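/- Let $M$ be a closed (compact, without boundary, Hausdorff) smooth three-manifold, let $2\le r\le\infty$, and let $\eta$ be a $C^r$ plane field on $M$, i.e. a rank-two $C^r$ subbundle of $TM$. Let $\Gamma^r(\eta)$ be the space of $C^r$ vector fields $X$ on $M$ with $X(p)\in\eta(p)$ for all $p\in M$, with the $C^r$ topology (uniform convergence, on compact subsets of charts, of all derivatives of finite order $\le r$). If $p$ is a zero of $X$ lying on a $C^1$ embedded curve $L$ of zeros of $X$, then $X$ is called transversally hyperbolic at $p$ if the endomorphism of the plane $T_pM/T_pL$ induced by the linearization $DX_p:T_pM\to T_pM$ has no complex eigenvalue with zero real part. Then there is a residual subset of $\Gamma^r(\eta)$ such that, for every $X$ in it, the fixed point set $\mathrm{Fix}(X)=\{p\in M: X(p)=0\}$ is a $C^r$ link $L$ (a finite, possibly empty, union of pairwise disjoint $C^r$ embedded circles in $M$), and $X$ is transversally hyperbolic at all but finitely many points $p\in L$. -/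

import Mathlib

open scoped Manifold ContDiff Topology UniformConvergence

noncomputable section

namespace PlaneFieldFlow

/-- Euclidean three-space, the model of all three-manifolds below. -/
abbrev E3 : Type := EuclideanSpace ℝ (Fin 3)

section Manifold

variable (M : Type*) [TopologicalSpace M] [ChartedSpace E3 M] [IsManifold (𝓡 3) ∞ M]

/-- A `C^r` plane field on a three-manifold: a field of two-dimensional subspaces of the tangent
spaces which is locally spanned by two `C^r` vector fields (a rank two `C^r` subbundle of `TM`). -/
structure PlaneField (r : ℕ∞) where
  /-- The plane at a point. -/
  plane : ∀ p : M, Submodule ℝ (TangentSpace (𝓡 3) p)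
  finrank_plane : ∀ p : M, Module.finrank ℝ (plane p) = 2
  exists_local_frame : ∀ p : M, ∃ U : Set M, IsOpen U ∧ p ∈ U ∧
    ∃ V W : ∀ q : M, TangentSpace (𝓡 3) q,
      ContMDiffOn (𝓡 3) (𝓡 3).tangent r (fun q ↦ (⟨q, V q⟩ : TangentBundle (𝓡 3) M)) U ∧
      ContMDiffOn (𝓡 3) (𝓡 3).tangent r (fun q ↦ (⟨q, W q⟩ : TangentBundle (𝓡 3) M)) U ∧
      ∀ q ∈ U, plane q = Submodule.span ℝ {V q, W q}

variable {M}

/-- `Γ^r(η)`: the `C^r` vector fields `X` on `M` with `X(p) ∈ η(p)` for all `p`. -/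
def PlaneField.Section {r : ℕ∞} (η : PlaneField M r) : Type _ :=
  {X : ContMDiffSection (𝓡 3) E3 (r : WithTop ℕ∞) (TangentSpace (𝓡 3) : M → Type) //
    ∀ p : M, X p ∈ η.plane p}

/-- The vector field underlying a section of a plane field. -/
def PlaneField.Section.field {r : ℕ∞} {η : PlaneField M r} (X : η.Section) (p : M) :
    TangentSpace (𝓡 3) p :=
  X.1 p

/-- The expression of a vector field in the preferred chart around `c`; it is meaningful on the
(open) target of that chart. -/
def localRep (X : ∀ q : M, TangentSpace (𝓡 3) q) (c : M) (y : E3) : E3 :=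
  (trivializationAt E3 (TangentSpace (𝓡 3)) c
    (⟨(chartAt E3 c).symm y, X ((chartAt E3 c).symm y)⟩ : TangentBundle (𝓡 3) M)).2

/-- The `C^r` topology on `Γ^r(η)`: uniform convergence, on compact subsets of chart domains, of
the chart expressions together with all their derivatives of finite order `k ≤ r`. -/
instance PlaneField.Section.instTopologicalSpace {r : ℕ∞} (η : PlaneField M r) :
    TopologicalSpace η.Section :=
  ⨅ (c : M) (k : ℕ) (_ : (k : ℕ∞) ≤ r),
    TopologicalSpace.induced
      (fun X : η.Section ↦
        UniformOnFun.ofFun {K : Set E3 | IsCompact K ∧ K ⊆ (chartAt E3 c).target}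
          (iteratedFDeriv ℝ k (localRep X.field c)))
      inferInstance

/-- The fixed point set of the flow of a vector field, i.e. its set of zeros. -/
def fixedPoints (X : ∀ q : M, TangentSpace (𝓡 3) q) : Set M :=
  {p | X p = 0}

/-- The linearization `DX_p : T_pM → T_pM` of a vector field, computed in the preferred chart
around `p` (the one through which Mathlib identifies `T_pM` with the model space).
At a zero of `X` it does not depend on the chart. -/
def linearization (X : ∀ q : M, TangentSpace (𝓡 3) q) (p : M) :
    TangentSpace (𝓡 3) p →ₗ[ℝ] TangentSpace (𝓡 3) p :=
  (fderiv ℝ (localRep X p) (chartAt E3 p p) : E3 →ₗ[ℝ] E3)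

instance instFiniteTangentSpace (p : M) : Module.Finite ℝ (TangentSpace (𝓡 3) p) :=
  inferInstanceAs (Module.Finite ℝ E3)

end Manifold

/-- A linear endomorphism of a finite-dimensional real vector space is hyperbolic (as the
generator of a linear flow) if none of its complex eigenvalues has zero real part. -/
def IsHyperbolicLinear {V : Type*} [AddCommGroup V] [Module ℝ V] [Module.Finite ℝ V]
    (B : V →ₗ[ℝ] V) : Prop :=
  ∀ μ : ℂ, (B.charpoly.map (algebraMap ℝ ℂ)).IsRoot μ → μ.re ≠ 0

section Manifold

variable {M : Type*} [TopologicalSpace M] [ChartedSpace E3 M] [IsManifold (𝓡 3) ∞ M]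

/-- Let `T` be the tangent line at `p` of a curve of zeros of `X`. Then `X` is transversally
hyperbolic at `p` if the endomorphism of the transverse plane `T_pM / T` induced by the
linearization of `X` at `p` is hyperbolic. -/
def IsTransversallyHyperbolicAt (X : ∀ q : M, TangentSpace (𝓡 3) q) (p : M)
    (T : Submodule ℝ (TangentSpace (𝓡 3) p)) : Prop :=
  ∃ h : T ≤ T.comap (linearization X p), IsHyperbolicLinear (T.mapQ T (linearization X p) h)

/-- A finite family of pairwise disjoint `C^r` embedded circles in `M`. The circle being compact,
an injective immersion of it into a Hausdorff manifold is an embedding. -/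
structure IsLinkParametrization (r : ℕ∞) {n : ℕ} (γ : Fin n → Circle → M) : Prop where
  contMDiff : ∀ i, ContMDiff (𝓡 1) (𝓡 3) r (γ i)
  injective : ∀ i, Function.Injective (γ i)
  immersion : ∀ i z, Function.Injective (mfderiv (𝓡 1) (𝓡 3) (γ i) z)
  disjoint : Pairwise fun i j ↦ Disjoint (Set.range (γ i)) (Set.range (γ j))

/-- The tangent line of a parametrized circle in `M` at the image of `z`. -/
def tangentLine (γ : Circle → M) (z : Circle) : Submodule ℝ (TangentSpace (𝓡 3) (γ z)) :=
  LinearMap.range (mfderiv (𝓡 1) (𝓡 3) γ z).toLinearMap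

/-- The zero set of `X` is a `C^r` link (a finite, possibly empty, disjoint union of embedded
circles), and `X` is transversally hyperbolic at all but finitely many points of this link. -/
def HasTransversallyHyperbolicLink (r : ℕ∞) (X : ∀ q : M, TangentSpace (𝓡 3) q) : Prop :=
  ∃ (n : ℕ) (γ : Fin n → Circle → M),
    IsLinkParametrization r γ ∧
    fixedPoints X = ⋃ i, Set.range (γ i) ∧
    {p : M | ∃ i z, γ i z = p ∧
      ¬ IsTransversallyHyperbolicAt X (γ i z) (tangentLine (γ i) z)}.Finite

end Manifold

end PlaneFieldFlow

end

/-! Let `D` be the linearization of `X` at a zero `p`. Differentiating the identity `ν · X = 0`,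
where `ν` is a form defining the plane field, shows that `D` takes values in `η(p)`; so its rank is
at most two. Two invariants of `D` matter: the trace and `secondInvariant`, equal to `tr(D)² -
tr(D²)`. If the kernel of `D` is the tangent line of the zero set, the transverse endomorphism has
the same trace, and its determinant is half the second invariant. An eigenvalue of a real 2×2 matrix
on the imaginary axis forces the trace or the determinant to vanish. It therefore suffices that the
kernel be a line at every zero and that both invariants be nonzero at all but finitely many zeros.

Both properties follow from one condition, `IsTransverseOn`: wherever `X = 0` and `σ(DX) = 0`, the
pair `(X, σ(DX))` has injective differential, for `σ` the trace and for `σ` the second invariant. As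
`X` has two independent components, these are three equations in three unknowns. Their solutions are
isolated, hence finite in number by compactness. The kernel is a line at every zero
(`finrank_ker_fderiv_eq_one`): a nonzero second invariant excludes a kernel of dimension two, and
where it vanishes its differential is injective on the kernel.

The condition is open on compact subsets of charts, since it concerns two-jets. Density comes from
parametric transversality (`exists_perturb_transverse`). Because equations and variables are equal
in number, it needs only the C¹ form of Sard's theorem, so `2 ≤ r` is enough. The required
perturbations change `D` by `l ⊗ w` with `w ∈ η(p)`. The trace then varies by `l(w)` and the second
invariant by `2 l(tr(D) w - D w)`. The latter can be made nonzero unless `D` vanishes on `η(p)`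
(`exists_mem_trace_smul_ne`). That degenerate case is first removed on an open dense set: it amounts
to at least four equations in three unknowns (`exists_local_dense_fderiv_ne_zero`).

When every kernel is a line, the implicit function theorem makes the zero set a union of C^r arcs. A
smooth immersion of `M` into a Euclidean space gives them arc length, which is unique up to sign and
translation, so the zero set is a compact space locally isometric to the line. Arcs extend to curves
defined on the whole line; compactness makes these periodic and leaves only finitely many
(`IsLocalArcs.exists_closed_geodesics`). Each of them descends to an embedded circle. -/

noncomputable section

namespace PlaneFieldFlow

/-! ### Linear algebra -/

section LinearAlgebra

variable {V : Type*} [AddCommGroup V] [Module ℝ V] [Module.Finite ℝ V]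

/-- Twice the second elementary symmetric function of the eigenvalues. -/
def secondInvariant (D : V →ₗ[ℝ] V) : ℝ :=
  LinearMap.trace ℝ V D ^ 2 - LinearMap.trace ℝ V (D ∘ₗ D)

/-- `D` factors through the quotient; `D` and the induced map are the two composites of the factor
with the projection, and the trace is invariant under swapping them. -/
theorem trace_mapQ_of_le_ker (D : V →ₗ[ℝ] V) (T : Submodule ℝ V) (hT : T ≤ LinearMap.ker D)
    (h : T ≤ T.comap D) :
    LinearMap.trace ℝ (V ⧸ T) (T.mapQ T D h) = LinearMap.trace ℝ V D := by
  have h1 : T.mapQ T D h = T.mkQ ∘ₗ T.liftQ D hT := by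
    apply Submodule.linearMap_qext; ext x; simp
  have h2 : D = T.liftQ D hT ∘ₗ T.mkQ := by ext x; simp
  rw [h1, LinearMap.trace_comp_comm', ← h2]

theorem secondInvariant_mapQ_of_le_ker (D : V →ₗ[ℝ] V) (T : Submodule ℝ V)
    (hT : T ≤ LinearMap.ker D) (h : T ≤ T.comap D) :
    secondInvariant (T.mapQ T D h) = secondInvariant D := by
  have hT2 : T ≤ LinearMap.ker (D ∘ₗ D) := fun x hx ↦ by
    have : D x = 0 := hT hx
    simp [this]
  have h2 : T ≤ T.comap (D ∘ₗ D) := fun x hx ↦ by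
    have : (D ∘ₗ D) x = 0 := hT2 hx
    rw [Submodule.mem_comap, this]; exact T.zero_mem
  have h3 : T.mapQ T D h ∘ₗ T.mapQ T D h = T.mapQ T (D ∘ₗ D) h2 := by
    apply Submodule.linearMap_qext; ext x; simp
  rw [secondInvariant, h3, trace_mapQ_of_le_ker D T hT, trace_mapQ_of_le_ker _ T hT2,
    secondInvariant]

theorem secondInvariant_eq_zero_of_finrank_le_one (h : Module.finrank ℝ V ≤ 1) (D : V →ₗ[ℝ] V) :
    secondInvariant D = 0 := by
  let b := Module.finBasis ℝ V
  rw [secondInvariant, LinearMap.trace_eq_matrix_trace ℝ b, LinearMap.trace_eq_matrix_trace ℝ b,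
    LinearMap.toMatrix_comp b b b]
  generalize LinearMap.toMatrix b b D = A
  clear_value b
  generalize Module.finrank ℝ V = n at *
  interval_cases n
  · simp
  · simp [Matrix.trace, Matrix.mul_apply]; ring

/-- In dimension two the second invariant is twice the determinant. A root `iy` of the
characteristic polynomial satisfies `y² = det` and `tr · y = 0`; a nonzero trace gives `y = 0`,
hence zero determinant. -/
theorem isHyperbolicLinear_of_finrank_eq_two (h : Module.finrank ℝ V = 2) (B : V →ₗ[ℝ] V)
    (h1 : LinearMap.trace ℝ V B ≠ 0) (h2 : secondInvariant B ≠ 0) : IsHyperbolicLinear B := by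
  let b := Module.finBasisOfFinrankEq ℝ V h
  rw [secondInvariant, LinearMap.trace_eq_matrix_trace ℝ b, LinearMap.trace_eq_matrix_trace ℝ b,
    LinearMap.toMatrix_comp b b b] at h2
  rw [LinearMap.trace_eq_matrix_trace ℝ b] at h1
  intro μ hμ hre
  rw [← LinearMap.charpoly_toMatrix B b] at hμ
  generalize LinearMap.toMatrix b b B = A at *
  rw [Matrix.charpoly_fin_two, Polynomial.IsRoot.def] at hμ
  simp only [Polynomial.map_add, Polynomial.map_sub, Polynomial.map_pow, Polynomial.map_X,
    Polynomial.map_mul, Polynomial.map_C, Polynomial.eval_add, Polynomial.eval_sub,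
    Polynomial.eval_pow, Polynomial.eval_X, Polynomial.eval_mul, Polynomial.eval_C] at hμ
  have hr := congrArg Complex.re hμ
  have hi := congrArg Complex.im hμ
  simp [pow_two, hre] at hr hi
  have hy : μ.im = 0 := by tauto
  have hd : A.det = 0 := by rw [hy] at hr; simpa using hr
  apply h2
  rw [Matrix.det_fin_two] at hd
  simp only [Matrix.trace_fin_two, Matrix.mul_apply, Fin.sum_univ_two]
  linear_combination 2 * hd

theorem isHyperbolicLinear_mapQ (hV : Module.finrank ℝ V = 3) (D : V →ₗ[ℝ] V) (T : Submodule ℝ V)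
    (hT : T ≤ LinearMap.ker D) (hT1 : Module.finrank ℝ T = 1) (h : T ≤ T.comap D)
    (h1 : LinearMap.trace ℝ V D ≠ 0) (h2 : secondInvariant D ≠ 0) :
    IsHyperbolicLinear (T.mapQ T D h) := by
  apply isHyperbolicLinear_of_finrank_eq_two
  · have := T.finrank_quotient_add_finrank; omega
  · rwa [trace_mapQ_of_le_ker D T hT]
  · rwa [secondInvariant_mapQ_of_le_ker D T hT]

/-- Passing to the quotient by the kernel preserves the second invariant, and a kernel of dimension
at least two leaves a quotient of dimension at most one, where the invariant vanishes. -/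
theorem finrank_ker_le_one_of_secondInvariant_ne_zero (hV : Module.finrank ℝ V = 3)
    (D : V →ₗ[ℝ] V) (h : secondInvariant D ≠ 0) : Module.finrank ℝ (LinearMap.ker D) ≤ 1 := by
  by_contra! h1
  apply h
  have h2 : LinearMap.ker D ≤ (LinearMap.ker D).comap D := fun x hx ↦ by
    have : D x = 0 := hx
    rw [Submodule.mem_comap, this]; exact Submodule.zero_mem _
  rw [← secondInvariant_mapQ_of_le_ker D _ le_rfl h2]
  apply secondInvariant_eq_zero_of_finrank_le_one
  have := (LinearMap.ker D).finrank_quotient_add_finrank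
  omega

/-- Since `D` maps into `P`, its trace is that of its restriction to `P`. If the restriction were
`tr(D) • id`, this would read `tr(D) = 2 tr(D)`, so `D` would vanish on `P`. This supplies a
direction in which the second invariant has nonzero derivative. -/
theorem exists_mem_trace_smul_ne (D : V →ₗ[ℝ] V) (P : Submodule ℝ V)
    (hP : Module.finrank ℝ P = 2) (hD : ∀ x, D x ∈ P) (h : ∃ v ∈ P, D v ≠ 0) :
    ∃ v ∈ P, LinearMap.trace ℝ V D • v ≠ D v := by
  by_contra! hc
  obtain ⟨v, hv, hDv⟩ := h
  have h1 : D.restrict (p := P) (q := P) (fun x _ ↦ hD x) =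
      LinearMap.trace ℝ V D • LinearMap.id := by
    ext x
    simp [hc x x.2]
  have h2 := LinearMap.trace_restrict_eq_of_forall_mem P D hD
  rw [h1, map_smul, LinearMap.trace_id, hP] at h2
  have h3 : LinearMap.trace ℝ V D = 0 := by
    simp at h2; linarith
  exact hDv (by rw [← hc v hv, h3, zero_smul])

theorem trace_conj_equiv {W : Type*} [AddCommGroup W] [Module ℝ W]
    [Module.Finite ℝ W] (D : V →ₗ[ℝ] V) (D' : W →ₗ[ℝ] W) (A : V →ₗ[ℝ] W) (A' : W →ₗ[ℝ] V)
    (h : A' ∘ₗ A = LinearMap.id) (hD : D' = A ∘ₗ D ∘ₗ A') :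
    LinearMap.trace ℝ W D' = LinearMap.trace ℝ V D := by
  rw [hD, LinearMap.trace_comp_comm', LinearMap.comp_assoc, h, LinearMap.comp_id]

theorem secondInvariant_conj_equiv {W : Type*} [AddCommGroup W] [Module ℝ W]
    [Module.Finite ℝ W] (D : V →ₗ[ℝ] V) (D' : W →ₗ[ℝ] W) (A : V →ₗ[ℝ] W) (A' : W →ₗ[ℝ] V)
    (h : A' ∘ₗ A = LinearMap.id) (hD : D' = A ∘ₗ D ∘ₗ A') :
    secondInvariant D' = secondInvariant D := by
  rw [secondInvariant, secondInvariant, trace_conj_equiv D D' A A' h hD,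
    trace_conj_equiv (D ∘ₗ D) (D' ∘ₗ D') A A' h]
  rw [hD]
  calc (A ∘ₗ D ∘ₗ A') ∘ₗ A ∘ₗ D ∘ₗ A' = A ∘ₗ D ∘ₗ (A' ∘ₗ A) ∘ₗ D ∘ₗ A' := by
        simp only [LinearMap.comp_assoc]
    _ = _ := by rw [h]; simp only [LinearMap.comp_assoc, LinearMap.id_comp]

end LinearAlgebra

/-! ### Parametric transversality in equal dimensions -/

section Sard

open MeasureTheory Set

variable {E : Type*} [NormedAddCommGroup E] [NormedSpace ℝ E] [FiniteDimensional ℝ E]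

/-- The equation `G(x, b) = 0` can be solved locally for the parameter as `b = β(x)`. At points of
`S` the differential of `β` is singular, because the partial differential of `G` in `x` is. Such
values of a differentiable map between spaces of equal dimension form a null set. -/
theorem exists_mem_nhds_measure_image_snd_eq_zero [MeasurableSpace E] [BorelSpace E]
    (μ : Measure E) [μ.IsAddHaarMeasure] {G : E × E → E} {G' : E × E → (E × E →L[ℝ] E)}
    {S : Set (E × E)} (hG : ∀ z ∈ S, G z = 0)
    (hG' : ∀ z ∈ S, HasStrictFDerivAt G (G' z) z)
    (h1 : ∀ z ∈ S, Function.Injective fun b ↦ G' z (0, b))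
    (h2 : ∀ z ∈ S, ¬ Function.Injective fun x ↦ G' z (x, 0)) {z : E × E} (hz : z ∈ S) :
    ∃ O ∈ 𝓝 z, μ (Prod.snd '' (S ∩ O)) = 0 := by
  let T : E × E → (E × E →L[ℝ] E × E) := fun z ↦ (ContinuousLinearMap.fst ℝ E E).prod (G' z)
  have hT : ∀ z ∈ S, ∃ e : (E × E) ≃L[ℝ] (E × E), (e : (E × E) →L[ℝ] (E × E)) = T z := by
    intro w hw
    have hinj : Function.Injective (T w : E × E →ₗ[ℝ] E × E) := by
      rw [injective_iff_map_eq_zero]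
      rintro ⟨x, b⟩ h
      have hx : x = 0 := congrArg Prod.fst h
      have hb : G' w (x, b) = 0 := congrArg Prod.snd h
      subst hx
      have : b = 0 := h1 w hw (by
        change G' w (0, b) = G' w (0, 0)
        rw [hb]; exact (map_zero (G' w)).symm)
      subst this; rfl
    refine ⟨(LinearEquiv.ofInjectiveEndo _ hinj).toContinuousLinearEquiv, ?_⟩
    exact ContinuousLinearMap.ext fun _ ↦ rfl
  obtain ⟨e, he⟩ := hT z hz
  have hθ : ∀ w ∈ S, HasStrictFDerivAt (fun w : E × E ↦ (w.1, G w)) (T w) w := fun w hw ↦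
    hasStrictFDerivAt_fst.prodMk (hG' w hw)
  have hθz := hθ z hz
  rw [← he] at hθz
  let θ := hθz.toOpenPartialHomeomorph
  have hθc : ∀ w, θ w = (w.1, G w) := fun w ↦ rfl
  refine ⟨θ.source, θ.open_source.mem_nhds hθz.mem_toOpenPartialHomeomorph_source, ?_⟩
  let β : E → E := fun x ↦ (θ.symm (x, 0)).2
  have hβ : ∀ w ∈ S ∩ θ.source, β w.1 = w.2 := by
    intro w hw
    have : θ.symm (w.1, 0) = w := by
      rw [← hG w hw.1, ← hθc w, θ.left_inv hw.2]
    simp only [β, this]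
  have himg : Prod.snd '' (S ∩ θ.source) = β '' (Prod.fst '' (S ∩ θ.source)) := by
    rw [image_image]
    exact image_congr fun w hw ↦ (hβ w hw).symm
  rw [himg]
  have hder : ∀ x ∈ Prod.fst '' (S ∩ θ.source), ∃ β' : E →L[ℝ] E,
      HasFDerivAt β β' x ∧ β'.det = 0 := by
    rintro _ ⟨w, hw, rfl⟩
    obtain ⟨f, hf⟩ := hT w hw.1
    have hsymm : θ.symm (w.1, 0) = w := by
      rw [← hG w hw.1, ← hθc w, θ.left_inv hw.2]
    have hmem : (w.1, (0 : E)) ∈ θ.target := by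
      rw [← hG w hw.1, ← hθc w]; exact θ.map_source hw.2
    have hd : HasFDerivAt θ.symm (f.symm : E × E →L[ℝ] E × E) (w.1, 0) := by
      apply θ.hasFDerivAt_symm hmem
      rw [hsymm, hf]
      exact (hθ w hw.1).hasFDerivAt
    have hd2 : HasFDerivAt β ((ContinuousLinearMap.snd ℝ E E).comp
        ((f.symm : E × E →L[ℝ] E × E).comp
          ((ContinuousLinearMap.id ℝ E).prod (0 : E →L[ℝ] E)))) w.1 :=
      hasFDerivAt_snd.comp _ (HasFDerivAt.comp (f := fun x : E ↦ (x, (0 : E))) w.1 hd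
        ((hasFDerivAt_id _).prodMk (hasFDerivAt_const _ _)))
    refine ⟨_, hd2, ?_⟩
    have hni := h2 w hw.1
    by_contra hdet
    apply hni
    have hinj := (LinearMap.equivOfDetNeZero _ hdet).injective
    have hlin : Function.Injective ((G' w).comp (ContinuousLinearMap.inl ℝ E E)) := by
      rw [injective_iff_map_eq_zero]
      intro x hx
      apply hinj
      -- A vector `x` killed by the partial differential is fixed, as `(x, 0)`, by the differential
      -- of `(x, b) ↦ (x, G(x, b))`; hence `β'` kills it.
      have h3 : f (x, 0) = (x, 0) := by
        have : f (x, 0) = T w (x, 0) := by rw [← hf]; rfl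
        rw [this]
        exact Prod.ext rfl hx
      have h4 : f.symm (x, 0) = (x, 0) := by rw [f.symm_apply_eq, h3]
      change (f.symm (x, 0)).2 = (f.symm (0, 0)).2
      rw [h4]
      exact (congrArg Prod.snd (map_zero f.symm)).symm
    exact hlin
  choose! β' hβ' hdet using hder
  exact addHaar_image_eq_zero_of_det_fderivWithin_eq_zero μ (f' := β')
    (fun x hx ↦ (hβ' x hx).hasFDerivWithinAt) hdet

theorem measure_image_snd_eq_zero [MeasurableSpace E] [BorelSpace E]
    (μ : Measure E) [μ.IsAddHaarMeasure] {G : E × E → E} {G' : E × E → (E × E →L[ℝ] E)}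
    {S : Set (E × E)} (hG : ∀ z ∈ S, G z = 0)
    (hG' : ∀ z ∈ S, HasStrictFDerivAt G (G' z) z)
    (h1 : ∀ z ∈ S, Function.Injective fun b ↦ G' z (0, b))
    (h2 : ∀ z ∈ S, ¬ Function.Injective fun x ↦ G' z (x, 0)) :
    μ (Prod.snd '' S) = 0 := by
  choose! O hO hμ using fun z (hz : z ∈ S) ↦
    exists_mem_nhds_measure_image_snd_eq_zero μ hG hG' h1 h2 hz
  obtain ⟨t, hts, htc, hcov⟩ := TopologicalSpace.countable_cover_nhdsWithin (f := O) (s := S)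
    fun z hz ↦ mem_nhdsWithin_of_mem_nhds (hO z hz)
  have : Prod.snd '' S ⊆ ⋃ z ∈ t, Prod.snd '' (S ∩ O z) := by
    rintro _ ⟨w, hw, rfl⟩
    obtain ⟨z, hz, hwz⟩ := mem_iUnion₂.1 (hcov hw)
    exact mem_iUnion₂.2 ⟨z, hz, w, ⟨hw, hwz⟩, rfl⟩
  exact measure_mono_null this ((measure_biUnion_null_iff htc).2 fun z hz ↦ hμ z (hts hz))

end Sard

/-! ### Compact spaces which are locally isometric to the line -/

section LocalArcs

open Set Filter

variable {M : Type*}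

/-- The curve `γ` is, near the parameter `s`, one of the arcs `δ` run through at unit speed. -/
def IsGeodesicAt (L : Set M) (δ : M → ℝ → M) (γ : ℝ → M) (s : ℝ) : Prop :=
  γ s ∈ L ∧ ∃ σ : ℝ, (σ = 1 ∨ σ = -1) ∧ ∀ᶠ u in 𝓝 (0 : ℝ), γ (s + u) = δ (γ s) (σ * u)

variable {L : Set M} {δ : M → ℝ → M} {γ γ' : ℝ → M} {s t : ℝ}

theorem tendsto_const_add_nhds_zero (s : ℝ) : Tendsto (fun u ↦ s + u) (𝓝 0) (𝓝 s) := by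
  have : Continuous fun u : ℝ ↦ s + u := by fun_prop
  simpa using this.tendsto 0

theorem tendsto_sub_const_nhds (s : ℝ) : Tendsto (fun u ↦ u - s) (𝓝 s) (𝓝 0) := by
  have : Continuous fun u : ℝ ↦ u - s := by fun_prop
  simpa using this.tendsto s

theorem tendsto_const_mul_nhds_zero (s : ℝ) : Tendsto (fun u ↦ s * u) (𝓝 0) (𝓝 0) := by
  have : Continuous fun u : ℝ ↦ s * u := by fun_prop
  simpa using this.tendsto 0

theorem IsGeodesicAt.congr (h : IsGeodesicAt L δ γ s) (hγ : γ =ᶠ[𝓝 s] γ') :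
    IsGeodesicAt L δ γ' s := by
  obtain ⟨hL, σ, hσ, hu⟩ := h
  have h0 := hγ.eq_of_nhds
  refine ⟨h0 ▸ hL, σ, hσ, ?_⟩
  filter_upwards [hu, (tendsto_const_add_nhds_zero s).eventually hγ] with u h1 h2
  rw [← h2, h1, h0]

theorem IsGeodesicAt.comp_affine {c κ : ℝ} (hκ : κ = 1 ∨ κ = -1)
    (h : IsGeodesicAt L δ γ (c + κ * s)) : IsGeodesicAt L δ (fun t ↦ γ (c + κ * t)) s := by
  obtain ⟨hL, σ, hσ, hu⟩ := h
  refine ⟨hL, σ * κ, ?_, ?_⟩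
  · rcases hσ with rfl | rfl <;> rcases hκ with rfl | rfl <;> simp
  · filter_upwards [(tendsto_const_mul_nhds_zero κ).eventually hu] with u h1
    rw [mul_add, ← add_assoc, h1, mul_assoc]

/-- The curve is continued past `c` by the geodesic of uniform length through `γ c`, after reversing
the latter if necessary. -/
theorem exists_extend_right {ε₀ : ℝ} (hε₀ : 0 < ε₀)
    (hun : ∀ q ∈ L, ∃ γ : ℝ → M, γ 0 = q ∧ ∀ s ∈ Ioo (-ε₀) ε₀, IsGeodesicAt L δ γ s)
    {a b c : ℝ} (hc : c ∈ Ioo a b) (hγ : ∀ s ∈ Ioo a b, IsGeodesicAt L δ γ s) :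
    ∃ γ' : ℝ → M, EqOn γ' γ (Iic c) ∧ ∀ s ∈ Ioo a (c + ε₀), IsGeodesicAt L δ γ' s := by
  obtain ⟨hL, σ, hσ, hu⟩ := hγ c hc
  obtain ⟨β, hβ0, hβ⟩ := hun _ hL
  obtain ⟨-, σ', hσ', hu'⟩ := hβ 0 ⟨by linarith, hε₀⟩
  simp only [zero_add, hβ0] at hu'
  have hκ : σ' * σ = 1 ∨ σ' * σ = -1 := by
    rcases hσ with rfl | rfl <;> rcases hσ' with rfl | rfl <;> simp
  have hσσ : σ' * σ' = 1 := by rcases hσ' with rfl | rfl <;> simp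
  -- The sign `σ' * σ` makes `β` run through the arc at `γ c` in the same direction as `γ`, so that
  -- the two germs at `c` coincide.
  let γ' : ℝ → M := fun t ↦ if t ≤ c then γ t else β (-(σ' * σ) * c + σ' * σ * t)
  have hbig : ∀ t, c < t → γ' t = β (-(σ' * σ) * c + σ' * σ * t) := fun t ht ↦ if_neg ht.not_ge
  have hcev : γ' =ᶠ[𝓝 c] γ := by
    filter_upwards [(tendsto_sub_const_nhds c).eventually hu,
      (tendsto_sub_const_nhds c).eventually
        ((tendsto_const_mul_nhds_zero (σ' * σ)).eventually hu')] with t h1 h2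
    rcases le_or_gt t c with htc | htc
    · exact if_pos htc
    · rw [hbig t htc]
      rw [add_sub_cancel] at h1
      rw [h1, show -(σ' * σ) * c + σ' * σ * t = σ' * σ * (t - c) by ring, h2,
        show σ' * (σ' * σ * (t - c)) = (σ' * σ') * (σ * (t - c)) by ring, hσσ, one_mul]
  refine ⟨γ', fun t ht ↦ if_pos ht, fun t ht ↦ ?_⟩
  rcases lt_trichotomy t c with htc | rfl | htc
  · refine (hγ t ⟨ht.1, htc.trans hc.2⟩).congr ?_
    filter_upwards [gt_mem_nhds htc] with x hx
    exact (if_pos hx.le).symm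
  · exact (hγ t hc).congr hcev.symm
  · have : IsGeodesicAt L δ (fun t ↦ β (-(σ' * σ) * c + σ' * σ * t)) t := by
      apply IsGeodesicAt.comp_affine hκ
      apply hβ
      have := ht.2
      rcases hκ with hk | hk <;> rw [hk] <;> constructor <;> linarith
    refine this.congr ?_
    filter_upwards [lt_mem_nhds htc] with x hx
    exact (hbig x hx).symm

theorem isGeodesicAt_neg_comp {a b : ℝ} (hγ : ∀ s ∈ Ioo a b, IsGeodesicAt L δ γ s) :
    ∀ s ∈ Ioo (-b) (-a), IsGeodesicAt L δ (fun t ↦ γ (-t)) s := by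
  intro s hs
  have := IsGeodesicAt.comp_affine (L := L) (δ := δ) (γ := γ) (s := s) (c := 0) (κ := -1)
    (Or.inr rfl) (by
      apply hγ
      obtain ⟨h1, h2⟩ := hs
      constructor <;> linarith)
  simpa using this

theorem exists_extend {ε₀ : ℝ} (hε₀ : 0 < ε₀)
    (hun : ∀ q ∈ L, ∃ γ : ℝ → M, γ 0 = q ∧ ∀ s ∈ Ioo (-ε₀) ε₀, IsGeodesicAt L δ γ s)
    {T : ℝ} (hT : ε₀ / 2 ≤ T) (hγ : ∀ s ∈ Ioo (-T) T, IsGeodesicAt L δ γ s) :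
    ∃ γ' : ℝ → M, γ' =ᶠ[𝓝 0] γ ∧
      ∀ s ∈ Ioo (-(T + ε₀ / 2)) (T + ε₀ / 2), IsGeodesicAt L δ γ' s := by
  -- Gluing at `T - ε₀ / 4` stays inside the old interval and reaches `T + 3 ε₀ / 4`, more than is
  -- needed. The left end is treated in the same way after a reflection.
  obtain ⟨γ₁, h1, h1'⟩ := exists_extend_right hε₀ hun (c := T - ε₀ / 4)
    ⟨by linarith, by linarith⟩ hγ
  have h2 := isGeodesicAt_neg_comp h1'
  obtain ⟨γ₂, h3, h3'⟩ := exists_extend_right hε₀ hun (c := T - ε₀ / 4)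
    ⟨by linarith, by linarith⟩ h2
  have h4 := isGeodesicAt_neg_comp h3'
  refine ⟨_, ?_, fun s hs ↦ h4 s ⟨by linarith [hs.1], by linarith [hs.2]⟩⟩
  have hpos : 0 < T - ε₀ / 4 := by linarith
  filter_upwards [Ioo_mem_nhds (neg_lt_zero.2 hpos) hpos] with x hx
  rw [h3 (by simp only [mem_Iic]; linarith [hx.1])]
  simp only [neg_neg]
  exact h1 hx.2.le

variable [TopologicalSpace M] {ε : M → ℝ}

/-- A family of parametrized arcs `δ p` in `L` around its points `p`, whose transition maps are
isometries of the line. -/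
structure IsLocalArcs (L : Set M) (δ : M → ℝ → M) (ε : M → ℝ) : Prop where
  pos : ∀ p ∈ L, 0 < ε p
  apply_zero : ∀ p ∈ L, δ p 0 = p
  mem : ∀ p ∈ L, ∀ s ∈ Ioo (-ε p) (ε p), δ p s ∈ L
  continuousOn : ∀ p ∈ L, ContinuousOn (δ p) (Ioo (-ε p) (ε p))
  injOn : ∀ p ∈ L, InjOn (δ p) (Ioo (-ε p) (ε p))
  image_mem : ∀ p ∈ L, ∀ η, 0 < η → η ≤ ε p → δ p '' Ioo (-η) η ∈ 𝓝[L] p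
  transition : ∀ p ∈ L, ∀ s ∈ Ioo (-ε p) (ε p),
    ∃ σ : ℝ, (σ = 1 ∨ σ = -1) ∧ ∀ᶠ u in 𝓝 (0 : ℝ), δ p (s + u) = δ (δ p s) (σ * u)

theorem IsLocalArcs.isGeodesicAt (h : IsLocalArcs L δ ε) {p : M} (hp : p ∈ L)
    (hs : s ∈ Ioo (-ε p) (ε p)) : IsGeodesicAt L δ (δ p) s :=
  ⟨h.mem p hp s hs, h.transition p hp s hs⟩

theorem IsLocalArcs.Ioo_mem (h : IsLocalArcs L δ ε) {p : M} (hp : p ∈ L) :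
    Ioo (-ε p) (ε p) ∈ 𝓝 (0 : ℝ) :=
  Ioo_mem_nhds (by have := h.pos p hp; linarith) (h.pos p hp)

theorem IsGeodesicAt.continuousAt (hγ : IsGeodesicAt L δ γ s) (h : IsLocalArcs L δ ε) :
    ContinuousAt γ s := by
  obtain ⟨hL, σ, hσ, hu⟩ := hγ
  have h1 : ContinuousAt (δ (γ s)) 0 := (h.continuousOn _ hL).continuousAt (h.Ioo_mem hL)
  have h2 : Tendsto (fun u ↦ δ (γ s) (σ * u)) (𝓝 0) (𝓝 (γ s)) := by
    have := h1.tendsto.comp (tendsto_const_mul_nhds_zero σ)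
    rwa [h.apply_zero _ hL] at this
  have h3 : Tendsto (fun u ↦ γ (s + u)) (𝓝 0) (𝓝 (γ s)) :=
    h2.congr' (hu.mono fun _ hx ↦ hx.symm)
  have h4 := h3.comp (tendsto_sub_const_nhds s)
  refine h4.congr fun x ↦ ?_
  simp

theorem IsGeodesicAt.exists_injOn (hγ : IsGeodesicAt L δ γ s) (h : IsLocalArcs L δ ε) :
    ∃ η > 0, ∀ u v, |u| < η → |v| < η → γ (s + u) = γ (s + v) → u = v := by
  obtain ⟨hL, σ, hσ, hu⟩ := hγ
  obtain ⟨η, hη, hball⟩ := Metric.eventually_nhds_iff.1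
    (hu.and ((tendsto_const_mul_nhds_zero σ).eventually (h.Ioo_mem hL)))
  refine ⟨η, hη, fun u v hu hv huv ↦ ?_⟩
  obtain ⟨h1, h2⟩ := hball (y := u) (by simpa using hu)
  obtain ⟨h3, h4⟩ := hball (y := v) (by simpa using hv)
  rw [h1, h3] at huv
  have := h.injOn _ hL h2 h4 huv
  rcases hσ with rfl | rfl <;> linarith

/-- This makes the range of a geodesic open in `L`, which is what allows compactness to bound the
number of closed geodesics. -/
theorem IsGeodesicAt.image_mem (hγ : IsGeodesicAt L δ γ s) (h : IsLocalArcs L δ ε) {η : ℝ}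
    (hη : 0 < η) : γ '' Ioo (s - η) (s + η) ∈ 𝓝[L] (γ s) := by
  obtain ⟨hL, σ, hσ, hu⟩ := hγ
  obtain ⟨η', hη', hball⟩ := Metric.eventually_nhds_iff.1 hu
  have hε := h.pos _ hL
  have hpos : 0 < min (min η η') (ε (γ s)) := by positivity
  filter_upwards [h.image_mem _ hL _ hpos (min_le_right _ _)]
  rintro _ ⟨u, hu, rfl⟩
  have hu' : |u| < min (min η η') (ε (γ s)) := abs_lt.2 hu
  have hσu : |σ * u| = |u| := by
    rcases hσ with rfl | rfl <;> simp
  have h1 : |σ * u| < η := by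
    rw [hσu]; exact hu'.trans_le ((min_le_left _ _).trans (min_le_left _ _))
  have h2 : |σ * u| < η' := by
    rw [hσu]; exact hu'.trans_le ((min_le_left _ _).trans (min_le_right _ _))
  refine ⟨s + σ * u, ?_, ?_⟩
  · rw [abs_lt] at h1; constructor <;> linarith
  · rw [hball (by simpa using h2), ← mul_assoc]
    rcases hσ with rfl | rfl <;> simp

/-- The set where the two germs agree is open, and it is closed in `I`. At a limit point the values
agree and both curves follow the same arc; opposite directions would let them meet only at that
point itself, by injectivity of the arc. -/
theorem eqOn_of_isGeodesicAt [T2Space M] (h : IsLocalArcs L δ ε) {I : Set ℝ}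
    (hI : IsPreconnected I) (h1 : ∀ s ∈ I, IsGeodesicAt L δ γ s)
    (h2 : ∀ s ∈ I, IsGeodesicAt L δ γ' s) (hs : s ∈ I) (heq : γ =ᶠ[𝓝 s] γ') : EqOn γ γ' I := by
  have key : I ⊆ {s | γ =ᶠ[𝓝 s] γ'} := by
    refine hI.subset_of_closure_inter_subset ?_ ⟨s, hs, heq⟩ ?_
    · exact isOpen_iff_mem_nhds.2 fun t ht ↦ eventually_eventually_nhds.2 ht
    · rintro t ⟨htc, htI⟩
      by_contra hnot
      have hfr : ∃ᶠ x in 𝓝 t, γ =ᶠ[𝓝 x] γ' := mem_closure_iff_frequently.1 htc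
      have hval : γ t = γ' t :=
        tendsto_nhds_unique_of_frequently_eq ((h1 t htI).continuousAt h)
          ((h2 t htI).continuousAt h) (hfr.mono fun x hx ↦ hx.eq_of_nhds)
      obtain ⟨hL, σ, hσ, hu⟩ := h1 t htI
      obtain ⟨-, σ', hσ', hu'⟩ := h2 t htI
      rw [← hval] at hu'
      have hev := (tendsto_sub_const_nhds t).eventually (hu.and (hu'.and
        (((tendsto_const_mul_nhds_zero σ).eventually (h.Ioo_mem hL)).and
        ((tendsto_const_mul_nhds_zero σ').eventually (h.Ioo_mem hL)))))
      by_cases hσσ : σ = σ'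
      · apply hnot
        subst hσσ
        filter_upwards [hev] with x hx
        obtain ⟨ha, hb, -⟩ := hx
        rw [add_sub_cancel] at ha hb
        rw [ha, hb]
      · obtain ⟨x, hx, ha, hb, hc, hd⟩ := (hfr.and_eventually hev).exists
        rw [add_sub_cancel] at ha hb
        have := h.injOn _ hL hc hd (by rw [← ha, ← hb]; exact hx.eq_of_nhds)
        have hxt : x = t := by
          rcases hσ with rfl | rfl <;> rcases hσ' with rfl | rfl <;>
            first | exact absurd rfl hσσ | linarith
        rw [hxt] at hx
        exact hnot hx
  exact fun t ht ↦ (key ht).eq_of_nhds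

/-- Every point on the inner half of the arc at `p` has a geodesic of length `ε p / 2` on each side,
namely the shifted arc. Finitely many inner halves cover `L`. -/
theorem IsLocalArcs.exists_uniform (h : IsLocalArcs L δ ε) (hL : IsCompact L) :
    ∃ ε₀ > 0, ∀ q ∈ L, ∃ γ : ℝ → M, γ 0 = q ∧ ∀ s ∈ Ioo (-ε₀) ε₀, IsGeodesicAt L δ γ s := by
  refine hL.induction_on (p := fun S ↦ ∃ ε₀ > 0, ∀ q ∈ S, ∃ γ : ℝ → M, γ 0 = q ∧
    ∀ s ∈ Ioo (-ε₀) ε₀, IsGeodesicAt L δ γ s) ⟨1, one_pos, by simp⟩ ?_ ?_ ?_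
  · rintro S S' hS ⟨e, he, hq⟩
    exact ⟨e, he, fun q hqS ↦ hq q (hS hqS)⟩
  · rintro S S' ⟨e, he, hq⟩ ⟨e', he', hq'⟩
    refine ⟨min e e', lt_min he he', ?_⟩
    rintro q (hqS | hqS)
    · obtain ⟨γ, h0, hγ⟩ := hq q hqS
      exact ⟨γ, h0, fun s hs ↦ hγ s (Ioo_subset_Ioo (neg_le_neg (min_le_left _ _))
        (min_le_left _ _) hs)⟩
    · obtain ⟨γ, h0, hγ⟩ := hq' q hqS
      exact ⟨γ, h0, fun s hs ↦ hγ s (Ioo_subset_Ioo (neg_le_neg (min_le_right _ _))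
        (min_le_right _ _) hs)⟩
  · intro p hp
    have hpos := h.pos p hp
    refine ⟨_, h.image_mem p hp (ε p / 2) (by linarith) (by linarith), ε p / 2, by linarith, ?_⟩
    rintro _ ⟨s, hs, rfl⟩
    refine ⟨fun u ↦ δ p (s + 1 * u), by simp, fun u hu ↦ ?_⟩
    apply IsGeodesicAt.comp_affine (Or.inl rfl)
    apply h.isGeodesicAt hp
    obtain ⟨h1, h2⟩ := hs
    obtain ⟨h3, h4⟩ := hu
    constructor <;> linarith

theorem IsLocalArcs.exists_global [T2Space M] (h : IsLocalArcs L δ ε) (hL : IsCompact L) {p : M}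
    (hp : p ∈ L) : ∃ Γ : ℝ → M, Γ 0 = p ∧ ∀ s, IsGeodesicAt L δ Γ s := by
  obtain ⟨ε₀, hε₀, hun⟩ := h.exists_uniform hL
  obtain ⟨β, hβ0, hβ⟩ := hun p hp
  have hex : ∀ n : ℕ, ∃ γ : ℝ → M, γ =ᶠ[𝓝 0] β ∧
      ∀ s ∈ Ioo (-((n + 1 : ℝ) * (ε₀ / 2))) ((n + 1 : ℝ) * (ε₀ / 2)), IsGeodesicAt L δ γ s := by
    intro n
    induction n with
    | zero =>
      refine ⟨β, EventuallyEq.rfl, fun s hs ↦ hβ s ?_⟩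
      obtain ⟨h1, h2⟩ := hs
      constructor <;> norm_num at h1 h2 <;> linarith
    | succ n ih =>
      obtain ⟨γ, h1, h2⟩ := ih
      obtain ⟨γ', h3, h4⟩ := exists_extend hε₀ hun (T := (n + 1 : ℝ) * (ε₀ / 2))
        (by nlinarith [(Nat.cast_nonneg n : (0 : ℝ) ≤ n)]) h2
      refine ⟨γ', h3.trans h1, ?_⟩
      have : (((n + 1 : ℕ) : ℝ) + 1) * (ε₀ / 2) = (n + 1 : ℝ) * (ε₀ / 2) + ε₀ / 2 := by
        push_cast; ring
      rwa [this]
  choose g hg0 hg using hex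
  have hle : ∀ m n : ℕ, m ≤ n → ∀ t, |t| < (m + 1 : ℝ) * (ε₀ / 2) → g m t = g n t := by
    intro m n hmn t ht
    have hmn' : (m + 1 : ℝ) * (ε₀ / 2) ≤ (n + 1 : ℝ) * (ε₀ / 2) := by
      have : (m : ℝ) ≤ n := Nat.cast_le.2 hmn
      nlinarith
    refine eqOn_of_isGeodesicAt h isPreconnected_Ioo (hg m) (s := 0)
      (fun s hs ↦ hg n s (Ioo_subset_Ioo (neg_le_neg hmn') hmn' hs)) ?_
      ((hg0 m).trans (hg0 n).symm) (abs_lt.1 ht)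
    have : 0 < (m + 1 : ℝ) * (ε₀ / 2) := by positivity
    exact ⟨by linarith, this⟩
  -- The index `⌈|t| / (ε₀ / 2)⌉₊` selects, for each `t`, an approximation whose domain contains
  -- `t`; by uniqueness any larger index gives the same value.
  have hlt : ∀ t : ℝ, |t| < ((⌈|t| / (ε₀ / 2)⌉₊ : ℝ) + 1) * (ε₀ / 2) := by
    intro t
    have h1 := Nat.le_ceil (|t| / (ε₀ / 2))
    have h2 : |t| / (ε₀ / 2) * (ε₀ / 2) = |t| := by field_simp
    nlinarith
  have hΓ : ∀ n : ℕ, ∀ t, |t| < (n + 1 : ℝ) * (ε₀ / 2) → g ⌈|t| / (ε₀ / 2)⌉₊ t = g n t := by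
    intro n t ht
    rcases le_total n ⌈|t| / (ε₀ / 2)⌉₊ with hn | hn
    · exact (hle _ _ hn t ht).symm
    · exact hle _ _ hn t (hlt t)
  refine ⟨fun t ↦ g ⌈|t| / (ε₀ / 2)⌉₊ t, ?_, fun s ↦ ?_⟩
  · change g ⌈|(0 : ℝ)| / (ε₀ / 2)⌉₊ 0 = p
    rw [hΓ 0 0 (by simp; linarith), (hg0 0).eq_of_nhds, hβ0]
  · have hs := hlt s
    refine (hg _ s (abs_lt.1 hs)).congr ?_
    have : ∀ᶠ t : ℝ in 𝓝 s, |t| < ((⌈|s| / (ε₀ / 2)⌉₊ : ℝ) + 1) * (ε₀ / 2) :=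
      continuous_abs.continuousAt.eventually (gt_mem_nhds hs)
    filter_upwards [this] with t ht
    exact (hΓ _ t ht).symm

theorem exists_eq_comp_affine [T2Space M] (h : IsLocalArcs L δ ε)
    (h1 : ∀ s, IsGeodesicAt L δ γ s) (h2 : ∀ s, IsGeodesicAt L δ γ' s) (hst : γ s = γ' t) :
    ∃ σ : ℝ, (σ = 1 ∨ σ = -1) ∧ ∀ u, γ' (t + u) = γ (s + σ * u) := by
  obtain ⟨hL, σ, hσ, hu⟩ := h1 s
  obtain ⟨-, σ', hσ', hu'⟩ := h2 t
  have hκ : σ * σ' = 1 ∨ σ * σ' = -1 := by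
    rcases hσ with rfl | rfl <;> rcases hσ' with rfl | rfl <;> simp
  have hσσ : σ * σ = 1 := by rcases hσ with rfl | rfl <;> simp
  refine ⟨σ * σ', hκ, fun u ↦ ?_⟩
  have h3 : ∀ v, IsGeodesicAt L δ (fun u ↦ γ' (t + 1 * u)) v := fun v ↦
    (h2 _).comp_affine (Or.inl rfl)
  have h4 : ∀ v, IsGeodesicAt L δ (fun u ↦ γ (s + σ * σ' * u)) v := fun v ↦
    (h1 _).comp_affine hκ
  have := eqOn_of_isGeodesicAt h isPreconnected_univ (fun s _ ↦ h3 s) (fun s _ ↦ h4 s)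
    (mem_univ 0) (by
      filter_upwards [hu', (tendsto_const_mul_nhds_zero (σ * σ')).eventually hu] with v hv hv'
      rw [hv', one_mul, hv, hst, ← mul_assoc, ← mul_assoc, hσσ, one_mul]) (mem_univ u)
  simpa using this

/-- The points `γ n` accumulate at some `q`, so a short geodesic through `q` is visited at two
integer times that are far apart. It is a reparametrized piece of `γ`, so it gives a second, much
closer time for the same point. -/
theorem exists_return [T2Space M] (h : IsLocalArcs L δ ε) (hL : IsCompact L)
    (h1 : ∀ s, IsGeodesicAt L δ γ s) : ∃ s t, s ≠ t ∧ γ s = γ t := by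
  obtain ⟨q, hq, hcl⟩ := hL.exists_mapClusterPt (f := atTop) (u := fun n : ℕ ↦ γ n)
    (tendsto_principal.2 (Eventually.of_forall fun n : ℕ ↦ (h1 n).1))
  obtain ⟨β, hβ0, hβ⟩ := h.exists_global hL hq
  have hnh := (hβ 0).image_mem h one_pos
  rw [hβ0, zero_sub, zero_add, mem_nhdsWithin_iff_exists_mem_nhds_inter] at hnh
  obtain ⟨U, hU, hUs⟩ := hnh
  have hfr : ∃ᶠ n : ℕ in atTop, γ n ∈ β '' Ioo (-1) 1 :=
    (hcl.frequently hU).mono fun n hn ↦ hUs ⟨hn, (h1 n).1⟩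
  obtain ⟨n₀, t₀, ht₀, hn₀⟩ := hfr.exists
  -- Two parameters in `(-1, 1)` differ by less than 2, so a gap of 3 between the integer times
  -- guarantees distinct parameters.
  obtain ⟨n, ⟨t, ht, hnt⟩, hn⟩ := (hfr.and_eventually (eventually_ge_atTop (n₀ + 3))).exists
  obtain ⟨σ, hσ, hu⟩ := exists_eq_comp_affine h h1 hβ hn₀.symm
  refine ⟨n, n₀ + σ * (t - t₀), ?_, ?_⟩
  · have hn' : (n₀ : ℝ) + 3 ≤ n := by exact_mod_cast hn
    obtain ⟨h3, h4⟩ := ht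
    obtain ⟨h5, h6⟩ := ht₀
    rcases hσ with rfl | rfl <;> intro hc <;> linarith
  · rw [← hu, add_sub_cancel, hnt]

/-- Near the two parameters `γ` agrees with itself up to a translation or a reflection, globally by
uniqueness. A reflection would fold `γ` at the midpoint `(s + t) / 2`, against local injectivity. -/
theorem sub_mem_periods [T2Space M] (h : IsLocalArcs L δ ε) (h1 : ∀ s, IsGeodesicAt L δ γ s)
    (hst : γ s = γ t) (u : ℝ) : γ (u + (t - s)) = γ u := by
  obtain ⟨σ, hσ, hu⟩ := exists_eq_comp_affine h h1 h1 hst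
  rcases hσ with rfl | rfl
  · have := hu (u - s)
    rw [one_mul, add_sub_cancel] at this
    rw [← this]; congr 1; ring
  · exfalso
    obtain ⟨η, hη, hinj⟩ := (h1 ((s + t) / 2)).exists_injOn h
    have h3 : |η / 2| < η := by rw [abs_of_pos (by linarith)]; linarith
    have := hinj (η / 2) (-(η / 2)) h3 (by rwa [abs_neg]) (by
      have := hu ((s + t) / 2 - t + η / 2)
      rw [show t + ((s + t) / 2 - t + η / 2) = (s + t) / 2 + η / 2 by ring] at this
      rw [this]; congr 1; ring)
    linarith

/-- The periods form a subgroup of the line. Local injectivity isolates zero in it, so it is cyclic,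
and it is nontrivial because `γ` returns. -/
theorem exists_period [T2Space M] (h : IsLocalArcs L δ ε) (hL : IsCompact L)
    (h1 : ∀ s, IsGeodesicAt L δ γ s) :
    ∃ P > 0, ∀ s t, γ s = γ t ↔ ∃ k : ℤ, t = s + k * P := by
  let H : AddSubgroup ℝ :=
    { carrier := {c | ∀ u, γ (u + c) = γ u}
      add_mem' := fun {a b} ha hb u ↦ by rw [← add_assoc, hb, ha]
      zero_mem' := fun u ↦ by rw [add_zero]
      neg_mem' := fun {a} ha u ↦ by rw [← ha (u + -a), neg_add_cancel_right] }
  have hmem : ∀ s t, γ s = γ t ↔ t - s ∈ H := fun s t ↦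
    ⟨fun hst u ↦ sub_mem_periods h h1 hst u, fun hc ↦ by
      have := hc s
      rw [add_sub_cancel] at this
      exact this.symm⟩
  obtain ⟨η, hη, hinj⟩ := (h1 0).exists_injOn h
  obtain ⟨b, hb⟩ := AddSubgroup.cyclic_of_isolated_zero (H := H) hη (by
    rw [disjoint_left]
    intro c hc hc'
    have := hinj c 0 (by rw [abs_of_pos hc'.1]; exact hc'.2) (by simpa using hη) (by
      rw [hc 0, add_zero])
    exact hc'.1.ne' this)
  have hHb : ∀ c, c ∈ H ↔ ∃ k : ℤ, c = k * b := by
    intro c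
    rw [hb, AddSubgroup.mem_closure_singleton]
    simp only [zsmul_eq_mul, eq_comm]
  have hb0 : b ≠ 0 := by
    rintro rfl
    obtain ⟨s, t, hne, hst⟩ := exists_return h hL h1
    obtain ⟨k, hk⟩ := (hHb _).1 ((hmem s t).1 hst)
    rw [mul_zero] at hk
    exact hne (by linarith)
  refine ⟨|b|, abs_pos.2 hb0, fun s t ↦ ?_⟩
  rw [hmem, hHb]
  rcases abs_choice b with hab | hab <;> rw [hab]
  · exact exists_congr fun k ↦ ⟨fun hk ↦ by linarith, fun hk ↦ by linarith⟩
  · constructor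
    · rintro ⟨k, hk⟩; exact ⟨-k, by push_cast; linarith⟩
    · rintro ⟨k, hk⟩; exact ⟨-k, by push_cast; linarith⟩

/-- A compact set with local arcs is a finite disjoint union of closed geodesics. -/
theorem IsLocalArcs.exists_closed_geodesics [T2Space M] (h : IsLocalArcs L δ ε)
    (hL : IsCompact L) :
    ∃ (n : ℕ) (Γ : Fin n → ℝ → M) (P : Fin n → ℝ), (∀ i, 0 < P i) ∧
      (∀ i s, IsGeodesicAt L δ (Γ i) s) ∧
      (∀ i s t, Γ i s = Γ i t ↔ ∃ k : ℤ, t = s + k * P i) ∧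
      (Pairwise fun i j ↦ Disjoint (range (Γ i)) (range (Γ j))) ∧ L = ⋃ i, range (Γ i) := by
  choose! Γ hΓ0 hΓ using fun p (hp : p ∈ L) ↦ h.exists_global hL hp
  obtain ⟨t, htL, htc⟩ := hL.elim_nhdsWithin_subcover (fun p ↦ range (Γ p)) fun p hp ↦ by
    have := (hΓ p hp 0).image_mem h one_pos
    rw [hΓ0 p hp] at this
    exact mem_of_superset this (image_subset_range _ _)
  classical
  -- Indexing by ranges rather than base points counts each closed curve once.
  let R : Finset (Set M) := t.image fun p ↦ range (Γ p)
  have hR : ∀ r : R, ∃ p ∈ L, (r : Set M) = range (Γ p) := by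
    rintro ⟨r, hr⟩
    obtain ⟨p, hp, rfl⟩ := Finset.mem_image.1 hr
    exact ⟨p, htL p hp, rfl⟩
  choose c hcL hc using hR
  have hP := fun r : R ↦ exists_period h hL (hΓ _ (hcL r))
  choose P hP0 hP using hP
  let e := R.equivFin.symm
  refine ⟨R.card, fun i ↦ Γ (c (e i)), fun i ↦ P (e i), fun i ↦ hP0 _, fun i ↦ hΓ _ (hcL _),
    fun i ↦ hP _, ?_, ?_⟩
  · intro i j hij
    by_contra hnd
    obtain ⟨_, ⟨s, rfl⟩, s', hs'⟩ := not_disjoint_iff.1 hnd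
    obtain ⟨σ, hσ, hu⟩ := exists_eq_comp_affine h (hΓ _ (hcL (e i))) (hΓ _ (hcL (e j))) hs'.symm
    apply hij
    apply e.injective
    apply Subtype.ext
    rw [hc (e i), hc (e j)]
    have hσσ : σ * σ = 1 := by rcases hσ with rfl | rfl <;> simp
    apply Subset.antisymm
    · rintro _ ⟨x, rfl⟩
      refine ⟨s' + σ * (x - s), ?_⟩
      rw [hu, ← mul_assoc, hσσ, one_mul, add_sub_cancel]
    · rintro _ ⟨x, rfl⟩
      refine ⟨s + σ * (x - s'), ?_⟩
      rw [← hu, add_sub_cancel]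
  · apply Subset.antisymm
    · intro x hx
      obtain ⟨p, hp, hxp⟩ := mem_iUnion₂.1 (htc hx)
      have hm : range (Γ p) ∈ R := Finset.mem_image_of_mem _ hp
      refine mem_iUnion.2 ⟨e.symm ⟨_, hm⟩, ?_⟩
      rw [← hc, e.apply_symm_apply]
      exact hxp
    · refine iUnion_subset fun i ↦ ?_
      rintro _ ⟨s, rfl⟩
      exact (hΓ _ (hcL _) s).1

end LocalArcs

/-! ### Vector fields in charts -/

section Charts

open Set Filter

/-- In the product rule the term containing the derivative of `B` is multiplied by `u x = 0`, so
continuity of `B` suffices. It is applied to coordinate changes and to defining forms of the plane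
field. -/
theorem hasFDerivAt_clm_apply_of_eq_zero {E F G : Type*} [NormedAddCommGroup E] [NormedSpace ℝ E]
    [NormedAddCommGroup F] [NormedSpace ℝ F] [NormedAddCommGroup G] [NormedSpace ℝ G]
    {B : E → F →L[ℝ] G} {u : E → F} {u' : E →L[ℝ] F} {x : E} (hB : ContinuousAt B x)
    (hu : HasFDerivAt u u' x) (h0 : u x = 0) :
    HasFDerivAt (fun y ↦ B y (u y)) ((B x).comp u') x := by
  have h1 : HasFDerivAt (fun y ↦ B x (u y)) ((B x).comp u') x := (B x).hasFDerivAt.comp x hu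
  have h2 : HasFDerivAt (fun y ↦ (B y - B x) (u y)) (0 : E →L[ℝ] G) x := by
    rw [hasFDerivAt_iff_isLittleO]
    have h3 : (fun y ↦ B y - B x) =o[𝓝 x] fun _ ↦ (1 : ℝ) := by
      rw [Asymptotics.isLittleO_one_iff]
      simpa using hB.tendsto.sub_const (B x)
    have h4 : u =O[𝓝 x] fun y ↦ ‖y - x‖ := by
      have := hu.isBigO_sub
      simp only [h0, sub_zero] at this
      exact this.norm_right
    have h5 : (fun y ↦ (B y - B x) (u y)) =O[𝓝 x] fun y ↦ ‖B y - B x‖ * ‖u y‖ :=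
      Asymptotics.isBigO_of_le _ fun y ↦ by
        rw [norm_mul, norm_norm, norm_norm]; exact (B y - B x).le_opNorm _
    have h6 := h5.trans_isLittleO (h3.norm_left.mul_isBigO h4.norm_left)
    simp only [one_mul] at h6
    simpa [h0] using h6.of_norm_right
  have := h1.add h2
  rw [add_zero] at this
  refine this.congr_of_eventuallyEq (Eventually.of_forall fun y ↦ ?_)
  simp

variable {M : Type*} [TopologicalSpace M] [ChartedSpace E3 M] [IsManifold (𝓡 3) ∞ M]

theorem localRep_eq (X : ∀ q : M, TangentSpace (𝓡 3) q) (c : M) (y : E3) :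
    localRep X c y = tangentCoordChange (𝓡 3) ((chartAt E3 c).symm y) c ((chartAt E3 c).symm y)
      (X ((chartAt E3 c).symm y)) := by
  rw [localRep, TangentBundle.trivializationAt_apply]; rfl

theorem localRep_chartAt (X : ∀ q : M, TangentSpace (𝓡 3) q) {c p : M}
    (hp : p ∈ (chartAt E3 c).source) :
    localRep X c (chartAt E3 c p) = tangentCoordChange (𝓡 3) p c p (X p) := by
  rw [localRep_eq, (chartAt E3 c).left_inv hp]

theorem tangentCoordChange_comp_self {c c' p : M} (hc : p ∈ (chartAt E3 c).source)
    (hc' : p ∈ (chartAt E3 c').source) (v : E3) :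
    tangentCoordChange (𝓡 3) c' c p (tangentCoordChange (𝓡 3) c c' p v) = v := by
  rw [tangentCoordChange_comp, tangentCoordChange_self] <;> simp [hc, hc']

theorem localRep_eq_zero_iff (X : ∀ q : M, TangentSpace (𝓡 3) q) {c p : M}
    (hp : p ∈ (chartAt E3 c).source) : localRep X c (chartAt E3 c p) = 0 ↔ X p = 0 := by
  rw [localRep_chartAt X hp]
  constructor
  · intro h
    have := tangentCoordChange_comp_self (mem_chart_source E3 p) hp (X p)
    rw [h, map_zero] at this
    exact this.symm
  · intro h
    rw [h]; exact map_zero _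

theorem localRep_change (X : ∀ q : M, TangentSpace (𝓡 3) q) {c c' p : M}
    (hc : p ∈ (chartAt E3 c).source) (hc' : p ∈ (chartAt E3 c').source) :
    localRep X c (chartAt E3 c p) =
      tangentCoordChange (𝓡 3) c' c p (localRep X c' (chartAt E3 c' p)) := by
  rw [localRep_chartAt X hc, localRep_chartAt X hc']
  exact (tangentCoordChange_comp (I := 𝓡 3) (v := X p) (by simp [hc, hc'])).symm

theorem contDiffOn_localRep {X : ∀ q : M, TangentSpace (𝓡 3) q} {n : ℕ∞} {U : Set M}
    (hU : IsOpen U)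
    (hX : ContMDiffOn (𝓡 3) (𝓡 3).tangent n (fun q ↦ (⟨q, X q⟩ : TangentBundle (𝓡 3) M)) U)
    (c : M) : ContDiffOn ℝ n (localRep X c)
      ((chartAt E3 c).target ∩ (chartAt E3 c).symm ⁻¹' U) := by
  have h1 : ContMDiffOn (𝓡 3) 𝓘(ℝ, E3) n
      (fun q ↦ (trivializationAt E3 (TangentSpace (𝓡 3)) c
        (⟨q, X q⟩ : TangentBundle (𝓡 3) M)).2) (U ∩ (chartAt E3 c).source) := by
    refine (Bundle.Trivialization.contMDiffOn_section_iff _ (hU.inter (chartAt E3 c).open_source)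
      ?_).1 (hX.mono inter_subset_left)
    rw [TangentBundle.trivializationAt_baseSet]
    exact inter_subset_right
  have h2 := h1.comp ((contMDiffOn_chart_symm (I := 𝓡 3) (n := (n : ℕ∞ω)) (x := c)).of_le
    le_rfl |>.mono inter_subset_left) (t := U ∩ (chartAt E3 c).source)
    (s := (chartAt E3 c).target ∩ (chartAt E3 c).symm ⁻¹' U)
    (fun y hy ↦ ⟨hy.2, (chartAt E3 c).map_target hy.1⟩)
  exact contMDiffOn_iff_contDiffOn.1 h2

theorem hasFDerivAt_coord_change {c c' p : M} (hc : p ∈ (chartAt E3 c).source)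
    (hc' : p ∈ (chartAt E3 c').source) :
    HasFDerivAt (fun y ↦ chartAt E3 c' ((chartAt E3 c).symm y))
      (tangentCoordChange (𝓡 3) c c' p) (chartAt E3 c p) := by
  have := hasFDerivWithinAt_tangentCoordChange (I := 𝓡 3) (x := c) (y := c') (z := p)
    (by simp [hc, hc'])
  simpa [Function.comp_def, hasFDerivWithinAt_univ] using this

/-- At a zero, the linearizations of a vector field in two charts are conjugate. -/
theorem hasFDerivAt_localRep_change {X : ∀ q : M, TangentSpace (𝓡 3) q} {c c' p : M}
    (hc : p ∈ (chartAt E3 c).source) (hc' : p ∈ (chartAt E3 c').source) (hp : X p = 0)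
    {D : E3 →L[ℝ] E3} (hD : HasFDerivAt (localRep X c') D (chartAt E3 c' p)) :
    HasFDerivAt (localRep X c) ((tangentCoordChange (𝓡 3) c' c p).comp
      (D.comp (tangentCoordChange (𝓡 3) c c' p))) (chartAt E3 c p) := by
  have hinv := (chartAt E3 c).left_inv hc
  have hsymm : ContinuousAt (chartAt E3 c).symm (chartAt E3 c p) :=
    (chartAt E3 c).continuousAt_symm ((chartAt E3 c).map_source hc)
  have hB : ContinuousAt (fun y ↦ tangentCoordChange (𝓡 3) c' c ((chartAt E3 c).symm y))
      (chartAt E3 c p) := by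
    have h1 : ContinuousAt (tangentCoordChange (𝓡 3) c' c) p :=
      (continuousOn_tangentCoordChange c' c).continuousAt (by
        rw [extChartAt_source, extChartAt_source]
        exact ((chartAt E3 c').open_source.inter (chartAt E3 c).open_source).mem_nhds ⟨hc', hc⟩)
    rw [← hinv] at h1
    exact ContinuousAt.comp (g := tangentCoordChange (𝓡 3) c' c) h1 hsymm
  have hu : HasFDerivAt (fun y ↦ localRep X c' (chartAt E3 c' ((chartAt E3 c).symm y)))
      (D.comp (tangentCoordChange (𝓡 3) c c' p)) (chartAt E3 c p) := by
    refine HasFDerivAt.comp (g := localRep X c') _ ?_ (hasFDerivAt_coord_change hc hc')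
    rwa [hinv]
  have h0 : localRep X c' (chartAt E3 c' ((chartAt E3 c).symm (chartAt E3 c p))) = 0 := by
    rw [hinv]; exact (localRep_eq_zero_iff X hc').2 hp
  have h2 := hasFDerivAt_clm_apply_of_eq_zero hB hu h0
  simp only [hinv] at h2
  refine h2.congr_of_eventuallyEq ?_
  have hev1 : ∀ᶠ y in 𝓝 (chartAt E3 c p), y ∈ (chartAt E3 c).target :=
    (chartAt E3 c).open_target.mem_nhds ((chartAt E3 c).map_source hc)
  have hev2 : ∀ᶠ y in 𝓝 (chartAt E3 c p), (chartAt E3 c).symm y ∈ (chartAt E3 c').source :=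
    hsymm.eventually ((chartAt E3 c').open_source.mem_nhds (by rwa [hinv]))
  filter_upwards [hev1, hev2] with y hy1 hy2
  have := localRep_change X ((chartAt E3 c).map_target hy1) hy2
  rwa [(chartAt E3 c).right_inv hy1] at this

end Charts

/-! ### Sections of a plane field -/

section Sections

open Set Filter

variable {M : Type*} [TopologicalSpace M] [ChartedSpace E3 M] [IsManifold (𝓡 3) ∞ M]
  {r : ℕ∞} {η : PlaneField M r}

theorem PlaneField.Section.contDiffOn (X : η.Section) (c : M) :
    ContDiffOn ℝ r (localRep X.field c) (chartAt E3 c).target := by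
  have := contDiffOn_localRep (X := X.field) (n := r) isOpen_univ
    (X.1.contMDiff.contMDiffOn) c
  simpa using this

theorem PlaneField.Section.contDiffAt (X : η.Section) {c : M} {y : E3}
    (hy : y ∈ (chartAt E3 c).target) : ContDiffAt ℝ r (localRep X.field c) y :=
  (X.contDiffOn c).contDiffAt ((chartAt E3 c).open_target.mem_nhds hy)

/-- The section `X + ∑ bᵢ Yᵢ`. -/
def PlaneField.Section.perturb {ι : Type*} [Fintype ι] (X : η.Section) (Y : ι → η.Section)
    (b : ι → ℝ) : η.Section :=
  ⟨X.1 + ∑ i, b i • (Y i).1, fun p ↦ by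
    have h : (⇑(∑ i, b i • (Y i).1) : ∀ q : M, TangentSpace (𝓡 3) q) =
        ∑ i, b i • ⇑(Y i).1 :=
      map_sum (ContMDiffSection.coeAddHom (𝓡 3) E3 (r : ℕ∞ω) (TangentSpace (𝓡 3) : M → Type))
        (fun i ↦ b i • (Y i).1) Finset.univ
    rw [ContMDiffSection.coe_add, h, Pi.add_apply, Finset.sum_apply]
    exact add_mem (X.2 p) (sum_mem fun i _ ↦ Submodule.smul_mem _ _ ((Y i).2 p))⟩

theorem PlaneField.Section.perturb_field {ι : Type*} [Fintype ι] (X : η.Section)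
    (Y : ι → η.Section) (b : ι → ℝ) (p : M) :
    (X.perturb Y b).field p = X.field p + ∑ i, b i • (Y i).field p := by
  have h : (⇑(∑ i, b i • (Y i).1) : ∀ q : M, TangentSpace (𝓡 3) q) =
      ∑ i, b i • ⇑(Y i).1 :=
    map_sum (ContMDiffSection.coeAddHom (𝓡 3) E3 (r : ℕ∞ω) (TangentSpace (𝓡 3) : M → Type))
      (fun i ↦ b i • (Y i).1) Finset.univ
  change (X.1 + ∑ i, b i • (Y i).1) p = _
  rw [ContMDiffSection.coe_add, h, Pi.add_apply, Finset.sum_apply]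
  rfl

theorem PlaneField.Section.localRep_perturb {ι : Type*} [Fintype ι] (X : η.Section)
    (Y : ι → η.Section) (b : ι → ℝ) (c : M) :
    localRep (X.perturb Y b).field c =
      localRep X.field c + ∑ i, b i • localRep (Y i).field c := by
  funext y
  rw [Pi.add_apply, Finset.sum_apply, localRep_eq, perturb_field, localRep_eq]
  have := map_add (tangentCoordChange (𝓡 3) ((chartAt E3 c).symm y) c ((chartAt E3 c).symm y))
    (X.field ((chartAt E3 c).symm y)) (∑ i, b i • (Y i).field ((chartAt E3 c).symm y) : E3)
  refine this.trans ?_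
  congr 1
  refine (map_sum (tangentCoordChange (𝓡 3) ((chartAt E3 c).symm y) c ((chartAt E3 c).symm y))
    (fun i ↦ (b i • (Y i).field ((chartAt E3 c).symm y) : E3)) Finset.univ).trans ?_
  refine Finset.sum_congr rfl fun i _ ↦ ?_
  rw [Pi.smul_apply, localRep_eq]
  exact map_smul (tangentCoordChange (𝓡 3) ((chartAt E3 c).symm y) c ((chartAt E3 c).symm y))
    (b i) ((Y i).field ((chartAt E3 c).symm y) : E3)

theorem PlaneField.Section.iteratedFDeriv_perturb {ι : Type*} [Fintype ι] (X : η.Section)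
    (Y : ι → η.Section) (b : ι → ℝ) (c : M) {k : ℕ} (hk : (k : ℕ∞) ≤ r) {y : E3}
    (hy : y ∈ (chartAt E3 c).target) :
    iteratedFDeriv ℝ k (localRep (X.perturb Y b).field c) y =
      iteratedFDeriv ℝ k (localRep X.field c) y +
        ∑ i, b i • iteratedFDeriv ℝ k (localRep (Y i).field c) y := by
  have hkr : ((k : ℕ) : ℕ∞ω) ≤ (r : ℕ∞ω) := by exact_mod_cast hk
  have hY : ∀ i, ContDiffAt ℝ k (b i • localRep (Y i).field c) y := fun i ↦
    ContDiffAt.const_smul (b i) (((Y i).contDiffAt hy).of_le hkr)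
  have hS : ∀ s : Finset ι, ContDiffAt ℝ k (∑ i ∈ s, b i • localRep (Y i).field c) y ∧
      iteratedFDeriv ℝ k (∑ i ∈ s, b i • localRep (Y i).field c) y =
        ∑ i ∈ s, b i • iteratedFDeriv ℝ k (localRep (Y i).field c) y := by
    classical
    intro s
    induction s using Finset.induction_on with
    | empty =>
      simp only [Finset.sum_empty]
      exact ⟨contDiffAt_const, by simp⟩
    | insert i s hi ih =>
      rw [Finset.sum_insert hi, Finset.sum_insert hi]
      refine ⟨(hY i).add ih.1, ?_⟩
      rw [iteratedFDeriv_add_apply (hY i) ih.1, ih.2,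
        iteratedFDeriv_const_smul_apply (((Y i).contDiffAt hy).of_le hkr)]
  rw [localRep_perturb, iteratedFDeriv_add_apply ((X.contDiffAt hy).of_le hkr) (hS _).1, (hS _).2]

theorem PlaneField.Section.tendsto_nhds_iff {α : Type*} {l : Filter α} {F : α → η.Section}
    {X : η.Section} : Tendsto F l (𝓝 X) ↔ ∀ (c : M) (k : ℕ), (k : ℕ∞) ≤ r → ∀ K : Set E3,
      IsCompact K → K ⊆ (chartAt E3 c).target →
      TendstoUniformlyOn (fun a ↦ iteratedFDeriv ℝ k (localRep (F a).field c))
        (iteratedFDeriv ℝ k (localRep X.field c)) l K := by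
  simp only [nhds_iInf, nhds_induced, tendsto_iInf, tendsto_comap_iff,
    UniformOnFun.tendsto_iff_tendstoUniformlyOn, mem_ofPred_eq, and_imp]
  rfl

theorem PlaneField.Section.tendsto_perturb {ι : Type*} [Fintype ι] (X : η.Section)
    (Y : ι → η.Section) : Tendsto (X.perturb Y) (𝓝 0) (𝓝 X) := by
  rw [tendsto_nhds_iff]
  intro c k hk K hK hKc
  have hkr : ((k : ℕ) : ℕ∞ω) ≤ (r : ℕ∞ω) := by exact_mod_cast hk
  have hbd : ∀ i, ∃ C, ∀ y ∈ K, ‖iteratedFDeriv ℝ k (localRep (Y i).field c) y‖ ≤ C := fun i ↦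
    hK.exists_bound_of_continuousOn fun y hy ↦
      (((Y i).contDiffAt (hKc hy)).continuousAt_iteratedFDeriv hkr).continuousWithinAt
  choose C hC using hbd
  rw [Metric.tendstoUniformlyOn_iff]
  intro e he
  have hcont : Tendsto (fun b : ι → ℝ ↦ ∑ i, |b i| * C i) (𝓝 0) (𝓝 0) := by
    have : Continuous fun b : ι → ℝ ↦ ∑ i, |b i| * C i := by fun_prop
    simpa using this.tendsto 0
  filter_upwards [hcont.eventually (gt_mem_nhds he)] with b hb y hy
  rw [iteratedFDeriv_perturb X Y b c hk (hKc hy), dist_eq_norm, sub_add_cancel_left, norm_neg]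
  refine lt_of_le_of_lt ((norm_sum_le _ _).trans (Finset.sum_le_sum fun i _ ↦ ?_)) hb
  rw [norm_smul, Real.norm_eq_abs]
  exact mul_le_mul_of_nonneg_left (hC i y hy) (abs_nonneg _)

theorem tendstoUniformlyOn_of_iteratedFDeriv_zero {α F : Type*} [NormedAddCommGroup F]
    [NormedSpace ℝ F] {l : Filter α} {K : Set E3} {f : α → E3 → F} {g : E3 → F}
    (h : TendstoUniformlyOn (fun a ↦ iteratedFDeriv ℝ 0 (f a)) (iteratedFDeriv ℝ 0 g) l K) :
    TendstoUniformlyOn f g l K := by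
  have := (continuousMultilinearCurryFin0 ℝ E3 F).isometry.uniformContinuous.comp_tendstoUniformlyOn
    h
  simp only [iteratedFDeriv_zero_eq_comp] at this
  refine (this.congr (Eventually.of_forall fun a x _ ↦ ?_)).congr_right fun x _ ↦ ?_ <;> simp

/-- Currying is an isometry. Peeling off derivatives one at a time turns convergence of iterated
derivatives into convergence of two-jets. -/
theorem tendstoUniformlyOn_iteratedFDeriv_fderiv {α F : Type*} [NormedAddCommGroup F]
    [NormedSpace ℝ F] {l : Filter α} {K : Set E3} {f : α → E3 → F} {g : E3 → F} {k : ℕ}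
    (h : TendstoUniformlyOn (fun a ↦ iteratedFDeriv ℝ (k + 1) (f a))
      (iteratedFDeriv ℝ (k + 1) g) l K) :
    TendstoUniformlyOn (fun a ↦ iteratedFDeriv ℝ k (fderiv ℝ (f a)))
      (iteratedFDeriv ℝ k (fderiv ℝ g)) l K := by
  have := (continuousMultilinearCurryRightEquiv' ℝ k E3
    F).isometry.uniformContinuous.comp_tendstoUniformlyOn h
  refine (this.congr (Eventually.of_forall fun a x _ ↦ ?_)).congr_right fun x _ ↦ ?_ <;>
  · simp only [Function.comp_apply]
    rw [iteratedFDeriv_succ_eq_comp_right, Function.comp_apply, LinearIsometryEquiv.apply_symm_apply]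

theorem eventually_forall_mem_of_tendstoUniformlyOn {α X Y : Type*} [TopologicalSpace X]
    [PseudoMetricSpace Y] {l : Filter α} {K : Set X} (hK : IsCompact K) {F : α → X → Y} {f : X → Y}
    (h : TendstoUniformlyOn F f l K) (hf : ContinuousOn f K) {P : Set Y} (hP : IsOpen P)
    (hfP : ∀ x ∈ K, f x ∈ P) : ∀ᶠ a in l, ∀ x ∈ K, F a x ∈ P := by
  obtain ⟨e, he, hsub⟩ := (hK.image_of_continuousOn hf).exists_thickening_subset_open hP
    (image_subset_iff.2 hfP)
  filter_upwards [Metric.tendstoUniformlyOn_iff.1 h e he] with a ha x hx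
  exact hsub (Metric.mem_thickening_iff.2 ⟨f x, mem_image_of_mem f hx, by
    rw [dist_comm]; exact ha x hx⟩)

/-- The two-jet of a map. -/
def twoJet (f : E3 → E3) (x : E3) : E3 × (E3 →L[ℝ] E3) × (E3 →L[ℝ] E3 →L[ℝ] E3) :=
  (f x, fderiv ℝ f x, fderiv ℝ (fderiv ℝ f) x)

theorem continuousAt_twoJet {f : E3 → E3} {x : E3} (hf : ContDiffAt ℝ 2 f x) :
    ContinuousAt (twoJet f) x :=
  hf.continuousAt.prodMk ((hf.continuousAt_fderiv (by norm_num)).prodMk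
    ((hf.fderiv_right (m := 1) (by norm_num)).continuousAt_fderiv (by norm_num)))

/-- An open condition on two-jets over a compact subset of a chart is open in `Γ^r(η)`. -/
theorem isOpen_setOf_forall_twoJet_mem (hr : 2 ≤ r) {c : M} {K : Set E3} (hK : IsCompact K)
    (hKc : K ⊆ (chartAt E3 c).target) {G : Type*} [PseudoMetricSpace G] {g : E3 → G}
    (hg : ContinuousOn g K) {P : Set (G × E3 × (E3 →L[ℝ] E3) × (E3 →L[ℝ] E3 →L[ℝ] E3))}
    (hP : IsOpen P) :
    IsOpen {X : η.Section | ∀ x ∈ K, (g x, twoJet (localRep X.field c) x) ∈ P} := by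
  rw [isOpen_iff_eventually]
  intro X hX
  have h := PlaneField.Section.tendsto_nhds_iff.1 (tendsto_id (x := 𝓝 X))
  have hr2 : ((2 : ℕ) : ℕ∞) ≤ r := hr
  have h0 := tendstoUniformlyOn_of_iteratedFDeriv_zero (h c 0 (by simp) K hK hKc)
  have h1 := tendstoUniformlyOn_of_iteratedFDeriv_zero (tendstoUniformlyOn_iteratedFDeriv_fderiv
    (h c 1 (le_trans (by norm_num) hr2) K hK hKc))
  have h2 := tendstoUniformlyOn_of_iteratedFDeriv_zero (tendstoUniformlyOn_iteratedFDeriv_fderiv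
    (tendstoUniformlyOn_iteratedFDeriv_fderiv (h c 2 hr2 K hK hKc)))
  have hgt : TendstoUniformlyOn (fun _ : η.Section ↦ g) g (𝓝 X) K := by
    rw [Metric.tendstoUniformlyOn_iff]
    exact fun e he ↦ Eventually.of_forall fun _ x _ ↦ by rwa [dist_self]
  have hall := hgt.prodMk (h0.prodMk (h1.prodMk h2))
  have hdiag : Tendsto (fun Y : η.Section ↦ (Y, Y, Y, Y)) (𝓝 X)
      (𝓝 X ×ˢ 𝓝 X ×ˢ 𝓝 X ×ˢ 𝓝 X) :=
    tendsto_id.prodMk (tendsto_id.prodMk (tendsto_id.prodMk tendsto_id))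
  have hall' : TendstoUniformlyOn (fun (Y : η.Section) x ↦ (g x, twoJet (localRep Y.field c) x))
      (fun x ↦ (g x, twoJet (localRep X.field c) x)) (𝓝 X) K :=
    fun u hu ↦ hdiag.eventually (hall u hu)
  refine eventually_forall_mem_of_tendstoUniformlyOn hK hall' ?_ hP hX
  refine hg.prodMk fun x hx ↦ (continuousAt_twoJet ?_).continuousWithinAt
  exact (X.contDiffAt (hKc hx)).of_le (WithTop.coe_le_coe.2 hr)

end Sections

/-! ### Local constructions of sections -/

section LinearForms

/-- Coordinates on the plane `ker ν`, extended to the whole space, serve as `π`. They allow the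
vanishing of a section to be expressed by two scalar equations. -/
theorem exists_prod_injective_of_ne_zero {ν : E3 →L[ℝ] ℝ} (hν : ν ≠ 0) :
    ∃ π : E3 →L[ℝ] (Fin 2 → ℝ), Function.Injective (π.prod ν) := by
  have hfr : Module.finrank ℝ (LinearMap.ker (ν : E3 →ₗ[ℝ] ℝ)) = 2 := by
    have h1 := (ν : E3 →ₗ[ℝ] ℝ).finrank_range_add_finrank_ker
    have h2 : LinearMap.range (ν : E3 →ₗ[ℝ] ℝ) = ⊤ := LinearMap.range_eq_top.2
      (LinearMap.surjective (by
        intro h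
        exact hν (ContinuousLinearMap.coe_injective h)))
    rw [h2, finrank_top, Module.finrank_self, finrank_euclideanSpace_fin] at h1
    omega
  let e : LinearMap.ker (ν : E3 →ₗ[ℝ] ℝ) ≃ₗ[ℝ] (Fin 2 → ℝ) :=
    LinearEquiv.ofFinrankEq _ _ (by rw [hfr]; simp)
  obtain ⟨π, hπ⟩ := LinearMap.exists_extend (e : LinearMap.ker (ν : E3 →ₗ[ℝ] ℝ) →ₗ[ℝ] (Fin 2 → ℝ))
  refine ⟨LinearMap.toContinuousLinearMap π, ?_⟩
  rw [injective_iff_map_eq_zero]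
  intro x hx
  have h1 : π x = 0 := congrArg Prod.fst hx
  have h2 : ν x = 0 := congrArg Prod.snd hx
  have h3 : e ⟨x, h2⟩ = π x := (LinearMap.congr_fun hπ ⟨x, h2⟩).symm
  rw [h1] at h3
  have h4 := e.map_eq_zero_iff.1 h3
  exact congrArg Subtype.val h4

/-- The linear form with kernel spanned by two given vectors. -/
def crossForm (a b : E3) : E3 →L[ℝ] ℝ :=
  ∑ i, (crossProduct (a : Fin 3 → ℝ) b) i • EuclideanSpace.proj i

theorem crossForm_apply (a b u : E3) :
    crossForm a b u = (a 1 * b 2 - a 2 * b 1) * u 0 + (a 2 * b 0 - a 0 * b 2) * u 1 +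
      (a 0 * b 1 - a 1 * b 0) * u 2 := by
  simp [crossForm, Fin.sum_univ_three, cross_apply]

theorem continuous_crossForm : Continuous fun z : E3 × E3 ↦ crossForm z.1 z.2 := by
  simp only [crossForm, Fin.sum_univ_three, cross_apply]
  simp only [Matrix.cons_val_zero, Matrix.cons_val_one, Matrix.cons_val]
  fun_prop

theorem continuousOn_crossForm {f g : E3 → E3} {O : Set E3} (hf : ContinuousOn f O)
    (hg : ContinuousOn g O) : ContinuousOn (fun x ↦ crossForm (f x) (g x)) O :=
  Continuous.comp_continuousOn' (g := fun z : E3 × E3 ↦ crossForm z.1 z.2)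
    (f := fun x ↦ (f x, g x)) continuous_crossForm (hf.prodMk hg)

theorem crossForm_ne_zero {a b : E3} (h : LinearIndependent ℝ ![a, b]) : crossForm a b ≠ 0 := by
  have h' : LinearIndependent ℝ ![(a : Fin 3 → ℝ), b] := by
    rw [LinearIndependent.pair_iff] at h ⊢
    intro s t hst
    apply h
    ext i
    simpa using congrFun hst i
  have h1 := crossProduct_ne_zero_iff_linearIndependent.2 h'
  intro h0
  apply h1
  ext i
  have := congrArg (fun f ↦ f (EuclideanSpace.single i (1 : ℝ))) h0
  fin_cases i <;> simpa [crossForm, Fin.sum_univ_three, Pi.single_apply] using this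

theorem crossForm_add_smul (a b : E3) (s t : ℝ) : crossForm a b (s • a + t • b) = 0 := by
  rw [crossForm_apply]
  simp only [PiLp.add_apply, PiLp.smul_apply, smul_eq_mul]
  ring

theorem exists_add_smul_of_crossForm_eq_zero {a b u : E3} (h : LinearIndependent ℝ ![a, b])
    (hu : crossForm a b u = 0) : ∃ s t : ℝ, s • a + t • b = u := by
  rw [← Submodule.mem_span_pair]
  have hle : Submodule.span ℝ {a, b} ≤ LinearMap.ker (crossForm a b : E3 →ₗ[ℝ] ℝ) := by
    intro x hx
    obtain ⟨s, t, rfl⟩ := Submodule.mem_span_pair.1 hx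
    exact crossForm_add_smul a b s t
  have h1 := (crossForm a b : E3 →ₗ[ℝ] ℝ).finrank_range_add_finrank_ker
  have h2 : LinearMap.range (crossForm a b : E3 →ₗ[ℝ] ℝ) = ⊤ := LinearMap.range_eq_top.2
    (LinearMap.surjective fun h0 ↦ crossForm_ne_zero h (ContinuousLinearMap.coe_injective h0))
  rw [h2, finrank_top, Module.finrank_self, finrank_euclideanSpace_fin] at h1
  have h3 := finrank_span_eq_card h
  have h4 : Set.range ![a, b] = {a, b} := by simp [Matrix.range_cons, Matrix.range_empty, Set.pair_comm]
  rw [h4, Fintype.card_fin] at h3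
  have h5 := Submodule.eq_of_le_of_finrank_eq hle (by omega)
  rw [h5]
  exact hu

theorem clm_add_smul (A : E3 →L[ℝ] E3) (a b : ℝ) (v w : E3) :
    A (a • v + b • w) = a • A v + b • A w := by
  rw [map_add, map_smul, map_smul]

end LinearForms

/-! ### Sections with prescribed local behaviour -/

section LocalSections

open Set Filter

variable {M : Type*} [TopologicalSpace M] [ChartedSpace E3 M] [IsManifold (𝓡 3) ∞ M]
  {r : ℕ∞} {η : PlaneField M r}

/-- A combination of the local frame with constant coefficients is cut off by a bump function equal
to one at `p`. -/
theorem PlaneField.exists_section_field_eq [T2Space M] (η : PlaneField M r) {p : M}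
    {v : TangentSpace (𝓡 3) p} (hv : v ∈ η.plane p) : ∃ Y : η.Section, Y.field p = v := by
  obtain ⟨U, hU, hpU, V, W, hV, hW, hspan⟩ := η.exists_local_frame p
  rw [hspan p hpU] at hv
  obtain ⟨a, b, hab⟩ := Submodule.mem_span_pair.1 hv
  obtain ⟨f, -, hf⟩ := (SmoothBumpFunction.nhds_basis_tsupport (I := 𝓡 3) p).mem_iff.1
    (hU.mem_nhds hpU)
  have hs := ContMDiffOn.smul_section_of_tsupport (ψ := f)
    (s := (a • V + b • W : ∀ q, TangentSpace (𝓡 3) q))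
    ((f.contMDiff.of_le (WithTop.coe_le_coe.2 le_top)).contMDiffOn) hU hf
    ((hV.const_smul_section (a := a)).add_section (hW.const_smul_section (a := b)))
  refine ⟨⟨⟨_, hs⟩, fun q ↦ ?_⟩, ?_⟩
  · change f q • (a • V q + b • W q) ∈ η.plane q
    by_cases hq : q ∈ U
    · rw [hspan q hq]
      exact Submodule.smul_mem _ _ (Submodule.mem_span_pair.2 ⟨a, b, rfl⟩)
    · have : f q = 0 := image_eq_zero_of_notMem_tsupport fun h ↦ hq (hf h)
      rw [this, zero_smul]
      exact Submodule.zero_mem _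
  · change f p • (a • V p + b • W p) = v
    rw [f.eq_one, one_smul, hab]

theorem PlaneField.Section.exists_mul [T2Space M] (Y : η.Section) {c p : M}
    (hp : p ∈ (chartAt E3 c).source) {ℓ : E3 → ℝ} (hℓ : ContDiff ℝ ∞ ℓ) :
    ∃ Y' : η.Section, localRep Y'.field c =ᶠ[𝓝 (chartAt E3 c p)]
      fun y ↦ ℓ y • localRep Y.field c y := by
  have hO : IsOpen (chartAt E3 c).source := (chartAt E3 c).open_source
  obtain ⟨f, -, hf⟩ := (SmoothBumpFunction.nhds_basis_tsupport (I := 𝓡 3) p).mem_iff.1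
    (hO.mem_nhds hp)
  have hψ : ContMDiffOn (𝓡 3) 𝓘(ℝ, ℝ) r (fun q ↦ f q * ℓ (chartAt E3 c q))
      (chartAt E3 c).source := by
    have h1 : ContMDiffOn (𝓡 3) 𝓘(ℝ, ℝ) ∞ (fun q ↦ ℓ (chartAt E3 c q)) (chartAt E3 c).source :=
      hℓ.contMDiff.comp_contMDiffOn (contMDiffOn_chart (I := 𝓡 3))
    exact (f.contMDiff.contMDiffOn.mul h1).of_le (WithTop.coe_le_coe.2 le_top)
  have hs := ContMDiffOn.smul_section_of_tsupport (s := (Y.field : ∀ q, TangentSpace (𝓡 3) q))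
    hψ hO ((tsupport_mul_subset_left (f := f)).trans hf) Y.1.contMDiff.contMDiffOn
  refine ⟨⟨⟨_, hs⟩, fun q ↦ Submodule.smul_mem _ _ (Y.2 q)⟩, ?_⟩
  have h1 : ∀ᶠ y in 𝓝 (chartAt E3 c p), y ∈ (chartAt E3 c).target :=
    (chartAt E3 c).open_target.mem_nhds ((chartAt E3 c).map_source hp)
  have hsymm : ContinuousAt (chartAt E3 c).symm (chartAt E3 c p) :=
    (chartAt E3 c).continuousAt_symm ((chartAt E3 c).map_source hp)
  have h2 : ∀ᶠ y in 𝓝 (chartAt E3 c p), f ((chartAt E3 c).symm y) = 1 :=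
    hsymm.eventually (by rw [(chartAt E3 c).left_inv hp]; exact f.eventuallyEq_one)
  filter_upwards [h1, h2] with y hy1 hy2
  rw [localRep_eq, localRep_eq]
  change tangentCoordChange (𝓡 3) ((chartAt E3 c).symm y) c ((chartAt E3 c).symm y)
    ((f ((chartAt E3 c).symm y) * ℓ (chartAt E3 c ((chartAt E3 c).symm y))) •
      (Y.field ((chartAt E3 c).symm y) : E3)) = _
  rw [hy2, one_mul, (chartAt E3 c).right_inv hy1]
  exact map_smul _ _ _

/-- In a chart a plane field is, locally, the kernel of a continuous family of linear forms. -/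
theorem PlaneField.exists_defining_form (η : PlaneField M r) {c p : M}
    (hp : p ∈ (chartAt E3 c).source) :
    ∃ O : Set E3, IsOpen O ∧ chartAt E3 c p ∈ O ∧ O ⊆ (chartAt E3 c).target ∧
      ∃ ν : E3 → E3 →L[ℝ] ℝ, ContinuousOn ν O ∧ (∀ x ∈ O, ν x ≠ 0) ∧
        (∀ x ∈ O, ∀ X : η.Section, ν x (localRep X.field c x) = 0) ∧
        ∀ w, ν (chartAt E3 c p) w = 0 →
          ∃ v : TangentSpace (𝓡 3) p, v ∈ η.plane p ∧ tangentCoordChange (𝓡 3) p c p v = w := by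
  obtain ⟨U, hU, hpU, V, W, hV, hW, hspan⟩ := η.exists_local_frame p
  let O := (chartAt E3 c).target ∩ (chartAt E3 c).symm ⁻¹' U
  have hmem : ∀ x ∈ O, ∀ v : TangentSpace (𝓡 3) ((chartAt E3 c).symm x),
      v ∈ η.plane ((chartAt E3 c).symm x) ↔ ∃ a b : ℝ, a • V _ + b • W _ = v := fun x hx v ↦ by
    rw [hspan _ hx.2, Submodule.mem_span_pair]
  have hlin : ∀ x ∈ O, LinearIndependent ℝ ![localRep V c x, localRep W c x] := by
    intro x hx
    have hsrc := (chartAt E3 c).map_target hx.1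
    have h1 : LinearIndependent ℝ ![V ((chartAt E3 c).symm x), W ((chartAt E3 c).symm x)] := by
      rw [linearIndependent_iff_card_eq_finrank_span, Set.finrank, Matrix.range_cons,
        Matrix.range_cons, Matrix.range_empty, union_empty, singleton_union, ← hspan _ hx.2,
        η.finrank_plane, Fintype.card_fin]
    rw [LinearIndependent.pair_iff] at h1 ⊢
    intro s t hst
    apply h1
    rw [localRep_eq, localRep_eq] at hst
    have h2 : tangentCoordChange (𝓡 3) ((chartAt E3 c).symm x) c ((chartAt E3 c).symm x)
        (s • (V ((chartAt E3 c).symm x) : E3) + t • (W ((chartAt E3 c).symm x) : E3)) = 0 :=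
      (clm_add_smul _ s t _ _).trans hst
    have h3 := tangentCoordChange_comp_self (mem_chart_source E3 ((chartAt E3 c).symm x)) hsrc
      (s • (V ((chartAt E3 c).symm x) : E3) + t • (W ((chartAt E3 c).symm x) : E3))
    rw [h2, map_zero] at h3
    exact h3.symm
  have hcV : ContinuousOn (localRep V c) O := (contDiffOn_localRep hU hV c).continuousOn
  have hcW : ContinuousOn (localRep W c) O := (contDiffOn_localRep hU hW c).continuousOn
  have hp' : chartAt E3 c p ∈ O :=
    ⟨(chartAt E3 c).map_source hp, by rw [mem_preimage, (chartAt E3 c).left_inv hp]; exact hpU⟩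
  have hO : IsOpen O := (chartAt E3 c).isOpen_inter_preimage_symm hU
  refine ⟨O, hO, hp', inter_subset_left,
    fun x ↦ crossForm (localRep V c x) (localRep W c x), ?_, ?_, ?_, ?_⟩
  · exact continuousOn_crossForm hcV hcW
  · exact fun x hx ↦ crossForm_ne_zero (hlin x hx)
  · intro x hx X
    obtain ⟨a, b, hab⟩ := (hmem x hx _).1 (X.2 _)
    have : localRep X.field c x = a • localRep V c x + b • localRep W c x := by
      rw [localRep_eq, localRep_eq, localRep_eq]
      have h2 : X.field ((chartAt E3 c).symm x) = _ := hab.symm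
      rw [h2]
      exact clm_add_smul (tangentCoordChange (𝓡 3) ((chartAt E3 c).symm x) c
        ((chartAt E3 c).symm x)) a b (V ((chartAt E3 c).symm x)) (W ((chartAt E3 c).symm x))
    rw [this, crossForm_add_smul]
  · intro w hw
    obtain ⟨a, b, rfl⟩ := exists_add_smul_of_crossForm_eq_zero (hlin _ hp') hw
    refine ⟨a • V p + b • W p, ?_, ?_⟩
    · rw [hspan p hpU]
      exact Submodule.mem_span_pair.2 ⟨a, b, rfl⟩
    · rw [localRep_chartAt V hp, localRep_chartAt W hp]
      exact clm_add_smul (tangentCoordChange (𝓡 3) p c p) a b (V p) (W p)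

end LocalSections

/-! ### Density of transversality -/

section Density

open Set Filter MeasureTheory

/-- The one-jet of a map, together with its base point. -/
def oneJet (f : E3 → E3) (x : E3) : E3 × E3 × (E3 →L[ℝ] E3) := (x, f x, fderiv ℝ f x)

theorem contDiffAt_oneJet {f : E3 → E3} {x : E3} (hf : ContDiffAt ℝ 2 f x) :
    ContDiffAt ℝ 1 (oneJet f) x :=
  contDiffAt_id.prodMk ((hf.of_le (by norm_num)).prodMk (hf.fderiv_right (m := 1) (by norm_num)))

variable {n : ℕ}

/-- The linear family `β ↦ ∑ βᵢ wᵢ`. -/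
def sumSMul {F : Type*} [NormedAddCommGroup F] [NormedSpace ℝ F] (w : Fin n → F) :
    (Fin n → ℝ) →L[ℝ] F :=
  ∑ i, (ContinuousLinearMap.proj i : (Fin n → ℝ) →L[ℝ] ℝ).smulRight (w i)

theorem sumSMul_apply {F : Type*} [NormedAddCommGroup F] [NormedSpace ℝ F] (w : Fin n → F)
    (β : Fin n → ℝ) : sumSMul w β = ∑ i, β i • w i := by
  simp [sumSMul]

/-- The variation of one-jets at `x` in the direction of vector fields `Yᵢ`. -/
def jetVariation (Y : Fin n → E3 → E3) (x : E3) : (Fin n → ℝ) →L[ℝ] E3 × E3 × (E3 →L[ℝ] E3) :=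
  (0 : (Fin n → ℝ) →L[ℝ] E3).prod
    ((sumSMul fun i ↦ Y i x).prod (sumSMul fun i ↦ fderiv ℝ (Y i) x))

theorem oneJet_add_sum {f : E3 → E3} {Y : Fin n → E3 → E3} {x : E3} (hf : DifferentiableAt ℝ f x)
    (hY : ∀ i, DifferentiableAt ℝ (Y i) x) (b : Fin n → ℝ) :
    oneJet (f + ∑ i, b i • Y i) x = oneJet f x + jetVariation Y x b := by
  have h1 : HasFDerivAt (f + ∑ i, b i • Y i) (fderiv ℝ f x + ∑ i, b i • fderiv ℝ (Y i) x) x :=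
    hf.hasFDerivAt.add (HasFDerivAt.sum fun i _ ↦ (hY i).hasFDerivAt.const_smul (b i))
  refine Prod.ext ?_ (Prod.ext ?_ ?_)
  · simp [oneJet, jetVariation]
  · simp [oneJet, jetVariation, sumSMul_apply]
  · simp only [oneJet, jetVariation, h1.fderiv]
    simp [sumSMul_apply]

theorem contDiffAt_oneJet_add_jetVariation {f : E3 → E3} {Y : Fin n → E3 → E3} {x : E3}
    (hf : ContDiffAt ℝ 2 f x) (hY : ∀ i, ContDiffAt ℝ 2 (Y i) x) (b : Fin n → ℝ) :
    ContDiffAt ℝ 1 (fun z : E3 × (Fin n → ℝ) ↦ oneJet f z.1 + jetVariation Y z.1 z.2) (x, b) := by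
  have h1 : ContDiffAt ℝ 1 (fun z : E3 × (Fin n → ℝ) ↦ oneJet f z.1) (x, b) :=
    (contDiffAt_oneJet hf).comp (x, b) contDiffAt_fst
  have h2 : ∀ i, ContDiffAt ℝ 1 (fun z : E3 × (Fin n → ℝ) ↦ z.2 i) (x, b) := fun i ↦
    contDiffAt_pi.1 contDiffAt_snd i
  have h3 : ∀ i, ContDiffAt ℝ 1 (fun z : E3 × (Fin n → ℝ) ↦ z.2 i • Y i z.1) (x, b) := fun i ↦
    (h2 i).smul (((hY i).of_le (by norm_num)).comp (x, b) contDiffAt_fst)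
  have h4 : ∀ i, ContDiffAt ℝ 1 (fun z : E3 × (Fin n → ℝ) ↦ z.2 i • fderiv ℝ (Y i) z.1) (x, b) :=
    fun i ↦ (h2 i).smul (((hY i).fderiv_right (m := 1) (by norm_num)).comp (x, b) contDiffAt_fst)
  have h5 := h1.add (contDiffAt_const (c := (0 : E3)) |>.prodMk
    ((ContDiffAt.sum (s := Finset.univ) fun i _ ↦ h3 i).prodMk
      (ContDiffAt.sum (s := Finset.univ) fun i _ ↦ h4 i)))
  refine h5.congr_of_eventuallyEq (Eventually.of_forall fun z ↦ ?_)
  simp [jetVariation, sumSMul_apply]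

variable {M : Type*} [TopologicalSpace M] [ChartedSpace E3 M] [IsManifold (𝓡 3) ∞ M]
  {r : ℕ∞} {η : PlaneField M r}

/-- Parametric transversality for sections of a plane field: if a finite-dimensional perturbation
is versal for the equation `Φ(j¹X) = 0` over `N`, then `X` has arbitrarily small perturbations for
which this equation is transverse over `N`. -/
theorem exists_perturb_transverse (hr : 2 ≤ r) {c : M} {N : Set E3}
    (hN : N ⊆ (chartAt E3 c).target) {Φ : E3 × E3 × (E3 →L[ℝ] E3) → (Fin n → ℝ)}
    (hΦ : ∀ x ∈ N, ∀ j, ContDiffAt ℝ 1 Φ (x, j)) (q : (Fin n → ℝ) →L[ℝ] E3)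
    (hq : Function.Surjective q) (Y : Fin n → η.Section) {U : Set η.Section} (hU : IsOpen U)
    (hUY : ∀ X ∈ U, ∀ x ∈ N, Φ (oneJet (localRep X.field c) x) = 0 →
      Function.Injective ((fderiv ℝ Φ (oneJet (localRep X.field c) x)).comp
        (jetVariation (fun i ↦ localRep (Y i).field c) x)))
    {X : η.Section} (hX : X ∈ U) :
    ∃ X' ∈ U, ∀ x ∈ N, Φ (oneJet (localRep X'.field c) x) = 0 →
      Function.Injective ((fderiv ℝ (fun y ↦ Φ (oneJet (localRep X'.field c) y)) x).comp q) := by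
  have hr2 : (2 : ℕ∞ω) ≤ (r : ℕ∞ω) := WithTop.coe_le_coe.2 hr
  have hc2 : ∀ (Z : η.Section), ∀ x ∈ (chartAt E3 c).target,
      ContDiffAt ℝ 2 (localRep Z.field c) x := fun Z x hx ↦ (Z.contDiffAt hx).of_le hr2
  let J : E3 × (Fin n → ℝ) → E3 × E3 × (E3 →L[ℝ] E3) := fun z ↦
    oneJet (localRep X.field c) z.1 + jetVariation (fun i ↦ localRep (Y i).field c) z.1 z.2
  have hJ : ∀ x ∈ (chartAt E3 c).target, ∀ b,
      oneJet (localRep (X.perturb Y b).field c) x = J (x, b) := fun x hx b ↦ by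
    rw [PlaneField.Section.localRep_perturb]
    exact oneJet_add_sum ((hc2 X x hx).differentiableAt (by norm_num))
      (fun i ↦ (hc2 (Y i) x hx).differentiableAt (by norm_num)) b
  have hJd : ∀ x ∈ (chartAt E3 c).target, ∀ b, ContDiffAt ℝ 1 J (x, b) := fun x hx b ↦
    contDiffAt_oneJet_add_jetVariation (hc2 X x hx) (fun i ↦ hc2 (Y i) x hx) b
  have hJ1 : ∀ x b, (J (x, b)).1 = x := fun x b ↦ by simp [J, oneJet, jetVariation]
  have hΦJ : ∀ x ∈ N, ∀ b, ContDiffAt ℝ 1 Φ (J (x, b)) := fun x hx b ↦ by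
    have : J (x, b) = (x, (J (x, b)).2) := Prod.ext (hJ1 x b) rfl
    rw [this]; exact hΦ x hx _
  -- The point is written as `q z`, so that unknowns, parameters and equations all number `n`, even
  -- when `n` exceeds three.
  let G : (Fin n → ℝ) × (Fin n → ℝ) → (Fin n → ℝ) := fun z ↦ Φ (J (q z.1, z.2))
  have hGd : ∀ z b, q z ∈ N → ContDiffAt ℝ 1 G (z, b) := fun z b hz ↦ by
    have h1 : ContDiffAt ℝ 1 (fun z : (Fin n → ℝ) × (Fin n → ℝ) ↦ (q z.1, z.2)) (z, b) :=
      (q.contDiff.contDiffAt.comp (z, b) contDiffAt_fst).prodMk contDiffAt_snd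
    have h2 : ContDiffAt ℝ 1 (fun z : (Fin n → ℝ) × (Fin n → ℝ) ↦ J (q z.1, z.2)) (z, b) :=
      ContDiffAt.comp (g := J) (z, b) (hJd _ (hN hz) b) h1
    exact ContDiffAt.comp (g := Φ) (z, b) (hΦJ _ hz b) h2
  -- The bad set: solutions, for admissible parameters, at which the equation fails to be
  -- transverse. Its projection to the parameters is null and so cannot contain a neighbourhood of
  -- zero.
  let S : Set ((Fin n → ℝ) × (Fin n → ℝ)) := {z | q z.1 ∈ N ∧ X.perturb Y z.2 ∈ U ∧ G z = 0 ∧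
    ¬ Function.Injective ((fderiv ℝ (fun y ↦ Φ (J (y, z.2))) (q z.1)).comp q)}
  have hS : volume (Prod.snd '' S) = 0 := by
    refine measure_image_snd_eq_zero volume (G := G) (G' := fderiv ℝ G) (fun z hz ↦ hz.2.2.1)
      (fun z hz ↦ (hGd z.1 z.2 hz.1).hasStrictFDerivAt (by norm_num)) ?_ ?_
    · rintro ⟨z, b⟩ ⟨hz, hbU, hG0, -⟩
      have hGz := ((hGd z b hz).differentiableAt (by norm_num)).hasFDerivAt
      have h1 : HasFDerivAt (fun b' ↦ G (z, b')) ((fderiv ℝ G (z, b)).comp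
          (ContinuousLinearMap.inr ℝ _ _)) b :=
        HasFDerivAt.comp (g := G) b hGz (hasFDerivAt_prodMk_right z b)
      have h2 : HasFDerivAt (fun b' ↦ J (q z, b'))
          (jetVariation (fun i ↦ localRep (Y i).field c) (q z)) b :=
        HasFDerivAt.const_add (oneJet (localRep X.field c) (q z))
          (jetVariation (fun i ↦ localRep (Y i).field c) (q z)).hasFDerivAt
      have h3 : HasFDerivAt (fun b' ↦ G (z, b')) ((fderiv ℝ Φ (J (q z, b))).comp
          (jetVariation (fun i ↦ localRep (Y i).field c) (q z))) b :=
        HasFDerivAt.comp (g := Φ) b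
          ((hΦJ _ hz b).differentiableAt (by norm_num)).hasFDerivAt h2
      have h4 := hUY _ hbU (q z) hz (by rw [hJ _ (hN hz)]; exact hG0)
      rw [hJ _ (hN hz), h3.unique h1] at h4
      exact h4
    · rintro ⟨z, b⟩ ⟨hz, -, -, hni⟩ hinj
      apply hni
      have hGz := ((hGd z b hz).differentiableAt (by norm_num)).hasFDerivAt
      have h1 : HasFDerivAt (fun z' ↦ G (z', b)) ((fderiv ℝ G (z, b)).comp
          (ContinuousLinearMap.inl ℝ _ _)) z :=
        HasFDerivAt.comp (g := G) z hGz (hasFDerivAt_prodMk_left z b)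
      have h2 : DifferentiableAt ℝ (fun y ↦ Φ (J (y, b))) (q z) := by
        have h3 : ContDiffAt ℝ 1 (fun y ↦ J (y, b)) (q z) :=
          ContDiffAt.comp (g := J) (q z) (hJd _ (hN hz) b)
            (contDiffAt_id.prodMk contDiffAt_const)
        exact (ContDiffAt.comp (g := Φ) (q z) (hΦJ _ hz b) h3).differentiableAt (by norm_num)
      have h3 : HasFDerivAt (fun z' ↦ G (z', b))
          ((fderiv ℝ (fun y ↦ Φ (J (y, b))) (q z)).comp q) z :=
        HasFDerivAt.comp (g := fun y ↦ Φ (J (y, b))) z h2.hasFDerivAt q.hasFDerivAt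
      rw [h3.unique h1]
      exact hinj
  have hnh : X.perturb Y ⁻¹' U ∈ 𝓝 (0 : Fin n → ℝ) :=
    (X.tendsto_perturb Y).eventually (hU.mem_nhds hX)
  obtain ⟨b, hbU, hb⟩ : ∃ b ∈ X.perturb Y ⁻¹' U, b ∉ Prod.snd '' S := by
    by_contra! hsub
    exact (Measure.measure_pos_of_mem_nhds volume hnh).ne' (measure_mono_null hsub hS)
  refine ⟨_, hbU, fun x hx h0 ↦ ?_⟩
  obtain ⟨z, rfl⟩ := hq x
  have heq : (fun y ↦ Φ (oneJet (localRep (X.perturb Y b).field c) y)) =ᶠ[𝓝 (q z)]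
      fun y ↦ Φ (J (y, b)) := by
    filter_upwards [(chartAt E3 c).open_target.mem_nhds (hN hx)] with y hy
    rw [hJ y hy]
  rw [heq.fderiv_eq]
  by_contra hni
  exact hb ⟨(z, b), ⟨hx, hbU, by rw [hJ _ (hN hx)] at h0; exact h0, hni⟩, rfl⟩

end Density

/-! ### Openness of transversality and adapted local sections -/

section LocalDensity

open Set Filter

variable {M : Type*} [TopologicalSpace M] [ChartedSpace E3 M] [IsManifold (𝓡 3) ∞ M]
  {r : ℕ∞} {η : PlaneField M r}

theorem continuous_clm_prod {E F G : Type*} [NormedAddCommGroup E] [NormedSpace ℝ E]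
    [NormedAddCommGroup F] [NormedSpace ℝ F] [NormedAddCommGroup G] [NormedSpace ℝ G] :
    Continuous fun z : (E →L[ℝ] F) × (E →L[ℝ] G) ↦ z.1.prod z.2 := by
  have : (fun z : (E →L[ℝ] F) × (E →L[ℝ] G) ↦ z.1.prod z.2) = fun z ↦
      (ContinuousLinearMap.inl ℝ F G).comp z.1 + (ContinuousLinearMap.inr ℝ F G).comp z.2 := by
    ext z x <;> simp
  rw [this]
  fun_prop

/-- The zeros of `X` over `K` at which `σ(DX)` vanishes are nondegenerate as zeros of
`(X, σ(DX))`. -/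
def IsTransverseOn (σ : (E3 →L[ℝ] E3) → ℝ) (c : M) (K : Set E3)
    (X : ∀ q : M, TangentSpace (𝓡 3) q) : Prop :=
  ∀ x ∈ K, localRep X c x = 0 → σ (fderiv ℝ (localRep X c) x) = 0 →
    Function.Injective ((fderiv ℝ (localRep X c) x).prod
      (fderiv ℝ (fun y ↦ σ (fderiv ℝ (localRep X c) y)) x))

theorem fderiv_comp_fderiv {σ : (E3 →L[ℝ] E3) → ℝ} (hσ : ContDiff ℝ ∞ σ) {f : E3 → E3} {x : E3}
    (hf : ContDiffAt ℝ 2 f x) : HasFDerivAt (fun y ↦ σ (fderiv ℝ f y))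
      ((fderiv ℝ σ (fderiv ℝ f x)).comp (fderiv ℝ (fderiv ℝ f) x)) x :=
  HasFDerivAt.comp (g := σ) x (hσ.differentiable (by simp) _).hasFDerivAt
    ((hf.fderiv_right (m := 1) (by norm_num)).differentiableAt (by norm_num)).hasFDerivAt

/-- By the chain rule the differential of `σ(DX)` is `dσ(DX) ∘ D²X`, so the condition is an open one
on the two-jet, and it is imposed over a compact set. -/
theorem isOpen_isTransverseOn (hr : 2 ≤ r) {σ : (E3 →L[ℝ] E3) → ℝ} (hσ : ContDiff ℝ ∞ σ) {c : M}
    {K : Set E3} (hK : IsCompact K) (hKc : K ⊆ (chartAt E3 c).target) :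
    IsOpen {X : η.Section | IsTransverseOn σ c K X.field} := by
  have hσ' : Continuous (fderiv ℝ σ) := hσ.continuous_fderiv (by simp)
  let P : Set (ℝ × E3 × (E3 →L[ℝ] E3) × (E3 →L[ℝ] E3 →L[ℝ] E3)) :=
    {z | z.2.1 ≠ 0} ∪ ({z | σ z.2.2.1 ≠ 0} ∪
      {z | Function.Injective (z.2.2.1.prod ((fderiv ℝ σ z.2.2.1).comp z.2.2.2))})
  have hP : IsOpen P := by
    refine (isOpen_ne.preimage (by fun_prop)).union ((isOpen_ne.preimage ?_).union
      (ContinuousLinearMap.isOpen_injective.preimage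
        (f := fun z : ℝ × E3 × (E3 →L[ℝ] E3) × (E3 →L[ℝ] E3 →L[ℝ] E3) ↦
          z.2.2.1.prod ((fderiv ℝ σ z.2.2.1).comp z.2.2.2)) ?_))
    · exact hσ.continuous.comp (by fun_prop)
    · have h1 : Continuous fun z : ℝ × E3 × (E3 →L[ℝ] E3) × (E3 →L[ℝ] E3 →L[ℝ] E3) ↦
          (fderiv ℝ σ z.2.2.1).comp z.2.2.2 := (hσ'.comp (by fun_prop)).clm_comp (by fun_prop)
      have h2 : Continuous fun z : ℝ × E3 × (E3 →L[ℝ] E3) × (E3 →L[ℝ] E3 →L[ℝ] E3) ↦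
          z.2.2.1 := by fun_prop
      exact continuous_clm_prod.comp (h2.prodMk h1)
  convert isOpen_setOf_forall_twoJet_mem (η := η) hr hK hKc
    (continuousOn_const (c := (0 : ℝ))) hP using 1
  ext X
  refine forall₂_congr fun x hx ↦ ?_
  rw [(fderiv_comp_fderiv hσ ((X.contDiffAt (hKc hx)).of_le (WithTop.coe_le_coe.2 hr))).fderiv]
  simp only [P, twoJet, mem_union, mem_ofPred_eq]
  tauto

/-- Differentiating `ν · X = 0` at a zero leaves only the term `ν · DX`; thus the linearization
takes values in the plane `η(p)`. -/
theorem form_comp_fderiv_eq_zero {c p : M} (hp : p ∈ (chartAt E3 c).source) {O : Set E3}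
    (hO : O ∈ 𝓝 (chartAt E3 c p)) {ν : E3 → E3 →L[ℝ] ℝ} (hν : ContinuousAt ν (chartAt E3 c p))
    {X : ∀ q : M, TangentSpace (𝓡 3) q} (hνX : ∀ x ∈ O, ν x (localRep X c x) = 0)
    (hd : DifferentiableAt ℝ (localRep X c) (chartAt E3 c p)) (hX : X p = 0) :
    (ν (chartAt E3 c p)).comp (fderiv ℝ (localRep X c) (chartAt E3 c p)) = 0 := by
  have h1 := hasFDerivAt_clm_apply_of_eq_zero hν hd.hasFDerivAt
    ((localRep_eq_zero_iff _ hp).2 hX)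
  have h2 : (fun y ↦ ν y (localRep X c y)) =ᶠ[𝓝 (chartAt E3 c p)] fun _ ↦ 0 := by
    filter_upwards [hO] with y hy using hνX y hy
  exact (h1.congr_of_eventuallyEq h2.symm).unique (hasFDerivAt_const _ _)

theorem PlaneField.Section.differentiableAt (hr : 2 ≤ r) (X : η.Section) {c : M} {y : E3}
    (hy : y ∈ (chartAt E3 c).target) : DifferentiableAt ℝ (localRep X.field c) y :=
  ((X.contDiffAt hy).of_le (WithTop.coe_le_coe.2 hr)).differentiableAt (by norm_num)

/-- Near any point there are sections of `η` and a projection which is injective on `η`. -/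
theorem PlaneField.exists_adapted [T2Space M] (hr : 2 ≤ r) (η : PlaneField M r) {c p : M}
    (hp : p ∈ (chartAt E3 c).source) :
    ∃ π : E3 →L[ℝ] (Fin 2 → ℝ),
      (∀ᶠ x in 𝓝 (chartAt E3 c p), ∀ X : η.Section, π (localRep X.field c x) = 0 →
        localRep X.field c x = 0) ∧
      (∀ X : η.Section, X.field p = 0 → ∀ v,
        π (fderiv ℝ (localRep X.field c) (chartAt E3 c p) v) = 0 →
        fderiv ℝ (localRep X.field c) (chartAt E3 c p) v = 0) ∧
      ∃ Y : Fin 2 → η.Section, ∀ i, π (localRep (Y i).field c (chartAt E3 c p)) =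
        Pi.single i 1 := by
  obtain ⟨O, hO, hpO, -, ν, hν, hν0, hνX, hw⟩ := η.exists_defining_form hp
  obtain ⟨π, hπ⟩ := exists_prod_injective_of_ne_zero (hν0 _ hpO)
  refine ⟨π, ?_, ?_, ?_⟩
  · have hcont : ContinuousAt (fun x ↦ π.prod (ν x)) (chartAt E3 c p) :=
      (continuous_clm_prod.tendsto (π, ν (chartAt E3 c p))).comp
        (tendsto_const_nhds.prodMk_nhds (hν.continuousAt (hO.mem_nhds hpO)))
    filter_upwards [hO.mem_nhds hpO,
      hcont.eventually (ContinuousLinearMap.isOpen_injective.mem_nhds hπ)] with x hx hinj X hX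
    refine hinj ?_
    rw [map_zero]
    exact Prod.ext hX (hνX x hx X)
  · intro X hX v hv
    have h1 := form_comp_fderiv_eq_zero hp (hO.mem_nhds hpO) (hν.continuousAt (hO.mem_nhds hpO))
      (fun x hx ↦ hνX x hx X) (X.differentiableAt hr ((chartAt E3 c).map_source hp)) hX
    refine hπ ?_
    rw [map_zero]
    exact Prod.ext hv (DFunLike.congr_fun h1 v)
  · have hsurj : Function.Surjective (π.prod (ν (chartAt E3 c p))) :=
      (LinearMap.injective_iff_surjective_of_finrank_eq_finrank
        (f := (π.prod (ν (chartAt E3 c p)) : E3 →ₗ[ℝ] (Fin 2 → ℝ) × ℝ)) (by simp)).1 hπ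
    have : ∀ i : Fin 2, ∃ Y : η.Section,
        π (localRep Y.field c (chartAt E3 c p)) = Pi.single i 1 := by
      intro i
      obtain ⟨w, hw'⟩ := hsurj (Pi.single i 1, 0)
      obtain ⟨v, hv, hvw⟩ := hw w (congrArg Prod.snd hw')
      obtain ⟨Y, hY⟩ := η.exists_section_field_eq hv
      refine ⟨Y, ?_⟩
      rw [localRep_chartAt _ hp, hY]
      refine (congrArg π hvw).trans (congrArg Prod.fst hw')
    exact ⟨fun i ↦ (this i).choose, fun i ↦ (this i).choose_spec⟩

/-- A multiple of a given section with vanishing value and prescribed derivative at a point. -/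
theorem PlaneField.Section.exists_fderiv_eq [T2Space M] (hr : 2 ≤ r) (Y : η.Section) {c p : M}
    (hp : p ∈ (chartAt E3 c).source) (l : E3 →L[ℝ] ℝ) :
    ∃ Y' : η.Section, localRep Y'.field c (chartAt E3 c p) = 0 ∧
      fderiv ℝ (localRep Y'.field c) (chartAt E3 c p) =
        l.smulRight (localRep Y.field c (chartAt E3 c p)) := by
  obtain ⟨Y', hY'⟩ := Y.exists_mul hp (ℓ := fun y ↦ l (y - chartAt E3 c p)) (by fun_prop)
  refine ⟨Y', by rw [hY'.eq_of_nhds]; simp, ?_⟩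
  rw [hY'.fderiv_eq]
  have h1 : HasFDerivAt (fun y ↦ l (y - chartAt E3 c p)) l (chartAt E3 c p) :=
    l.hasFDerivAt.comp _ ((hasFDerivAt_id _).sub_const _)
  have h2 : HasFDerivAt (localRep Y.field c) _ (chartAt E3 c p) :=
    (Y.differentiableAt hr ((chartAt E3 c).map_source hp)).hasFDerivAt
  refine (h1.smul h2).fderiv.trans ?_
  simp

end LocalDensity

/-! ### Local density of the transversality conditions -/

section LocalDensity

open Set Filter

theorem exists_closedBall_forall_mem {x₀ : E3} {O : Set E3} (hO : O ∈ 𝓝 x₀) {Q : E3 → Prop}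
    (hQ : ∀ᶠ x in 𝓝 x₀, Q x) : ∃ K ∈ 𝓝 x₀, IsCompact K ∧ K ⊆ O ∧ ∀ x ∈ K, Q x := by
  obtain ⟨e, he, hsub⟩ := Metric.nhds_basis_closedBall.mem_iff.1 (inter_mem hO hQ)
  exact ⟨_, Metric.closedBall_mem_nhds x₀ he, isCompact_closedBall x₀ e,
    fun x hx ↦ (hsub hx).1, fun x hx ↦ (hsub hx).2⟩

theorem _root_.ContinuousAt.clm_prod {X E F G : Type*} [TopologicalSpace X] [NormedAddCommGroup E]
    [NormedSpace ℝ E] [NormedAddCommGroup F] [NormedSpace ℝ F] [NormedAddCommGroup G]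
    [NormedSpace ℝ G] {f : X → E →L[ℝ] F} {g : X → E →L[ℝ] G} {x : X} (hf : ContinuousAt f x)
    (hg : ContinuousAt g x) : ContinuousAt (fun y ↦ (f y).prod (g y)) x := by
  have h1 := continuous_clm_prod.continuousAt (x := (f x, g x))
  exact ContinuousAt.comp (f := fun y ↦ (f y, g y))
    (g := fun z : (E →L[ℝ] F) × (E →L[ℝ] G) ↦ z.1.prod z.2) h1 (hf.prodMk hg)

theorem continuousAt_sumSMul {X F : Type*} {n : ℕ} [TopologicalSpace X] [NormedAddCommGroup F]
    [NormedSpace ℝ F] {w : Fin n → X → F} {x : X} (hw : ∀ i, ContinuousAt (w i) x) :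
    ContinuousAt (fun y ↦ sumSMul fun i ↦ w i y) x := by
  simp only [sumSMul]
  refine tendsto_finsetSum _ fun i _ ↦ ?_
  exact ContinuousAt.comp (g := ContinuousLinearMap.smulRightL ℝ (Fin n → ℝ) F
    (ContinuousLinearMap.proj i : (Fin n → ℝ) →L[ℝ] ℝ))
    (ContinuousLinearMap.continuous _).continuousAt (hw i)

theorem sumSMul_three {F : Type*} [NormedAddCommGroup F] [NormedSpace ℝ F] {w : Fin 3 → F}
    {β : Fin 3 → ℝ} (h0 : β 0 = 0) (h1 : β 1 = 0) : sumSMul w β = β 2 • w 2 := by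
  simp [sumSMul_apply, Fin.sum_univ_three, h0, h1]

theorem sumSMul_four {F : Type*} [NormedAddCommGroup F] [NormedSpace ℝ F] {w : Fin 4 → F}
    {β : Fin 4 → ℝ} (h0 : β 0 = 0) (h1 : β 1 = 0) :
    sumSMul w β = β 2 • w 2 + β 3 • w 3 := by
  simp [sumSMul_apply, Fin.sum_univ_four, h0, h1]

variable {M : Type*} [TopologicalSpace M] [ChartedSpace E3 M] [IsManifold (𝓡 3) ∞ M]
  {r : ℕ∞} {η : PlaneField M r} {n : ℕ}

theorem continuousAt_jetVariation {Y : Fin n → E3 → E3} {x : E3}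
    (hY : ∀ i, ContDiffAt ℝ 2 (Y i) x) : ContinuousAt (jetVariation Y) x := by
  have h1 := continuousAt_sumSMul (w := fun i ↦ Y i) fun i ↦ (hY i).continuousAt
  have h2 := continuousAt_sumSMul (w := fun i ↦ fderiv ℝ (Y i)) fun i ↦
    (hY i).continuousAt_fderiv (by norm_num)
  exact continuousAt_const.clm_prod (h1.clm_prod h2)

/-- The differential, at jets with derivative `D`, of `(X, D) ↦ (π X, σ D)`. -/
def jetDifferential (π : E3 →L[ℝ] (Fin 2 → ℝ)) (σ : (E3 →L[ℝ] E3) → ℝ) (D : E3 →L[ℝ] E3) :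
    E3 × E3 × (E3 →L[ℝ] E3) →L[ℝ] (Fin 2 → ℝ) × ℝ :=
  (π.comp ((ContinuousLinearMap.fst ℝ _ _).comp (ContinuousLinearMap.snd ℝ _ _))).prod
    ((fderiv ℝ σ D).comp ((ContinuousLinearMap.snd ℝ _ _).comp (ContinuousLinearMap.snd ℝ _ _)))

theorem hasFDerivAt_jetDifferential (π : E3 →L[ℝ] (Fin 2 → ℝ)) {σ : (E3 →L[ℝ] E3) → ℝ}
    (hσ : ContDiff ℝ ∞ σ) (j : E3 × E3 × (E3 →L[ℝ] E3)) :
    HasFDerivAt (fun j : E3 × E3 × (E3 →L[ℝ] E3) ↦ (π j.2.1, σ j.2.2))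
      (jetDifferential π σ j.2.2) j := by
  have h1 : HasFDerivAt (fun j : E3 × E3 × (E3 →L[ℝ] E3) ↦ j.2.1) _ j :=
    (hasFDerivAt_snd (𝕜 := ℝ) (p := j)).fst
  have h2 : HasFDerivAt (fun j : E3 × E3 × (E3 →L[ℝ] E3) ↦ j.2.2) _ j :=
    (hasFDerivAt_snd (𝕜 := ℝ) (p := j)).snd
  exact (π.hasFDerivAt.comp j h1).prodMk
    (HasFDerivAt.comp (g := σ) j (hσ.differentiable (by simp) _).hasFDerivAt h2)

theorem continuous_jetDifferential (π : E3 →L[ℝ] (Fin 2 → ℝ)) {σ : (E3 →L[ℝ] E3) → ℝ}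
    (hσ : ContDiff ℝ ∞ σ) : Continuous (jetDifferential π σ) :=
  continuous_clm_prod.comp (continuous_const.prodMk
    ((hσ.continuous_fderiv (by simp)).clm_comp continuous_const))

/-- At a zero `p`, two sections spanning the plane move `π X`, and a third, with value zero at `p`
and derivative `l ⊗ Y(p)`, moves `σ(DX)`. Together they are versal for the three equations `(π X,
σ(DX)) = 0`. Versality persists for nearby points and nearby sections, so parametric transversality
applies uniformly there. If `p` is not a zero, nearby sections have no zeros near `p`. -/
theorem exists_local_dense_isTransverseOn [T2Space M] (hr : 2 ≤ r) {σ : (E3 →L[ℝ] E3) → ℝ}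
    (hσ : ContDiff ℝ ∞ σ) {c p : M} (hp : p ∈ (chartAt E3 c).source) (X₀ : η.Section)
    (h : X₀.field p = 0 → ∃ (Y : η.Section) (l : E3 →L[ℝ] ℝ),
      fderiv ℝ σ (fderiv ℝ (localRep X₀.field c) (chartAt E3 c p))
        (l.smulRight (localRep Y.field c (chartAt E3 c p))) ≠ 0) :
    ∃ K ∈ 𝓝 (chartAt E3 c p), IsCompact K ∧ K ⊆ (chartAt E3 c).target ∧
      ∃ U : Set η.Section, IsOpen U ∧ X₀ ∈ U ∧ ∀ X ∈ U, ∀ O : Set η.Section, IsOpen O → X ∈ O →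
        ∃ X' ∈ O ∩ U, IsTransverseOn σ c K X'.field := by
  have hr2 : (2 : ℕ∞ω) ≤ (r : ℕ∞ω) := WithTop.coe_le_coe.2 hr
  have htgt : chartAt E3 c p ∈ (chartAt E3 c).target := (chartAt E3 c).map_source hp
  have hnh : (chartAt E3 c).target ∈ 𝓝 (chartAt E3 c p) := (chartAt E3 c).open_target.mem_nhds htgt
  have hc2 : ∀ (Z : η.Section), ∀ x ∈ (chartAt E3 c).target,
      ContDiffAt ℝ 2 (localRep Z.field c) x := fun Z x hx ↦ (Z.contDiffAt hx).of_le hr2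
  by_cases hX₀ : X₀.field p = 0
  swap
  · have hne : localRep X₀.field c (chartAt E3 c p) ≠ 0 := fun h0 ↦
      hX₀ ((localRep_eq_zero_iff _ hp).1 h0)
    obtain ⟨K, hK, hKc, hKt, hKQ⟩ := exists_closedBall_forall_mem hnh
      ((hc2 X₀ _ htgt).continuousAt.eventually_ne hne)
    refine ⟨K, hK, hKc, hKt, _, isOpen_setOf_forall_twoJet_mem (η := η) hr hKc hKt
      (continuousOn_const (c := (0 : ℝ))) (P := {z | z.2.1 ≠ 0})
      (isOpen_ne.preimage (by fun_prop)), hKQ, fun X hX O hO hXO ↦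
      ⟨X, ⟨hXO, hX⟩, fun x hx h0 ↦ absurd h0 (hX x hx)⟩⟩
  obtain ⟨Y₃, l, hl⟩ := h hX₀
  obtain ⟨π, hπ, -, Y, hY⟩ := η.exists_adapted hr hp
  obtain ⟨Z, hZ0, hZ1⟩ := Y₃.exists_fderiv_eq hr hp l
  let W : Fin 3 → η.Section := ![Y 0, Y 1, Z]
  let w : Fin 3 → E3 → E3 := fun i ↦ localRep (W i).field c
  -- Versality of the perturbation, required only at zeros, is open in the variation and the
  -- two-jet; hence it spreads from `X₀` at `p` to a compact neighbourhood and an open set of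
  -- sections.
  let P : Set (((Fin 3 → ℝ) →L[ℝ] E3 × E3 × (E3 →L[ℝ] E3)) ×
      E3 × (E3 →L[ℝ] E3) × (E3 →L[ℝ] E3 →L[ℝ] E3)) :=
    {z | z.2.1 ≠ 0} ∪ {z | Function.Injective ((jetDifferential π σ z.2.2.1).comp z.1)}
  have hP : IsOpen P := by
    refine (isOpen_ne.preimage (by fun_prop)).union
      (ContinuousLinearMap.isOpen_injective.preimage
        (f := fun z : ((Fin 3 → ℝ) →L[ℝ] E3 × E3 × (E3 →L[ℝ] E3)) ×
          E3 × (E3 →L[ℝ] E3) × (E3 →L[ℝ] E3 →L[ℝ] E3) ↦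
          (jetDifferential π σ z.2.2.1).comp z.1) ?_)
    exact ((continuous_jetDifferential π hσ).comp (by fun_prop)).clm_comp (by fun_prop)
  have hPX : (jetVariation w (chartAt E3 c p), twoJet (localRep X₀.field c) (chartAt E3 c p)) ∈
      P := by
    refine Or.inr ?_
    change Function.Injective ((jetDifferential π σ (fderiv ℝ (localRep X₀.field c)
      (chartAt E3 c p))).comp (jetVariation w (chartAt E3 c p)))
    rw [injective_iff_map_eq_zero]
    intro β hβ
    have h1 : π (sumSMul (fun i ↦ w i (chartAt E3 c p)) β) = 0 := congrArg Prod.fst hβ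
    have h2 : fderiv ℝ σ (fderiv ℝ (localRep X₀.field c) (chartAt E3 c p))
      (sumSMul (fun i ↦ fderiv ℝ (w i) (chartAt E3 c p)) β) = 0 := congrArg Prod.snd hβ
    rw [sumSMul_apply, Fin.sum_univ_three] at h1
    have hw0 : π (w 0 (chartAt E3 c p)) = Pi.single 0 1 := hY 0
    have hw1 : π (w 1 (chartAt E3 c p)) = Pi.single 1 1 := hY 1
    have hw2 : w 2 (chartAt E3 c p) = 0 := hZ0
    have hw3 : fderiv ℝ (w 2) (chartAt E3 c p) = _ := hZ1
    rw [map_add, map_add, map_smul, map_smul, hw0, hw1, hw2, smul_zero, map_zero, add_zero] at h1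
    have hb0 : β 0 = 0 := by simpa using congrFun h1 0
    have hb1 : β 1 = 0 := by simpa using congrFun h1 1
    rw [sumSMul_three hb0 hb1, hw3, map_smul, smul_eq_mul] at h2
    have hb2 : β 2 = 0 := (mul_eq_zero.1 h2).resolve_right hl
    ext i
    fin_cases i <;> assumption
  have hcont : ContinuousAt (fun x ↦ (jetVariation w x, twoJet (localRep X₀.field c) x))
      (chartAt E3 c p) :=
    (continuousAt_jetVariation fun i ↦ hc2 (W i) _ htgt).prodMk
      (continuousAt_twoJet (hc2 X₀ _ htgt))
  obtain ⟨K, hK, hKc, hKt, hKQ⟩ := exists_closedBall_forall_mem hnh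
    (hπ.and (hcont.eventually (hP.mem_nhds hPX)))
  refine ⟨K, hK, hKc, hKt, _, isOpen_setOf_forall_twoJet_mem (η := η) hr hKc hKt
      (g := jetVariation w) (fun x hx ↦ (continuousAt_jetVariation fun i ↦
        hc2 (W i) _ (hKt hx)).continuousWithinAt) hP, fun x hx ↦ (hKQ x hx).2, ?_⟩
  intro X hX O hO hXO
  let A : ((Fin 2 → ℝ) × ℝ) ≃L[ℝ] (Fin 3 → ℝ) := ContinuousLinearEquiv.ofFinrankEq (by simp)
  let q : (Fin 3 → ℝ) ≃L[ℝ] E3 := ContinuousLinearEquiv.ofFinrankEq (by simp)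
  let Φ : E3 × E3 × (E3 →L[ℝ] E3) → (Fin 3 → ℝ) := fun j ↦ A (π j.2.1, σ j.2.2)
  have hΦd : ContDiff ℝ 1 Φ :=
    A.contDiff.comp ((π.contDiff.comp (by fun_prop)).prodMk
      ((hσ.of_le (WithTop.coe_le_coe.2 le_top)).comp (by fun_prop)))
  have hΦf : ∀ j, fderiv ℝ Φ j = (A : ((Fin 2 → ℝ) × ℝ) →L[ℝ] (Fin 3 → ℝ)).comp
      (jetDifferential π σ j.2.2) := fun j ↦
    (A.hasFDerivAt.comp j (hasFDerivAt_jetDifferential π hσ j)).fderiv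
  have hΦ0 : ∀ j, Φ j = 0 → π j.2.1 = 0 := fun j hj ↦
    congrArg Prod.fst (A.map_eq_zero_iff.1 hj)
  obtain ⟨X', hX', hX'K⟩ := exists_perturb_transverse hr hKt (Φ := Φ)
    (fun x _ j ↦ hΦd.contDiffAt) (q : (Fin 3 → ℝ) →L[ℝ] E3) q.surjective W
    (hO.inter (isOpen_setOf_forall_twoJet_mem (η := η) hr hKc hKt
      (g := jetVariation w) (fun x hx ↦ (continuousAt_jetVariation fun i ↦
        hc2 (W i) _ (hKt hx)).continuousWithinAt) hP)) (by
      -- Over `K` the vanishing of `π` on a section forces the section to vanish, which leaves the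
      -- second alternative in `P`.
      rintro V ⟨-, hV⟩ x hx hΦV
      have hV0 := (hKQ x hx).1 V (hΦ0 _ hΦV)
      have hinj := (hV x hx).resolve_left fun hne ↦ hne hV0
      rw [hΦf]
      exact A.injective.comp hinj) (X := X) ⟨hXO, hX⟩
  refine ⟨X', hX', fun x hx h0 hσ0 ↦ ?_⟩
  have hz := hX'K x hx (by
    change A (π (localRep X'.field c x), σ (fderiv ℝ (localRep X'.field c) x)) = 0
    rw [h0, hσ0, map_zero]
    exact map_zero A)
  have hd1 := ((hc2 X' x (hKt hx)).differentiableAt (by norm_num)).hasFDerivAt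
  have hd2 := fderiv_comp_fderiv hσ (hc2 X' x (hKt hx))
  have hd3 : HasFDerivAt (fun y ↦ Φ (oneJet (localRep X'.field c) y)) _ x :=
    A.hasFDerivAt.comp x ((π.hasFDerivAt.comp x hd1).prodMk hd2)
  rw [hd3.fderiv] at hz
  rw [injective_iff_map_eq_zero]
  intro v hv
  have hv1 : fderiv ℝ (localRep X'.field c) x v = 0 := congrArg Prod.fst hv
  have hv2 : fderiv ℝ (fun y ↦ σ (fderiv ℝ (localRep X'.field c) y)) x v = 0 :=
    congrArg Prod.snd hv
  rw [hd2.fderiv] at hv2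
  obtain ⟨z, rfl⟩ := q.surjective v
  have hzz : z = 0 := by
    apply hz
    rw [map_zero]
    change A (π (fderiv ℝ (localRep X'.field c) x (q z)), ((fderiv ℝ σ _).comp _) (q z)) = 0
    rw [hv1, hv2, map_zero]
    exact map_zero A
  rw [hzz, map_zero]

/-- Sections whose linearization along `η` does not vanish at zeros are locally dense. -/
theorem exists_local_dense_fderiv_ne_zero [T2Space M] (hr : 2 ≤ r) (η : PlaneField M r) {c p : M}
    (hp : p ∈ (chartAt E3 c).source) :
    ∃ K ∈ 𝓝 (chartAt E3 c p), IsCompact K ∧ K ⊆ (chartAt E3 c).target ∧ ∃ Y : η.Section,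
      Dense {X : η.Section | ∀ x ∈ K, localRep X.field c x ≠ 0 ∨
        fderiv ℝ (localRep X.field c) x (localRep Y.field c x) ≠ 0} := by
  have hr2 : (2 : ℕ∞ω) ≤ (r : ℕ∞ω) := WithTop.coe_le_coe.2 hr
  have htgt : chartAt E3 c p ∈ (chartAt E3 c).target := (chartAt E3 c).map_source hp
  have hnh : (chartAt E3 c).target ∈ 𝓝 (chartAt E3 c p) := (chartAt E3 c).open_target.mem_nhds htgt
  have hc2 : ∀ (Z : η.Section), ∀ x ∈ (chartAt E3 c).target,
      ContDiffAt ℝ 2 (localRep Z.field c) x := fun Z x hx ↦ (Z.contDiffAt hx).of_le hr2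
  obtain ⟨π, hπ, -, Y, hY⟩ := η.exists_adapted hr hp
  have hY0 : localRep (Y 0).field c (chartAt E3 c p) ≠ 0 := by
    intro h0
    have := congrFun (hY 0) 0
    rw [h0, map_zero] at this
    simp at this
  -- Since `l` is one on `Y 0` at `p`, the sections with derivatives `l ⊗ Y 0` and `l ⊗ Y 1` move
  -- `DX(Y 0)` in both directions of the plane while fixing the value of `X` at `p`.
  obtain ⟨l, hl⟩ := SeparatingDual.exists_eq_one (R := ℝ) hY0
  obtain ⟨Z₀, hZ₀, hZ₀'⟩ := (Y 0).exists_fderiv_eq hr hp l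
  obtain ⟨Z₁, hZ₁, hZ₁'⟩ := (Y 1).exists_fderiv_eq hr hp l
  let W : Fin 4 → η.Section := ![Y 0, Y 1, Z₀, Z₁]
  let w : Fin 4 → E3 → E3 := fun i ↦ localRep (W i).field c
  let T : E3 → (E3 × E3 × (E3 →L[ℝ] E3) →L[ℝ] (Fin 2 → ℝ) × (Fin 2 → ℝ)) := fun x ↦
    (π.comp ((ContinuousLinearMap.fst ℝ _ _).comp (ContinuousLinearMap.snd ℝ _ _))).prod
    (π.comp ((ContinuousLinearMap.apply ℝ E3 (localRep (Y 0).field c x)).comp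
      ((ContinuousLinearMap.snd ℝ _ _).comp (ContinuousLinearMap.snd ℝ _ _))))
  have hT : ContinuousAt (fun x ↦ (T x).comp (jetVariation w x)) (chartAt E3 c p) := by
    refine ContinuousAt.clm_comp ?_ (continuousAt_jetVariation fun i ↦ hc2 (W i) _ htgt)
    refine continuousAt_const.clm_prod ?_
    refine ContinuousAt.clm_comp continuousAt_const (ContinuousAt.clm_comp ?_ continuousAt_const)
    exact (ContinuousLinearMap.apply ℝ E3).continuous.continuousAt.comp
      (hc2 (Y 0) _ htgt).continuousAt
  have hTinj : Function.Injective ((T (chartAt E3 c p)).comp (jetVariation w (chartAt E3 c p))) := by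
    rw [injective_iff_map_eq_zero]
    intro β hβ
    have h1 : π (sumSMul (fun i ↦ w i (chartAt E3 c p)) β) = 0 := congrArg Prod.fst hβ
    have h2 : π (sumSMul (fun i ↦ fderiv ℝ (w i) (chartAt E3 c p)) β
      (localRep (Y 0).field c (chartAt E3 c p))) = 0 := congrArg Prod.snd hβ
    rw [sumSMul_apply, Fin.sum_univ_four] at h1
    have hw0 : π (w 0 (chartAt E3 c p)) = Pi.single 0 1 := hY 0
    have hw1 : π (w 1 (chartAt E3 c p)) = Pi.single 1 1 := hY 1
    have hw2 : w 2 (chartAt E3 c p) = 0 := hZ₀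
    have hw3 : w 3 (chartAt E3 c p) = 0 := hZ₁
    have hw2' : fderiv ℝ (w 2) (chartAt E3 c p) = _ := hZ₀'
    have hw3' : fderiv ℝ (w 3) (chartAt E3 c p) = _ := hZ₁'
    rw [map_add, map_add, map_add, map_smul, map_smul, hw0, hw1, hw2, hw3, smul_zero, smul_zero,
      map_zero, add_zero, add_zero] at h1
    have hb0 : β 0 = 0 := by simpa using congrFun h1 0
    have hb1 : β 1 = 0 := by simpa using congrFun h1 1
    rw [sumSMul_four hb0 hb1, hw2', hw3',
      add_apply, smul_apply, smul_apply, ContinuousLinearMap.smulRight_apply,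
      ContinuousLinearMap.smulRight_apply, hl, one_smul, one_smul, map_add, map_smul, map_smul,
      hY 0, hY 1] at h2
    have hb2 : β 2 = 0 := by simpa using congrFun h2 0
    have hb3 : β 3 = 0 := by simpa using congrFun h2 1
    ext i
    fin_cases i <;> assumption
  obtain ⟨K, hK, hKc, hKt, hKQ⟩ := exists_closedBall_forall_mem hnh
    (hT.eventually (ContinuousLinearMap.isOpen_injective.mem_nhds hTinj))
  refine ⟨K, hK, hKc, hKt, Y 0, ?_⟩
  rw [dense_iff_inter_open]
  rintro O hO ⟨X, hX⟩
  let A : ((Fin 2 → ℝ) × (Fin 2 → ℝ)) ≃L[ℝ] (Fin 4 → ℝ) :=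
    ContinuousLinearEquiv.ofFinrankEq (by simp)
  -- There are four equations and three variables; one dummy variable makes the dimensions equal.
  obtain ⟨q, hq⟩ : ∃ q : (Fin 4 → ℝ) →L[ℝ] E3, Function.Surjective q := by
    let q : (Fin 3 → ℝ) ≃L[ℝ] E3 := ContinuousLinearEquiv.ofFinrankEq (by simp)
    refine ⟨(q : (Fin 3 → ℝ) →L[ℝ] E3).comp
      (ContinuousLinearMap.pi fun i : Fin 3 ↦ ContinuousLinearMap.proj i.castSucc), ?_⟩
    refine q.surjective.comp fun v ↦ ⟨Fin.snoc v 0, ?_⟩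
    ext i
    simp
  let Φ : E3 × E3 × (E3 →L[ℝ] E3) → (Fin 4 → ℝ) := fun j ↦
    A (π j.2.1, π (j.2.2 (localRep (Y 0).field c j.1)))
  have hYd : ∀ x ∈ K, ∀ j : E3 × (E3 →L[ℝ] E3), ContDiffAt ℝ 1
      (fun j : E3 × E3 × (E3 →L[ℝ] E3) ↦ localRep (Y 0).field c j.1) (x, j) := fun x hx j ↦
    ContDiffAt.comp (g := localRep (Y 0).field c) (x, j)
      ((hc2 (Y 0) x (hKt hx)).of_le (by norm_num)) contDiffAt_fst
  have hΦd : ∀ x ∈ K, ∀ j, ContDiffAt ℝ 1 Φ (x, j) := fun x hx j ↦ by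
    refine A.contDiff.contDiffAt.comp (x, j) (ContDiffAt.prodMk ?_ ?_)
    · exact π.contDiff.contDiffAt.comp (x, j) (by fun_prop)
    · refine π.contDiff.contDiffAt.comp (x, j) (ContDiffAt.clm_apply ?_ (hYd x hx j))
      fun_prop
  have hΦf : ∀ x ∈ K, ∀ j v, fderiv ℝ Φ (x, j) (0, v) = A (T x (0, v)) := fun x hx j v ↦ by
    have h1 : HasFDerivAt Φ (fderiv ℝ Φ (x, j)) (x, j) :=
      ((hΦd x hx j).differentiableAt (by norm_num)).hasFDerivAt
    have h2 : HasFDerivAt (fun j : E3 × (E3 →L[ℝ] E3) ↦ Φ (x, j)) _ j :=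
      HasFDerivAt.comp (g := Φ) j h1 (hasFDerivAt_prodMk_right x j)
    -- For a fixed base point the equation is linear in the jet, and the variations do not move the
    -- base point; so only this partial derivative is needed.
    let B : E3 × (E3 →L[ℝ] E3) →L[ℝ] (Fin 4 → ℝ) :=
      ((A : ((Fin 2 → ℝ) × (Fin 2 → ℝ)) →L[ℝ] (Fin 4 → ℝ)).comp (T x)).comp
        (ContinuousLinearMap.inr ℝ _ _)
    have h3 : HasFDerivAt (fun j : E3 × (E3 →L[ℝ] E3) ↦ Φ (x, j)) B j := B.hasFDerivAt
    exact congrArg (fun L ↦ L v) (h2.unique h3)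
  obtain ⟨X', hX', hX'K⟩ := exists_perturb_transverse hr hKt hΦd q hq W hO (by
      intro V _ x hx _
      rw [injective_iff_map_eq_zero]
      intro β hβ
      have h1 : jetVariation w x β = (0, (jetVariation w x β).2) := rfl
      have h2 : fderiv ℝ Φ (x, _) (jetVariation w x β) = 0 := hβ
      rw [h1, hΦf x hx, ← h1, A.map_eq_zero_iff] at h2
      exact (injective_iff_map_eq_zero _).1 (hKQ x hx) β h2) (X := X) hX
  refine ⟨X', hX', fun x hx ↦ ?_⟩
  by_contra! hc
  have := hX'K x hx (by
    change A (π (localRep X'.field c x),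
      π (fderiv ℝ (localRep X'.field c) x (localRep (Y 0).field c x))) = 0
    rw [hc.1, hc.2, map_zero]
    exact map_zero A)
  -- At a common zero transversality would make the surjection `q` from dimension four to dimension
  -- three injective, so there are no common zeros.
  have hq2 : Function.Injective (q : (Fin 4 → ℝ) →ₗ[ℝ] E3) := fun a b hab ↦ this
    (congrArg (fderiv ℝ (fun y ↦ Φ (oneJet (localRep X'.field c) y)) x) hab)
  have := LinearMap.finrank_le_finrank_of_injective hq2
  simp at this

end LocalDensity

/-! ### Genericity of the trace and the second invariant -/

section Invariants

/-- The trace, as a continuous linear form on endomorphisms. -/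
def traceForm : (E3 →L[ℝ] E3) →L[ℝ] ℝ :=
  LinearMap.toContinuousLinearMap (LinearMap.trace ℝ E3 ∘ₗ ContinuousLinearMap.coeLM ℝ)

theorem traceForm_apply (D : E3 →L[ℝ] E3) :
    traceForm D = LinearMap.trace ℝ E3 (D : E3 →ₗ[ℝ] E3) := rfl

/-- The second invariant, as a function on continuous endomorphisms. -/
def secondForm (D : E3 →L[ℝ] E3) : ℝ := secondInvariant (D : E3 →ₗ[ℝ] E3)

theorem secondForm_eq (D : E3 →L[ℝ] E3) :
    secondForm D = traceForm D ^ 2 - traceForm (D.comp D) := rfl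

theorem contDiff_secondForm : ContDiff ℝ ∞ secondForm := by
  have : secondForm = fun D ↦ traceForm D ^ 2 - traceForm (D.comp D) := funext secondForm_eq
  rw [this]
  exact (traceForm.contDiff.pow 2).sub (traceForm.contDiff.comp (contDiff_id.clm_comp contDiff_id))

theorem traceForm_smulRight (l : E3 →L[ℝ] ℝ) (w : E3) : traceForm (l.smulRight w) = l w := by
  rw [traceForm_apply]
  exact LinearMap.trace_smulRight _ _

/-- In a direction `H` the derivative is `2 tr(D) tr(H) - 2 tr(D H)`. For `H = l ⊗ w` the two traces
are `l(w)` and `l(D w)`. -/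
theorem fderiv_secondForm_smulRight (D : E3 →L[ℝ] E3) (l : E3 →L[ℝ] ℝ) (w : E3) :
    fderiv ℝ secondForm D (l.smulRight w) = 2 * l (traceForm D • w - D w) := by
  have h1 : HasFDerivAt (fun D : E3 →L[ℝ] E3 ↦ traceForm D ^ 2 - traceForm (D.comp D)) _ D :=
    (traceForm.hasFDerivAt.pow 2).sub (traceForm.hasFDerivAt.comp D
      ((hasFDerivAt_id D).clm_comp (hasFDerivAt_id D)))
  have h2 : HasFDerivAt secondForm _ D := h1
  rw [h2.fderiv]
  have h3 : D.comp (l.smulRight w) = l.smulRight (D w) := by ext x; simp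
  have h4 : (l.smulRight w).comp D = (l.comp D).smulRight w := by ext x; simp
  simp [traceForm_smulRight, h3, h4]
  ring

end Invariants

/-! ### From local density to residual sets -/

section Residual

open Set Filter

theorem exists_finset_chart_cover {M : Type*} [TopologicalSpace M] [ChartedSpace E3 M]
    [CompactSpace M] {K : M → Set E3}
    (hK : ∀ p, K p ∈ 𝓝 (chartAt E3 p p)) :
    ∃ t : Finset M, ∀ q, ∃ p ∈ t, q ∈ (chartAt E3 p).source ∧ K p ∈ 𝓝 (chartAt E3 p q) := by
  have hU : ∀ p, {q | q ∈ (chartAt E3 p).source ∧ K p ∈ 𝓝 (chartAt E3 p q)} ∈ 𝓝 p := fun p ↦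
    inter_mem ((chartAt E3 p).open_source.mem_nhds (mem_chart_source E3 p))
      (((chartAt E3 p).continuousAt (mem_chart_source E3 p)).eventually
        (eventually_eventually_nhds.2 (hK p)))
  obtain ⟨t, -, ht⟩ := isCompact_univ.elim_nhds_subcover _ fun p _ ↦ hU p
  refine ⟨t, fun q ↦ ?_⟩
  obtain ⟨p, hp, hq⟩ := mem_iUnion₂.1 (ht (mem_univ q))
  exact ⟨p, hp, hq⟩

variable {M : Type*} [TopologicalSpace M] [ChartedSpace E3 M] [IsManifold (𝓡 3) ∞ M]
  {r : ℕ∞} {η : PlaneField M r}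

theorem exists_section_smulRight_ne_zero [T2Space M] (hr : 2 ≤ r) {c p : M}
    (hp : p ∈ (chartAt E3 c).source) : ∃ (Y : η.Section) (l : E3 →L[ℝ] ℝ),
      l (localRep Y.field c (chartAt E3 c p)) ≠ 0 := by
  obtain ⟨π, -, -, Y, hY⟩ := η.exists_adapted hr hp
  refine ⟨Y 0, (ContinuousLinearMap.proj 0).comp π, ?_⟩
  change π (localRep (Y 0).field c (chartAt E3 c p)) 0 ≠ 0
  rw [hY 0]
  simp

/-- The linearization maps into the plane and does not vanish on it, so some `w` in the plane
satisfies `tr(D) w ≠ D w`. A form `l` separating the two and a section through `w` give a nonzero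
derivative. -/
theorem exists_fderiv_secondForm_ne_zero [T2Space M] (hr : 2 ≤ r) {c p : M}
    (hp : p ∈ (chartAt E3 c).source) {X : η.Section} (hX : X.field p = 0)
    (h : ∃ Y : η.Section, fderiv ℝ (localRep X.field c) (chartAt E3 c p)
      (localRep Y.field c (chartAt E3 c p)) ≠ 0) :
    ∃ (Y : η.Section) (l : E3 →L[ℝ] ℝ),
      fderiv ℝ secondForm (fderiv ℝ (localRep X.field c) (chartAt E3 c p))
        (l.smulRight (localRep Y.field c (chartAt E3 c p))) ≠ 0 := by
  obtain ⟨O, hO, hpO, hOt, ν, hν, hν0, hνX, hw⟩ := η.exists_defining_form hp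
  have hνD := form_comp_fderiv_eq_zero hp (hO.mem_nhds hpO) (hν.continuousAt (hO.mem_nhds hpO))
    (fun x hx ↦ hνX x hx X) (X.differentiableAt hr (hOt hpO)) hX
  set D := fderiv ℝ (localRep X.field c) (chartAt E3 c p)
  have hfr : Module.finrank ℝ (LinearMap.ker (ν (chartAt E3 c p) : E3 →ₗ[ℝ] ℝ)) = 2 := by
    have h1 := (ν (chartAt E3 c p) : E3 →ₗ[ℝ] ℝ).finrank_range_add_finrank_ker
    rw [LinearMap.range_eq_top.2 (LinearMap.surjective fun h0 ↦ hν0 _ hpO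
      (ContinuousLinearMap.coe_injective h0)), finrank_top, Module.finrank_self,
      finrank_euclideanSpace_fin] at h1
    omega
  obtain ⟨Y, hY⟩ := h
  obtain ⟨w, hwk, hne⟩ := exists_mem_trace_smul_ne (D : E3 →ₗ[ℝ] E3)
    (LinearMap.ker (ν (chartAt E3 c p) : E3 →ₗ[ℝ] ℝ)) hfr
    (fun x ↦ DFunLike.congr_fun hνD x) ⟨_, hνX _ hpO Y, hY⟩
  obtain ⟨v, hv, hvw⟩ := hw w hwk
  obtain ⟨Z, hZ⟩ := η.exists_section_field_eq hv
  obtain ⟨l, hl⟩ := SeparatingDual.exists_ne_zero (R := ℝ) (sub_ne_zero.2 hne)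
  refine ⟨Z, l, ?_⟩
  rw [localRep_chartAt _ hp, hZ]
  have : (tangentCoordChange (𝓡 3) p c p) v = w := hvw
  erw [this]
  rw [fderiv_secondForm_smulRight]
  exact mul_ne_zero two_ne_zero hl

/-- Within any open set a section `X₀` of `S` is chosen, to which the local density result applies
at each point of `K`. A finite cover is then handled by successive small perturbations, each
preserving the transversality already achieved because that is an open condition. -/
theorem dense_isTransverseOn [T2Space M] (hr : 2 ≤ r) {σ : (E3 →L[ℝ] E3) → ℝ}
    (hσ : ContDiff ℝ ∞ σ) {c : M} {K : Set E3} (hK : IsCompact K)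
    (hKc : K ⊆ (chartAt E3 c).target) {S : Set η.Section} (hS : Dense S)
    (h : ∀ X ∈ S, ∀ p ∈ (chartAt E3 c).source, X.field p = 0 →
      ∃ (Y : η.Section) (l : E3 →L[ℝ] ℝ),
      fderiv ℝ σ (fderiv ℝ (localRep X.field c) (chartAt E3 c p))
        (l.smulRight (localRep Y.field c (chartAt E3 c p))) ≠ 0) :
    Dense {X : η.Section | IsTransverseOn σ c K X.field} := by
  rw [dense_iff_inter_open]
  intro O hO hOne
  obtain ⟨X₀, hX₀O, hX₀S⟩ := hS.inter_open_nonempty O hO hOne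
  -- The neighbourhood `U` depends only on `X₀`, and perturbation is possible from every section in
  -- `U`. This lets the process be restarted from an already perturbed section.
  have key : ∃ K', IsCompact K' ∧ K ⊆ K' ∧ K' ⊆ (chartAt E3 c).target ∧
      ∃ U : Set η.Section, IsOpen U ∧ X₀ ∈ U ∧ ∀ X ∈ U, ∀ O : Set η.Section, IsOpen O → X ∈ O →
        ∃ X' ∈ O ∩ U, IsTransverseOn σ c K' X'.field := by
    refine hK.induction_on (p := fun K ↦ ∃ K', IsCompact K' ∧ K ⊆ K' ∧
      K' ⊆ (chartAt E3 c).target ∧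
      ∃ U : Set η.Section, IsOpen U ∧ X₀ ∈ U ∧ ∀ X ∈ U, ∀ O : Set η.Section, IsOpen O → X ∈ O →
        ∃ X' ∈ O ∩ U, IsTransverseOn σ c K' X'.field) ?_ ?_ ?_ ?_
    · exact ⟨∅, isCompact_empty, Subset.rfl, empty_subset _, univ, isOpen_univ, mem_univ _,
        fun X hX O _ hXO ↦ ⟨X, ⟨hXO, hX⟩, fun x hx ↦ hx.elim⟩⟩
    · rintro A B hAB ⟨K', h1, h2, h3⟩
      exact ⟨K', h1, hAB.trans h2, h3⟩
    · rintro A B ⟨K₁, hK₁, hA, hK₁t, U₁, hU₁, hX₁, h₁⟩ ⟨K₂, hK₂, hB, hK₂t, U₂, hU₂, hX₂, h₂⟩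
      refine ⟨K₁ ∪ K₂, hK₁.union hK₂, union_subset_union hA hB, union_subset hK₁t hK₂t, U₁ ∩ U₂,
        hU₁.inter hU₂, ⟨hX₁, hX₂⟩, fun X hX O hO hXO ↦ ?_⟩
      obtain ⟨Z, ⟨⟨hZO, hZ₂⟩, hZ₁⟩, hZ⟩ := h₁ X hX.1 (O ∩ U₂) (hO.inter hU₂) ⟨hXO, hX.2⟩
      obtain ⟨Z', ⟨⟨⟨hO', hU'⟩, hT⟩, hZ₂'⟩, hZ'⟩ := h₂ Z hZ₂ (O ∩ U₁ ∩
        {X : η.Section | IsTransverseOn σ c K₁ X.field})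
        ((hO.inter hU₁).inter (isOpen_isTransverseOn hr hσ hK₁ hK₁t)) ⟨⟨hZO, hZ₁⟩, hZ⟩
      exact ⟨Z', ⟨hO', hU', hZ₂'⟩, fun x hx ↦ hx.elim (hT x) (hZ' x)⟩
    · intro x hx
      have hp := (chartAt E3 c).map_target (hKc hx)
      obtain ⟨K', hK', hK'c, hK't, hU⟩ := exists_local_dense_isTransverseOn hr hσ hp X₀
        (h X₀ hX₀S _ hp)
      rw [(chartAt E3 c).right_inv (hKc hx)] at hK'
      exact ⟨K', mem_nhdsWithin_of_mem_nhds hK', K', hK'c, Subset.rfl, hK't, hU⟩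
  obtain ⟨K', -, hKK', -, U, -, hX₀U, hU⟩ := key
  obtain ⟨X', hX', hT⟩ := hU X₀ hX₀U O hO hX₀O
  exact ⟨X', hX'.1, fun x hx ↦ hT x (hKK' hx)⟩

/-- Each of the locally dense conditions is also open, so finitely many of them, over a cover of
`M`, can be imposed at once. -/
theorem exists_dense_fderiv_ne_zero [T2Space M] [CompactSpace M] (hr : 2 ≤ r)
    (η : PlaneField M r) : ∃ S : Set η.Section, Dense S ∧ ∀ X ∈ S, ∀ p, X.field p = 0 →
      ∃ c, p ∈ (chartAt E3 c).source ∧ ∃ Y : η.Section,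
        fderiv ℝ (localRep X.field c) (chartAt E3 c p)
          (localRep Y.field c (chartAt E3 c p)) ≠ 0 := by
  choose K hK hKc hKt Y hY using fun p : M ↦
    exists_local_dense_fderiv_ne_zero hr η (mem_chart_source E3 p)
  obtain ⟨t, ht⟩ := exists_finset_chart_cover hK
  let S : M → Set η.Section := fun p ↦ {X | ∀ x ∈ K p, localRep X.field p x ≠ 0 ∨
        fderiv ℝ (localRep X.field p) x (localRep (Y p).field p x) ≠ 0}
  have hSo : ∀ p, IsOpen (S p) := fun p ↦ by
    refine isOpen_setOf_forall_twoJet_mem (η := η) hr (hKc p) (hKt p)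
      (g := localRep (Y p).field p) (((Y p).contDiffOn p).continuousOn.mono (hKt p))
      (P := {z | z.2.1 ≠ 0} ∪ {z | z.2.2.1 z.1 ≠ 0}) ?_
    exact (isOpen_ne.preimage (by fun_prop)).union (isOpen_ne.preimage
      (f := fun z : E3 × E3 × (E3 →L[ℝ] E3) × (E3 →L[ℝ] E3 →L[ℝ] E3) ↦ z.2.2.1 z.1) (by fun_prop))
  have hdense : ∀ s : Finset M, IsOpen (⋂ p ∈ s, S p) ∧ Dense (⋂ p ∈ s, S p) := by
    classical
    intro s
    induction s using Finset.induction_on with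
    | empty => simp
    | insert p s hp ih =>
      rw [Finset.set_biInter_insert]
      exact ⟨(hSo p).inter ih.1, (hY p).inter_of_isOpen_left ih.2 (hSo p)⟩
  refine ⟨_, (hdense t).2, fun X hX p hp ↦ ?_⟩
  obtain ⟨c, hc, hpc, hKp⟩ := ht p
  have := mem_iInter₂.1 hX c hc _ (mem_of_mem_nhds hKp)
  exact ⟨c, hpc, Y c, this.resolve_left fun h ↦ h ((localRep_eq_zero_iff _ hpc).2 hp)⟩

theorem exists_fderiv_ne_zero_of_chart {X Y : η.Section} {c c' p : M} (hr : 2 ≤ r)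
    (hc : p ∈ (chartAt E3 c).source) (hc' : p ∈ (chartAt E3 c').source) (hX : X.field p = 0)
    (h : fderiv ℝ (localRep X.field c') (chartAt E3 c' p)
      (localRep Y.field c' (chartAt E3 c' p)) ≠ 0) :
    fderiv ℝ (localRep X.field c) (chartAt E3 c p)
      (localRep Y.field c (chartAt E3 c p)) ≠ 0 := by
  have hd : HasFDerivAt (localRep X.field c') _ (chartAt E3 c' p) :=
    (X.differentiableAt hr ((chartAt E3 c').map_source hc')).hasFDerivAt
  rw [(hasFDerivAt_localRep_change hc hc' hX hd).fderiv, localRep_change _ hc hc']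
  simp only [ContinuousLinearMap.comp_apply]
  rw [tangentCoordChange_comp_self hc' hc]
  intro h0
  have := tangentCoordChange_comp_self hc' hc (fderiv ℝ (localRep X.field c') (chartAt E3 c' p)
      (localRep Y.field c' (chartAt E3 c' p)))
  rw [h0, map_zero] at this
  exact h this.symm

/-- Generically, the zeros with vanishing trace, or vanishing second invariant, of the
linearization are nondegenerate. -/
theorem residual_isTransverseOn [T2Space M] [CompactSpace M] (hr : 2 ≤ r) (η : PlaneField M r) :
    {X : η.Section | ∀ p : M, ∃ (c : M) (K : Set E3), p ∈ (chartAt E3 c).source ∧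
      K ∈ 𝓝 (chartAt E3 c p) ∧ IsTransverseOn traceForm c K X.field ∧
      IsTransverseOn secondForm c K X.field} ∈ residual η.Section := by
  have hloc : ∀ p : M, ∃ K ∈ 𝓝 (chartAt E3 p p), IsCompact K ∧ K ⊆ (chartAt E3 p).target :=
    fun p ↦ by
      obtain ⟨K, h1, h2, h3, -⟩ := exists_closedBall_forall_mem
        ((chartAt E3 p).open_target.mem_nhds (mem_chart_target E3 p))
        (Q := fun _ ↦ True) (Eventually.of_forall fun _ ↦ trivial)
      exact ⟨K, h1, h2, h3⟩
  choose K hK hKc hKt using hloc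
  obtain ⟨t, ht⟩ := exists_finset_chart_cover hK
  obtain ⟨S, hS, hSX⟩ := exists_dense_fderiv_ne_zero hr η
  have htr : ∀ p, {X : η.Section | IsTransverseOn traceForm p (K p) X.field} ∈
      residual η.Section := fun p ↦ by
    refine residual_of_dense_open (isOpen_isTransverseOn hr traceForm.contDiff (hKc p) (hKt p))
      (dense_isTransverseOn hr traceForm.contDiff (hKc p) (hKt p) dense_univ ?_)
    intro X _ q hq _
    obtain ⟨Y, l, hl⟩ := exists_section_smulRight_ne_zero (η := η) hr hq
    refine ⟨Y, l, ?_⟩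
    rwa [traceForm.hasFDerivAt.fderiv, traceForm_smulRight]
  have hse : ∀ p, {X : η.Section | IsTransverseOn secondForm p (K p) X.field} ∈
      residual η.Section := fun p ↦ by
    refine residual_of_dense_open (isOpen_isTransverseOn hr contDiff_secondForm (hKc p) (hKt p))
      (dense_isTransverseOn hr contDiff_secondForm (hKc p) (hKt p) hS ?_)
    intro X hX q hq hXq
    obtain ⟨c', hc', Y, hY⟩ := hSX X hX q hXq
    exact exists_fderiv_secondForm_ne_zero hr hq hXq
      ⟨Y, exists_fderiv_ne_zero_of_chart hr hq hc' hXq hY⟩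
  filter_upwards [(biInter_finset_mem t).2 fun p _ ↦ htr p,
    (biInter_finset_mem t).2 fun p _ ↦ hse p] with X h1 h2 q
  obtain ⟨p, hp, hq, hKq⟩ := ht q
  exact ⟨p, K p, hq, hKq, mem_iInter₂.1 h1 p hp, mem_iInter₂.1 h2 p hp⟩

end Residual

/-! ### Zeros of generic sections -/

section Zeros

open Set Filter

variable {M : Type*} [TopologicalSpace M] [ChartedSpace E3 M] [IsManifold (𝓡 3) ∞ M]
  {r : ℕ∞} {η : PlaneField M r}

/-- The zeros of `X` with vanishing trace, or vanishing second invariant, of the linearization are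
nondegenerate. -/
def HasTransverseInvariants (X : ∀ q : M, TangentSpace (𝓡 3) q) : Prop :=
  ∀ p : M, ∃ (c : M) (K : Set E3), p ∈ (chartAt E3 c).source ∧
    K ∈ 𝓝 (chartAt E3 c p) ∧ IsTransverseOn traceForm c K X ∧ IsTransverseOn secondForm c K X

theorem traceForm_secondForm_localRep_change (hr : 2 ≤ r) (X : η.Section) {c c' p : M}
    (hc : p ∈ (chartAt E3 c).source) (hc' : p ∈ (chartAt E3 c').source) (hp : X.field p = 0) :
    traceForm (fderiv ℝ (localRep X.field c) (chartAt E3 c p)) =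
      traceForm (fderiv ℝ (localRep X.field c') (chartAt E3 c' p)) ∧
    secondForm (fderiv ℝ (localRep X.field c) (chartAt E3 c p)) =
      secondForm (fderiv ℝ (localRep X.field c') (chartAt E3 c' p)) := by
  have hd : HasFDerivAt (localRep X.field c') _ (chartAt E3 c' p) :=
    (X.differentiableAt hr ((chartAt E3 c').map_source hc')).hasFDerivAt
  have h := (hasFDerivAt_localRep_change hc hc' hp hd).fderiv
  have h1 : (tangentCoordChange (𝓡 3) c c' p : E3 →ₗ[ℝ] E3) ∘ₗ
      (tangentCoordChange (𝓡 3) c' c p : E3 →ₗ[ℝ] E3) = LinearMap.id :=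
    LinearMap.ext fun v ↦ tangentCoordChange_comp_self hc' hc v
  have h2 := congrArg (fun D : E3 →L[ℝ] E3 ↦ (D : E3 →ₗ[ℝ] E3)) h
  exact ⟨trace_conj_equiv _ _ _ _ h1 h2, secondInvariant_conj_equiv _ _ _ _ h1 h2⟩

/-- The kernel is nonzero because `π` is injective on the image of the linearization, whose rank is
thus at most two. It has dimension at most one: either the second invariant is nonzero, or
transversality makes one scalar form injective on the kernel. -/
theorem finrank_ker_fderiv_eq_one [T2Space M] (hr : 2 ≤ r) (X : η.Section) {c p : M} {K : Set E3}
    (hp : p ∈ (chartAt E3 c).source) (hK : chartAt E3 c p ∈ K)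
    (hX : IsTransverseOn secondForm c K X.field) (hXp : X.field p = 0) :
    Module.finrank ℝ (LinearMap.ker
      (fderiv ℝ (localRep X.field c) (chartAt E3 c p) : E3 →ₗ[ℝ] E3)) = 1 := by
  set D := fderiv ℝ (localRep X.field c) (chartAt E3 c p) with hD
  refine le_antisymm ?_ ?_
  · by_cases h : secondForm D = 0
    · have hinj := hX _ hK ((localRep_eq_zero_iff _ hp).2 hXp) h
      set l := fderiv ℝ (fun y ↦ secondForm (fderiv ℝ (localRep X.field c) y)) (chartAt E3 c p)
      have := LinearMap.finrank_le_finrank_of_injective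
        (f := (l : E3 →ₗ[ℝ] ℝ) ∘ₗ (LinearMap.ker (D : E3 →ₗ[ℝ] E3)).subtype) (by
          intro v w hvw
          refine Subtype.ext (hinj (Prod.ext ?_ hvw))
          exact (LinearMap.mem_ker.1 v.2).trans (LinearMap.mem_ker.1 w.2).symm)
      simpa using this
    · exact finrank_ker_le_one_of_secondInvariant_ne_zero (by simp) _ h
  · obtain ⟨π, -, hπ, -⟩ := η.exists_adapted hr hp
    have h1 : LinearMap.ker ((π.comp D : E3 →L[ℝ] (Fin 2 → ℝ)) : E3 →ₗ[ℝ] (Fin 2 → ℝ)) ≤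
        LinearMap.ker (D : E3 →ₗ[ℝ] E3) := fun v hv ↦ hπ X hXp v hv
    have h2 := Submodule.finrank_mono h1
    have h3 := LinearMap.finrank_range_add_finrank_ker
      ((π.comp D : E3 →L[ℝ] (Fin 2 → ℝ)) : E3 →ₗ[ℝ] (Fin 2 → ℝ))
    have h4 := Submodule.finrank_le (LinearMap.range
      ((π.comp D : E3 →L[ℝ] (Fin 2 → ℝ)) : E3 →ₗ[ℝ] (Fin 2 → ℝ)))
    simp only [finrank_euclideanSpace, Fintype.card_fin, Module.finrank_fin_fun] at h3 h4
    omega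

/-- A map with injective differential at a point does not take the same value again nearby, so a
transverse solution of `(X, σ(DX)) = 0` is isolated. At other points continuity excludes solutions
nearby. -/
theorem IsTransverseOn.eventually_eq (hr : 2 ≤ r) {σ : (E3 →L[ℝ] E3) → ℝ} (hσ : ContDiff ℝ ∞ σ)
    {X : η.Section} {c p : M} {K : Set E3} (hp : p ∈ (chartAt E3 c).source)
    (hK : chartAt E3 c p ∈ K) (hX : IsTransverseOn σ c K X.field) :
    ∀ᶠ q in 𝓝 p, X.field q = 0 → σ (fderiv ℝ (localRep X.field c) (chartAt E3 c q)) = 0 →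
      q = p := by
  have hpt := (chartAt E3 c).map_source hp
  have hX2 : ContDiffAt ℝ 2 (localRep X.field c) (chartAt E3 c p) :=
    (X.contDiffAt hpt).of_le (WithTop.coe_le_coe.2 hr)
  have hsrc := (chartAt E3 c).open_source.mem_nhds hp
  have hcont := (chartAt E3 c).continuousAt hp
  have hσd := fderiv_comp_fderiv hσ hX2
  by_cases h0 : localRep X.field c (chartAt E3 c p) = 0 ∧
      σ (fderiv ℝ (localRep X.field c) (chartAt E3 c p)) = 0
  · have hinj := hX _ hK h0.1 h0.2
    have hF := (hX2.differentiableAt (by norm_num)).hasFDerivAt.prodMk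
      (hσd.differentiableAt.hasFDerivAt)
    obtain ⟨C, -, hC⟩ := LinearMap.exists_antilipschitzWith (𝕜 := ℝ) _ (LinearMap.ker_eq_bot.2 hinj)
    have hne := hF.eventually_ne (c := (0, 0))
      ⟨C, hC⟩
    rw [eventually_nhdsWithin_iff] at hne
    filter_upwards [hcont.eventually hne, hsrc] with q hq hqs hq0 hqσ
    by_contra hqp
    refine hq (fun h ↦ hqp ((chartAt E3 c).injOn hqs hp h)) ?_
    exact Prod.ext ((localRep_eq_zero_iff _ hqs).2 hq0) hqσ
  · rw [not_and_or] at h0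
    rcases h0 with h0 | h0
    · filter_upwards [hcont.eventually (hX2.continuousAt.eventually_ne h0), hsrc] with q hq hqs hq0
      exact absurd ((localRep_eq_zero_iff _ hqs).2 hq0) hq
    · filter_upwards [hcont.eventually (hσd.continuousAt.eventually_ne h0)] with q hq _ hqσ
      exact absurd hqσ hq

/-- The linearization at a zero has nonvanishing trace and second invariant, with finitely many
exceptions. -/
theorem HasTransverseInvariants.finite [CompactSpace M] (hr : 2 ≤ r) {X : η.Section}
    (hX : HasTransverseInvariants X.field) :
    {p : M | X.field p = 0 ∧ (traceForm (fderiv ℝ (localRep X.field p) (chartAt E3 p p)) = 0 ∨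
      secondForm (fderiv ℝ (localRep X.field p) (chartAt E3 p p)) = 0)}.Finite := by
  have hloc : ∀ p : M, ∀ᶠ q in 𝓝 p, X.field q = 0 →
      (traceForm (fderiv ℝ (localRep X.field q) (chartAt E3 q q)) = 0 ∨
      secondForm (fderiv ℝ (localRep X.field q) (chartAt E3 q q)) = 0) → q = p := by
    intro p
    obtain ⟨c, K, hp, hK, h1, h2⟩ := hX p
    filter_upwards [h1.eventually_eq hr traceForm.contDiff hp (mem_of_mem_nhds hK),
      h2.eventually_eq hr contDiff_secondForm hp (mem_of_mem_nhds hK),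
      (chartAt E3 c).open_source.mem_nhds hp] with q hq1 hq2 hqs hq0 hq
    have := traceForm_secondForm_localRep_change hr X (mem_chart_source E3 q) hqs hq0
    rw [this.1, this.2] at hq
    exact hq.elim (hq1 hq0) (hq2 hq0)
  obtain ⟨t, -, ht⟩ := isCompact_univ.elim_nhds_subcover _ fun p _ ↦ hloc p
  refine t.finite_toSet.subset fun q hq ↦ ?_
  obtain ⟨p, hp, hqp⟩ := mem_iUnion₂.1 (ht (mem_univ q))
  have h : q = p := hqp hq.1 hq.2
  rwa [h]

theorem PlaneField.Section.isClosed_fixedPoints (hr : 2 ≤ r) (X : η.Section) :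
    IsClosed (fixedPoints X.field) := by
  rw [← isOpen_compl_iff, isOpen_iff_mem_nhds]
  intro p hp
  have hps := mem_chart_source E3 p
  have hc := (X.differentiableAt hr ((chartAt E3 p).map_source hps)).continuousAt
  filter_upwards [((chartAt E3 p).continuousAt hps).eventually (hc.eventually_ne
    (fun h ↦ hp ((localRep_eq_zero_iff _ hps).1 h))), (chartAt E3 p).open_source.mem_nhds hps]
    with q hq hqs hq0
  exact hq ((localRep_eq_zero_iff _ hqs).2 hq0)

end Zeros

/-! ### Arcs in Euclidean space -/

section Arcs

open Set Filter

theorem exists_equiv_of_injective {E F : Type*} [NormedAddCommGroup E] [NormedSpace ℝ E]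
    [FiniteDimensional ℝ E] [NormedAddCommGroup F] [NormedSpace ℝ F] [FiniteDimensional ℝ F]
    {T : E →L[ℝ] F} (hT : Function.Injective T)
    (h : Module.finrank ℝ E = Module.finrank ℝ F) : ∃ e : E ≃L[ℝ] F, (e : E →L[ℝ] F) = T :=
  ⟨(LinearEquiv.ofInjectiveOfFinrankEq (T : E →ₗ[ℝ] F) hT h).toContinuousLinearEquiv, by
    ext v; rfl⟩

/-- The inverse function theorem, with control of the differentiability of the inverse on a
neighbourhood. -/
theorem exists_local_diffeo {E F : Type*} [NormedAddCommGroup E] [NormedSpace ℝ E]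
    [FiniteDimensional ℝ E] [NormedAddCommGroup F] [NormedSpace ℝ F] [FiniteDimensional ℝ F]
    {n : ℕ∞ω} (hn : 1 ≤ n) {H : E → F} {U : Set E} (hU : IsOpen U) (hH : ContDiffOn ℝ n H U)
    {x₀ : E} (hx₀ : x₀ ∈ U) (hinj : Function.Injective (fderiv ℝ H x₀))
    (h : Module.finrank ℝ E = Module.finrank ℝ F) :
    ∃ Φ : OpenPartialHomeomorph E F, x₀ ∈ Φ.source ∧ Φ.source ⊆ U ∧ (∀ x, Φ x = H x) ∧
      ∀ y ∈ Φ.target, ContDiffAt ℝ n Φ.symm y := by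
  have := FiniteDimensional.complete ℝ E
  have hat : ∀ x ∈ U, ContDiffAt ℝ n H x := fun x hx ↦ hH.contDiffAt (hU.mem_nhds hx)
  have hd : ∀ x ∈ U, HasFDerivAt H (fderiv ℝ H x) x := fun x hx ↦
    ((hat x hx).differentiableAt (by positivity)).hasFDerivAt
  -- Restricting to points where the differential is still injective gives differentiability of the
  -- inverse on the whole target, not only at the image of `x₀`.
  let V := U ∩ fderiv ℝ H ⁻¹' {T | Function.Injective T}
  have hV : IsOpen V := (hH.continuousOn_fderiv_of_isOpen hU hn).isOpen_inter_preimage hU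
    ContinuousLinearMap.isOpen_injective
  obtain ⟨e, he⟩ := exists_equiv_of_injective hinj h
  have hde : HasFDerivAt H (e : E →L[ℝ] F) x₀ := he ▸ hd x₀ hx₀
  have hn0 : n ≠ 0 := by positivity
  let Φ := ((hat x₀ hx₀).toOpenPartialHomeomorph H hde hn0).restrOpen V hV
  have hΦ : Φ.source = _ ∩ V := OpenPartialHomeomorph.restrOpen_source _ _ _
  refine ⟨Φ, ?_, ?_, fun x ↦ rfl, fun y hy ↦ ?_⟩
  · rw [hΦ]
    exact ⟨(hat x₀ hx₀).mem_toOpenPartialHomeomorph_source hde hn0, hx₀, hinj⟩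
  · rw [hΦ]
    exact fun x hx ↦ hx.2.1
  · have hy' : Φ.symm y ∈ V := by
      have := Φ.map_target hy
      rw [hΦ] at this
      exact this.2
    obtain ⟨e', he'⟩ := exists_equiv_of_injective hy'.2 h
    exact Φ.contDiffAt_symm (f₀' := e') hy (he' ▸ hd _ hy'.1) (hat _ hy'.1)

theorem exists_Ioo_of_eventually {P : ℝ → Prop} (h : ∀ᶠ s in 𝓝 (0 : ℝ), P s) :
    ∃ ρ > 0, ∀ s ∈ Ioo (-ρ) ρ, P s := by
  obtain ⟨ρ, hρ, h⟩ := Metric.mem_nhds_iff.1 h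
  refine ⟨ρ, hρ, fun s hs ↦ h ?_⟩
  rw [Real.ball_eq_Ioo]
  simpa using hs

/-- The zero set of a field tangent to a plane field is an arc near a point where the kernel of
the linearization is a line. -/
theorem exists_zero_arc {n : ℕ∞ω} (hn : 1 ≤ n) {f : E3 → E3} {U : Set E3} (hU : IsOpen U)
    (hf : ContDiffOn ℝ n f U) {x₀ : E3} (hx₀ : x₀ ∈ U) (h0 : f x₀ = 0) {π : E3 →L[ℝ] (Fin 2 → ℝ)}
    (hπ : ∀ᶠ x in 𝓝 x₀, π (f x) = 0 → f x = 0)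
    (hπ' : ∀ v, π (fderiv ℝ f x₀ v) = 0 → fderiv ℝ f x₀ v = 0)
    (hker : Module.finrank ℝ (LinearMap.ker (fderiv ℝ f x₀ : E3 →ₗ[ℝ] E3)) = 1) :
    ∃ (τ : E3 →L[ℝ] ℝ) (a : ℝ → E3) (ρ : ℝ), 0 < ρ ∧ a 0 = x₀ ∧
      (∀ s ∈ Ioo (-ρ) ρ, ContDiffAt ℝ n a s ∧ a s ∈ U ∧ f (a s) = 0 ∧ τ (a s - x₀) = s) ∧
      ∀ᶠ x in 𝓝 x₀, f x = 0 → x = a (τ (x - x₀)) := by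
  obtain ⟨⟨t, ht⟩, ht0, htspan⟩ := finrank_eq_one_iff'.1 hker
  obtain ⟨τ, hτ⟩ := SeparatingDual.exists_eq_one (R := ℝ) (x := t) fun h ↦ ht0 (Subtype.ext h)
  -- The form `τ` is one on a generator of the kernel, so `H` straightens the zero set near `x₀` to
  -- the line `{0} × ℝ`; the arc is its preimage, with parameter `τ (x - x₀)`.
  let H : E3 → (Fin 2 → ℝ) × ℝ := fun x ↦ (π (f x), τ (x - x₀))
  have hH : ContDiffOn ℝ n H U := (π.contDiff.comp_contDiffOn hf).prodMk
    (τ.contDiff.comp (contDiff_id.sub contDiff_const)).contDiffOn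
  have hdH : HasFDerivAt H ((π.comp (fderiv ℝ f x₀)).prod τ) x₀ := by
    have h1 : HasFDerivAt f (fderiv ℝ f x₀) x₀ := ((hf.contDiffAt (hU.mem_nhds hx₀)).differentiableAt
      (by positivity)).hasFDerivAt
    exact (π.hasFDerivAt.comp x₀ h1).prodMk
      (τ.hasFDerivAt.comp x₀ ((hasFDerivAt_id x₀).sub_const x₀))
  have hinj : Function.Injective (fderiv ℝ H x₀) := by
    rw [hdH.fderiv]
    refine (injective_iff_map_eq_zero _).2 fun v hv ↦ ?_
    have h1 : π (fderiv ℝ f x₀ v) = 0 := congrArg Prod.fst hv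
    have h2 : τ v = 0 := congrArg Prod.snd hv
    obtain ⟨k, hk⟩ := htspan ⟨v, hπ' v h1⟩
    have hk : k • t = v := congrArg Subtype.val hk
    rw [← hk, map_smul, hτ, smul_eq_mul, mul_one] at h2
    rw [← hk, h2, zero_smul]
  obtain ⟨Φ, hΦ0, hΦU, hΦ, hΦs⟩ := exists_local_diffeo hn hU hH hx₀ hinj (by simp)
  have hHx₀ : Φ x₀ = ((0 : Fin 2 → ℝ), (0 : ℝ)) := by simp [hΦ, H, h0]
  have ht0 : ((0 : Fin 2 → ℝ), (0 : ℝ)) ∈ Φ.target := hHx₀ ▸ Φ.map_source hΦ0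
  have hsymm0 : Φ.symm (0, 0) = x₀ := by rw [← hHx₀, Φ.left_inv hΦ0]
  have hline : Tendsto (fun s : ℝ ↦ ((0 : Fin 2 → ℝ), s)) (𝓝 0) (𝓝 (0, 0)) :=
    tendsto_const_nhds.prodMk_nhds tendsto_id
  have hcont : Tendsto (fun s : ℝ ↦ Φ.symm (0, s)) (𝓝 0) (𝓝 x₀) := by
    have := (Φ.continuousAt_symm ht0).tendsto
    rw [hsymm0] at this
    exact this.comp hline
  obtain ⟨ρ, hρ, hP⟩ := exists_Ioo_of_eventually
    ((hline.eventually (Φ.open_target.mem_nhds ht0)).and (hcont.eventually hπ))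
  refine ⟨τ, fun s ↦ Φ.symm (0, s), ρ, hρ, hsymm0, fun s hs ↦ ?_, ?_⟩
  · obtain ⟨h1, h2⟩ := hP s hs
    have h3 : H (Φ.symm (0, s)) = (0, s) := by rw [← hΦ, Φ.right_inv h1]
    refine ⟨ContDiffAt.comp (g := Φ.symm) s (hΦs _ h1) (contDiffAt_const.prodMk contDiffAt_id),
      hΦU (Φ.map_target h1), h2 (congrArg Prod.fst h3), congrArg Prod.snd h3⟩
  · filter_upwards [Φ.open_source.mem_nhds hΦ0] with x hx hfx
    have : (0, τ (x - x₀)) = Φ x := by simp [hΦ, H, hfx]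
    simp only [this, Φ.left_inv hx]

/-- Reparametrization of a regular arc by arc length. -/
theorem exists_arclength {F : Type*} [NormedAddCommGroup F] [InnerProductSpace ℝ F]
    {r : ℕ∞} (hr : 1 ≤ r) {f : ℝ → F} {ρ : ℝ} (hρ : 0 < ρ) (hf : ContDiffOn ℝ r f (Ioo (-ρ) ρ))
    (hf' : ∀ s ∈ Ioo (-ρ) ρ, deriv f s ≠ 0) :
    ∃ (A B : ℝ → ℝ) (ε : ℝ), 0 < ε ∧ A 0 = 0 ∧ B 0 = 0 ∧
      (∀ s ∈ Ioo (-ρ) ρ, HasDerivAt A ‖deriv f s‖ s) ∧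
      (∀ u ∈ Ioo (-ε) ε, ContDiffAt ℝ r B u ∧ B u ∈ Ioo (-ρ) ρ ∧ A (B u) = u) ∧
      ∀ᶠ s in 𝓝 0, B (A s) = s := by
  have h00 : (0 : ℝ) ∈ Ioo (-ρ) ρ := by simpa
  have hr' : (1 : ℕ∞ω) ≤ r := WithTop.coe_le_coe.2 hr
  have hcont : ContinuousOn (fun s ↦ ‖deriv f s‖) (Ioo (-ρ) ρ) :=
    (hf.continuousOn_deriv_of_isOpen isOpen_Ioo hr').norm
  let A : ℝ → ℝ := fun s ↦ ∫ u in (0 : ℝ)..s, ‖deriv f u‖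
  have hA : ∀ s ∈ Ioo (-ρ) ρ, HasDerivAt A ‖deriv f s‖ s := fun s hs ↦ by
    refine intervalIntegral.integral_hasDerivAt_right ?_ ?_ (hcont.continuousAt
      (isOpen_Ioo.mem_nhds hs))
    · refine (hcont.mono ?_).intervalIntegrable
      exact (ordConnected_Ioo.uIcc_subset h00 hs)
    · exact hcont.stronglyMeasurableAtFilter isOpen_Ioo _ hs
  have hAd : ∀ s ∈ Ioo (-ρ) ρ, deriv A s = ‖deriv f s‖ := fun s hs ↦ (hA s hs).deriv
  have hAdiff : DifferentiableOn ℝ A (Ioo (-ρ) ρ) := fun s hs ↦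
    (hA s hs).differentiableAt.differentiableWithinAt
  -- The derivative `‖f'‖` has one order of smoothness less than `f`, the norm being smooth away
  -- from zero; hence `A` is as smooth as `f`.
  have hAC : ContDiffOn ℝ r A (Ioo (-ρ) ρ) := by
    induction r using ENat.recTopCoe with
    | top =>
      refine (contDiffOn_infty_iff_deriv_of_isOpen isOpen_Ioo).2 ⟨hAdiff, ?_⟩
      exact (((contDiffOn_infty_iff_deriv_of_isOpen isOpen_Ioo).1 hf).2.norm ℝ hf').congr hAd
    | coe n =>
      obtain ⟨m, rfl⟩ : ∃ m, n = m + 1 := ⟨n - 1, by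
        have : 1 ≤ n := by exact_mod_cast hr
        omega⟩
      have hm : ((((m + 1 : ℕ) : ℕ∞)) : ℕ∞ω) = (m : ℕ∞ω) + 1 := by push_cast; rfl
      rw [hm, contDiffOn_succ_iff_deriv_of_isOpen isOpen_Ioo] at hf
      rw [hm, contDiffOn_succ_iff_deriv_of_isOpen isOpen_Ioo]
      exact ⟨hAdiff, fun h ↦ by simp at h, (hf.2.2.norm ℝ hf').congr hAd⟩
  have hinj : Function.Injective (fderiv ℝ A 0) := by
    refine (injective_iff_map_eq_zero _).2 fun v hv ↦ ?_
    rw [(hA 0 h00).hasFDerivAt.fderiv] at hv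
    simpa [hf' 0 h00] using hv
  obtain ⟨Φ, hΦ0, hΦU, hΦ, hΦs⟩ := exists_local_diffeo hr' isOpen_Ioo hAC h00 hinj rfl
  have hA0 : A 0 = 0 := intervalIntegral.integral_same
  have hΦA : Φ 0 = 0 := (hΦ 0).trans hA0
  obtain ⟨ε, hε, hP⟩ := exists_Ioo_of_eventually
    (Φ.open_target.mem_nhds (hΦA ▸ Φ.map_source hΦ0))
  refine ⟨A, Φ.symm, ε, hε, hA0, ?_, hA, fun u hu ↦ ⟨hΦs u (hP u hu), hΦU (Φ.map_target (hP u hu)),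
    ?_⟩, ?_⟩
  · have := Φ.left_inv hΦ0
    rwa [hΦA] at this
  · rw [← hΦ, Φ.right_inv (hP u hu)]
  · filter_upwards [Φ.open_source.mem_nhds hΦ0] with s hs
    rw [← hΦ, Φ.left_inv hs]

/-- A function whose derivative has modulus one is affine of slope `±1`. -/
theorem eventually_eq_of_abs_deriv_eq_one {k k' : ℝ → ℝ} {s : ℝ} (h0 : k s = 0)
    (hk : ∀ᶠ u in 𝓝 s, HasDerivAt k (k' u) u ∧ |k' u| = 1) :
    ∃ σ : ℝ, (σ = 1 ∨ σ = -1) ∧ ∀ᶠ u in 𝓝 0, k (s + u) = σ * u := by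
  have hk2 : ∀ᶠ u in 𝓝 0, HasDerivAt (fun u ↦ k (s + u)) (k' (s + u)) u ∧ |k' (s + u)| = 1 := by
    filter_upwards [(tendsto_const_add_nhds_zero s).eventually hk] with u hu
    exact ⟨hu.1.comp_const_add s u, hu.2⟩
  obtain ⟨ρ, hρ, hP⟩ := exists_Ioo_of_eventually hk2
  -- The derivative never vanishes, so by Darboux's theorem it has constant sign; no continuity of
  -- `k'` is needed.
  have hσ : ∃ σ : ℝ, (σ = 1 ∨ σ = -1) ∧ ∀ u ∈ Ioo (-ρ) ρ, k' (s + u) = σ := by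
    have := hasDerivWithinAt_forall_lt_or_forall_gt_of_forall_ne (convex_Ioo (-ρ) ρ)
      (fun u hu ↦ (hP u hu).1.hasDerivWithinAt) (m := 0) fun u hu h ↦ by
        have := (hP u hu).2
        simp [h] at this
    rcases this with h | h
    · exact ⟨-1, Or.inr rfl, fun u hu ↦ by
        have := (hP u hu).2
        rw [abs_of_neg (h u hu)] at this
        linarith⟩
    · exact ⟨1, Or.inl rfl, fun u hu ↦ by
        have := (hP u hu).2
        rwa [abs_of_pos (h u hu)] at this⟩
  obtain ⟨σ, hσ1, hσ⟩ := hσ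
  refine ⟨σ, hσ1, ?_⟩
  have hd : ∀ u, HasDerivAt (fun u ↦ σ * u) σ u := fun u ↦ by
    simpa using (hasDerivAt_id u).const_mul σ
  have := isOpen_Ioo.eqOn_of_deriv_eq (isPreconnected_Ioo (a := -ρ) (b := ρ))
    (f := fun u ↦ k (s + u)) (g := fun u ↦ σ * u) (x := 0)
    (fun u hu ↦ (hP u hu).1.differentiableAt.differentiableWithinAt)
    (fun u _ ↦ (hd u).differentiableAt.differentiableWithinAt)
    (fun u hu ↦ by rw [(hP u hu).1.deriv, (hd u).deriv, hσ u hu]) (by simpa) (by simp [h0])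
  exact mem_of_superset (isOpen_Ioo.mem_nhds (by simpa)) this

end Arcs

/-! ### The zero set as a union of arcs of unit speed -/

section UnitSpeed

open Set Filter

variable {M : Type*} [TopologicalSpace M] [ChartedSpace E3 M]
  {F : Type*} [NormedAddCommGroup F] [InnerProductSpace ℝ F]

/-- The curve `γ` in `M`, followed by the map `e` into a Euclidean space, has unit speed at `u`. -/
def IsUnitSpeedAt (e : M → F) (γ : ℝ → M) (u : ℝ) : Prop :=
  MDifferentiableAt 𝓘(ℝ, ℝ) (𝓡 3) γ u ∧ ∃ v, ‖v‖ = 1 ∧ HasDerivAt (fun u ↦ e (γ u)) v u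

theorem IsGeodesicAt.contMDiffAt_isUnitSpeedAt {r : ℕ∞} {L : Set M} {δ : M → ℝ → M} {e : M → F}
    {γ : ℝ → M} {s : ℝ} (hγ : IsGeodesicAt L δ γ s)
    (hδ : ContMDiffAt 𝓘(ℝ, ℝ) (𝓡 3) r (δ (γ s)) 0 ∧ IsUnitSpeedAt e (δ (γ s)) 0) :
    ContMDiffAt 𝓘(ℝ, ℝ) (𝓡 3) r γ s ∧ IsUnitSpeedAt e γ s := by
  obtain ⟨-, σ, hσ, h⟩ := hγ
  have hγ : γ =ᶠ[𝓝 s] fun u ↦ δ (γ s) (σ * (u - s)) := by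
    filter_upwards [(tendsto_sub_const_nhds s).eventually h] with u hu
    rwa [add_sub_cancel] at hu
  have h0 : σ * (s - s) = 0 := by simp
  have haff : ContDiff ℝ r fun u ↦ σ * (u - s) := by fun_prop
  have haffd : HasDerivAt (fun u ↦ σ * (u - s)) σ s := by
    simpa using ((hasDerivAt_id s).sub_const s).const_mul σ
  refine ⟨?_, ?_, ?_⟩
  · refine ContMDiffAt.congr_of_eventuallyEq ?_ hγ
    exact ContMDiffAt.comp (g := δ (γ s)) (f := fun u ↦ σ * (u - s)) s (by rw [h0]; exact hδ.1)
      haff.contDiffAt.contMDiffAt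
  · refine MDifferentiableAt.congr_of_eventuallyEq ?_ hγ
    exact MDifferentiableAt.comp (g := δ (γ s)) (f := fun u ↦ σ * (u - s)) s
      (by rw [h0]; exact hδ.2.1) haffd.differentiableAt.mdifferentiableAt
  · obtain ⟨-, v, hv, hd⟩ := hδ.2
    refine ⟨σ • v, ?_, ?_⟩
    · rcases hσ with rfl | rfl <;> simpa using hv
    · refine (HasDerivAt.scomp (g₁ := fun u ↦ e (δ (γ s) u)) s (by rw [h0]; exact hd)
        haffd).congr_of_eventuallyEq ?_
      filter_upwards [hγ] with u hu
      rw [hu]; rfl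

variable [IsManifold (𝓡 3) ∞ M] {r : ℕ∞} {η : PlaneField M r}

theorem contDiffOn_comp_chartAt_symm {e : M → F} (he : ContMDiff (𝓡 3) 𝓘(ℝ, F) ∞ e) (c : M) :
    ContDiffOn ℝ ∞ (fun x ↦ e ((chartAt E3 c).symm x)) (chartAt E3 c).target :=
  contMDiffOn_iff_contDiffOn.1
    (he.comp_contMDiffOn (contMDiffOn_chart_symm (I := 𝓡 3) (n := ∞) (x := c)))

theorem injective_fderiv_comp_chartAt_symm {e : M → F} (he : ContMDiff (𝓡 3) 𝓘(ℝ, F) ∞ e)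
    (hinj : ∀ x, Function.Injective (mfderiv (𝓡 3) 𝓘(ℝ, F) e x)) {c : M} {x : E3}
    (hx : x ∈ (chartAt E3 c).target) :
    Function.Injective (fderiv ℝ (fun x ↦ e ((chartAt E3 c).symm x)) x) := by
  have hx' : x ∈ (extChartAt (𝓡 3) c).target := by simpa using hx
  have h1 := isInvertible_mfderivWithin_extChartAt_symm (I := 𝓡 3) hx'
  have h2 : MDifferentiableAt 𝓘(ℝ, E3) (𝓡 3) (extChartAt (𝓡 3) c).symm x :=
    mdifferentiableWithinAt_univ.1 (by
      simpa using mdifferentiableWithinAt_extChartAt_symm (I := 𝓡 3) hx')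
  have h3 : MDifferentiableAt (𝓡 3) 𝓘(ℝ, F) e ((extChartAt (𝓡 3) c).symm x) :=
    he.mdifferentiableAt (by simp)
  have h4 := mfderiv_comp x h3 h2
  have h5 : fderiv ℝ (fun x ↦ e ((chartAt E3 c).symm x)) x =
      mfderiv 𝓘(ℝ, E3) 𝓘(ℝ, F) (e ∘ (extChartAt (𝓡 3) c).symm) x := by
    rw [mfderiv_eq_fderiv]; rfl
  rw [h5, h4]
  simp only [modelWithCornersSelf_coe, range_id, mfderivWithin_univ] at h1
  exact (hinj _).comp h1.injective

theorem differentiableAt_chartAt_comp {γ : ℝ → M} {u : ℝ} {c : M}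
    (hγ : MDifferentiableAt 𝓘(ℝ, ℝ) (𝓡 3) γ u) (hu : γ u ∈ (chartAt E3 c).source) :
    DifferentiableAt ℝ (fun u ↦ chartAt E3 c (γ u)) u := by
  have h1 : MDifferentiableAt (𝓡 3) 𝓘(ℝ, E3) (extChartAt (𝓡 3) c) (γ u) :=
    mdifferentiableAt_extChartAt hu
  exact (h1.comp u hγ).differentiableAt

/-- The zeros of a section near a zero with one-dimensional kernel form an arc of unit speed, and
this arc is unique. -/
theorem exists_unitSpeed_arc [T2Space M] (hr : 2 ≤ r) (X : η.Section) {e : M → F}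
    (he : ContMDiff (𝓡 3) 𝓘(ℝ, F) ∞ e)
    (hinj : ∀ x, Function.Injective (mfderiv (𝓡 3) 𝓘(ℝ, F) e x)) {c p : M}
    (hp : p ∈ (chartAt E3 c).source) (hXp : X.field p = 0)
    (hker : Module.finrank ℝ (LinearMap.ker
      (fderiv ℝ (localRep X.field c) (chartAt E3 c p) : E3 →ₗ[ℝ] E3)) = 1) :
    ∃ (δ : ℝ → M) (ε : ℝ), 0 < ε ∧ δ 0 = p ∧
      (∀ u ∈ Ioo (-ε) ε, X.field (δ u) = 0 ∧ ContMDiffAt 𝓘(ℝ, ℝ) (𝓡 3) r δ u ∧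
        IsUnitSpeedAt e δ u) ∧
      InjOn δ (Ioo (-ε) ε) ∧
      (∀ ζ, 0 < ζ → ζ ≤ ε → δ '' Ioo (-ζ) ζ ∈ 𝓝[fixedPoints X.field] p) ∧
      ∀ (γ : ℝ → M) (s : ℝ), γ s = p →
        (∀ᶠ u in 𝓝 s, X.field (γ u) = 0 ∧ IsUnitSpeedAt e γ u) →
        ∃ σ : ℝ, (σ = 1 ∨ σ = -1) ∧ ∀ᶠ u in 𝓝 0, γ (s + u) = δ (σ * u) := by
  have hr1 : (1 : ℕ∞) ≤ r := le_trans (by norm_num) hr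
  have hr1' : (1 : ℕ∞ω) ≤ r := WithTop.coe_le_coe.2 hr1
  set φ := chartAt E3 c with hφ
  set x₀ := φ p with hx₀
  have hx₀t : x₀ ∈ φ.target := φ.map_source hp
  obtain ⟨π, hπ, hπ', -⟩ := η.exists_adapted hr hp
  obtain ⟨τ, a, ρ, hρ, ha0, ha, hau⟩ := exists_zero_arc hr1' φ.open_target (X.contDiffOn c) hx₀t
    ((localRep_eq_zero_iff _ hp).2 hXp) (hπ.mono fun x hx ↦ hx X) (hπ' X hXp) hker
  set g : E3 → F := fun x ↦ e (φ.symm x) with hg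
  have hgC : ContDiffOn ℝ ∞ g φ.target := contDiffOn_comp_chartAt_symm he c
  have hgd : ∀ x ∈ φ.target, HasFDerivAt g (fderiv ℝ g x) x := fun x hx ↦
    ((hgC.contDiffAt (φ.open_target.mem_nhds hx)).differentiableAt (by simp)).hasFDerivAt
  have had : ∀ s ∈ Ioo (-ρ) ρ, HasDerivAt a (deriv a s) s := fun s hs ↦
    ((ha s hs).1.differentiableAt (by positivity)).hasDerivAt
  set f : ℝ → F := fun s ↦ g (a s) with hf
  have hfd : ∀ s ∈ Ioo (-ρ) ρ, HasDerivAt f (fderiv ℝ g (a s) (deriv a s)) s := fun s hs ↦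
    (hgd _ (ha s hs).2.1).comp_hasDerivAt s (had s hs)
  -- The composite `f` is regular: `e` is an immersion, and `a` is regular because differentiating
  -- `τ (a s - x₀) = s` gives `τ (a' s) = 1`.
  have hf0 : ∀ s ∈ Ioo (-ρ) ρ, deriv f s ≠ 0 := fun s hs h ↦ by
    rw [(hfd s hs).deriv] at h
    have h1 : deriv a s = 0 := injective_fderiv_comp_chartAt_symm he hinj (ha s hs).2.1
      (h.trans (map_zero _).symm)
    have h2 : HasDerivAt (fun s ↦ τ (a s - x₀)) (τ (deriv a s)) s :=
      τ.hasFDerivAt.comp_hasDerivAt s ((had s hs).sub_const x₀)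
    have h3 : (fun s ↦ τ (a s - x₀)) =ᶠ[𝓝 s] id := by
      filter_upwards [isOpen_Ioo.mem_nhds hs] with u hu using (ha u hu).2.2.2
    have h4 := (h2.congr_of_eventuallyEq h3.symm).unique (hasDerivAt_id s)
    simp [h1] at h4
  have hfC : ContDiffOn ℝ r f (Ioo (-ρ) ρ) := fun s hs ↦
    (ContDiffAt.comp (g := g) s ((hgC.contDiffAt (φ.open_target.mem_nhds (ha s hs).2.1)).of_le
      (WithTop.coe_le_coe.2 le_top)) (ha s hs).1).contDiffWithinAt
  obtain ⟨A, B, ε, hε, hA0, hB0, hA, hB, hBA⟩ := exists_arclength hr1 hρ hfC hf0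
  set δ : ℝ → M := fun u ↦ φ.symm (a (B u)) with hδ
  have hδs : ∀ u ∈ Ioo (-ε) ε, δ u ∈ φ.source ∧ φ (δ u) = a (B u) := fun u hu ↦ by
    have := (ha _ (hB u hu).2.1).2.1
    exact ⟨φ.map_target this, φ.right_inv this⟩
  have hnear : ∀ᶠ q in 𝓝 p, q ∈ φ.source ∧ (X.field q = 0 → φ q = a (τ (φ q - x₀))) := by
    filter_upwards [φ.open_source.mem_nhds hp, (φ.continuousAt hp).eventually hau] with q hq hq'
    exact ⟨hq, fun hX ↦ hq' ((localRep_eq_zero_iff _ hq).2 hX)⟩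
  have hτ : Tendsto (fun q ↦ τ (φ q - x₀)) (𝓝 p) (𝓝 0) := by
    have h1 : ContinuousAt (fun x ↦ τ (x - x₀)) x₀ := by fun_prop
    have h2 : ContinuousAt (fun q ↦ τ (φ q - x₀)) p :=
      ContinuousAt.comp (g := fun x ↦ τ (x - x₀)) h1 (φ.continuousAt hp)
    simpa [ContinuousAt, ← hx₀] using h2
  have hAt : Tendsto A (𝓝 0) (𝓝 0) := by
    simpa [ContinuousAt, hA0] using (hA 0 (by simpa)).continuousAt
  refine ⟨δ, ε, hε, by simp [hδ, hB0, ha0, hx₀, φ.left_inv hp], fun u hu ↦ ?_, ?_, ?_, ?_⟩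
  · obtain ⟨hBC, hBu, hABu⟩ := hB u hu
    obtain ⟨haC, hat, haX, -⟩ := ha _ hBu
    have hδC : ContMDiffAt 𝓘(ℝ, ℝ) (𝓡 3) r δ u := by
      have h1 : ContMDiffAt 𝓘(ℝ, E3) (𝓡 3) r φ.symm (a (B u)) :=
        ((contMDiffOn_chart_symm (I := 𝓡 3) (n := ∞) (x := c)).contMDiffAt
          (φ.open_target.mem_nhds hat)).of_le (WithTop.coe_le_coe.2 le_top)
      exact ContMDiffAt.comp (g := φ.symm) (f := fun u ↦ a (B u)) u h1
        (ContDiffAt.comp (g := a) u haC hBC).contMDiffAt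
    have hBd := (hBC.differentiableAt (by positivity)).hasDerivAt
    refine ⟨(localRep_eq_zero_iff _ (hδs u hu).1).1 ((congrArg _ (hδs u hu).2).trans haX), hδC,
      hδC.mdifferentiableAt (by positivity), deriv B u • deriv f (B u), ?_,
      HasDerivAt.scomp (g₁ := f) u (hfd _ hBu).differentiableAt.hasDerivAt hBd⟩
    have h1 := (hA _ hBu).comp u hBd
    have h2 : A ∘ B =ᶠ[𝓝 u] id := by
      filter_upwards [isOpen_Ioo.mem_nhds hu] with v hv using (hB v hv).2.2
    have h3 := (h1.congr_of_eventuallyEq h2.symm).unique (hasDerivAt_id u)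
    have h4 : ‖‖deriv f (B u)‖ * deriv B u‖ = 1 := by rw [h3]; simp
    rw [norm_smul, mul_comm]
    rwa [norm_mul, norm_norm] at h4
  · intro u hu v hv huv
    have h1 : a (B u) = a (B v) := by rw [← (hδs u hu).2, ← (hδs v hv).2, huv]
    have h2 : B u = B v := by
      rw [← (ha _ (hB u hu).2.1).2.2.2, ← (ha _ (hB v hv).2.1).2.2.2, h1]
    rw [← (hB u hu).2.2, ← (hB v hv).2.2, h2]
  · intro ζ hζ _
    rw [mem_nhdsWithin_iff_eventually]
    filter_upwards [hnear, hτ.eventually hBA,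
      (hAt.comp hτ).eventually (isOpen_Ioo.mem_nhds (show (0 : ℝ) ∈ Ioo (-ζ) ζ by simpa))]
      with q hq hq1 hq2 hqX
    refine ⟨_, hq2, ?_⟩
    simp only [hδ, Function.comp_apply, hq1, ← hq.2 hqX, φ.left_inv hq.1]
  · intro γ s hγs hγ
    have hcont : Tendsto γ (𝓝 s) (𝓝 p) := by
      simpa [ContinuousAt, hγs] using hγ.self_of_nhds.2.1.continuousAt
    -- Here `h` is the parameter of `γ` along the zero arc and `A ∘ h` is its signed arc length.
    -- Both curves having unit speed, the derivative of `A ∘ h` has modulus one, which makes it `±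
    -- u` after recentring at `s`.
    set h : ℝ → ℝ := fun u ↦ τ (φ (γ u) - x₀) with hh
    have hh0 : Tendsto h (𝓝 s) (𝓝 0) := hτ.comp hcont
    have hev : ∀ᶠ u in 𝓝 s, γ u ∈ φ.source ∧ φ (γ u) = a (h u) ∧ IsUnitSpeedAt e γ u ∧
        h u ∈ Ioo (-ρ) ρ ∧ B (A (h u)) = h u := by
      filter_upwards [hγ, hcont.eventually hnear, hh0.eventually hBA,
        hh0.eventually (isOpen_Ioo.mem_nhds (show (0 : ℝ) ∈ Ioo (-ρ) ρ by simpa))]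
        with u h1 h2 h3 h4 using ⟨h2.1, h2.2 h1.1, h1.2, h4, h3⟩
    have hk : ∀ᶠ u in 𝓝 s, HasDerivAt (fun u ↦ A (h u)) (‖deriv f (h u)‖ * deriv h u) u ∧
        |‖deriv f (h u)‖ * deriv h u| = 1 := by
      filter_upwards [hev.eventually_nhds] with u hu
      obtain ⟨h1, h2, ⟨h3, v, hv, hvd⟩, h4, -⟩ := hu.self_of_nhds
      have hhd : HasDerivAt h (deriv h u) u :=
        (DifferentiableAt.comp (g := fun x ↦ τ (x - x₀)) u (by fun_prop)
          (differentiableAt_chartAt_comp h3 h1)).hasDerivAt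
      refine ⟨(hA _ h4).comp u hhd, ?_⟩
      have h5 : HasDerivAt (fun u ↦ f (h u)) (deriv h u • deriv f (h u)) u :=
        HasDerivAt.scomp (g₁ := f) u (hfd _ h4).differentiableAt.hasDerivAt hhd
      have h6 : (fun u ↦ e (γ u)) =ᶠ[𝓝 u] fun u ↦ f (h u) := by
        filter_upwards [hu] with w hw
        simp only [hf, hg, ← hw.2.1, φ.left_inv hw.1]
      have h7 := (hvd.congr_of_eventuallyEq h6.symm).unique h5
      rw [h7, norm_smul, mul_comm] at hv
      rwa [abs_mul, abs_norm, ← Real.norm_eq_abs]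
    have hks : A (h s) = 0 := by simp [hh, hγs, ← hx₀, hA0]
    obtain ⟨σ, hσ, hσu⟩ := eventually_eq_of_abs_deriv_eq_one
      (k := fun u ↦ A (h u)) (s := s) hks hk
    refine ⟨σ, hσ, ?_⟩
    filter_upwards [hσu, (tendsto_const_add_nhds_zero s).eventually hev] with u hu hu'
    simp only [hδ, ← hu, hu'.2.2.2.2, ← hu'.2.1, φ.left_inv hu'.1]

/-- The zero set of a generic section is a finite disjoint union of closed curves of unit speed. -/
theorem exists_closed_unitSpeed [T2Space M] [CompactSpace M] (hr : 2 ≤ r) {X : η.Section}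
    (hX : HasTransverseInvariants X.field) {e : M → F} (he : ContMDiff (𝓡 3) 𝓘(ℝ, F) ∞ e)
    (hinj : ∀ x, Function.Injective (mfderiv (𝓡 3) 𝓘(ℝ, F) e x)) :
    ∃ (n : ℕ) (Γ : Fin n → ℝ → M) (P : Fin n → ℝ), (∀ i, 0 < P i) ∧
      (∀ i s, ContMDiffAt 𝓘(ℝ, ℝ) (𝓡 3) r (Γ i) s ∧ IsUnitSpeedAt e (Γ i) s) ∧
      (∀ i s t, Γ i s = Γ i t ↔ ∃ k : ℤ, t = s + k * P i) ∧
      (Pairwise fun i j ↦ Disjoint (range (Γ i)) (range (Γ j))) ∧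
      fixedPoints X.field = ⋃ i, range (Γ i) := by
  have hloc : ∀ p : M, ∃ (δ : ℝ → M) (ε : ℝ), p ∈ fixedPoints X.field → (0 < ε ∧ δ 0 = p ∧
      (∀ u ∈ Ioo (-ε) ε, X.field (δ u) = 0 ∧ ContMDiffAt 𝓘(ℝ, ℝ) (𝓡 3) r δ u ∧
        IsUnitSpeedAt e δ u) ∧
      InjOn δ (Ioo (-ε) ε) ∧
      (∀ ζ, 0 < ζ → ζ ≤ ε → δ '' Ioo (-ζ) ζ ∈ 𝓝[fixedPoints X.field] p) ∧
      ∀ (γ : ℝ → M) (s : ℝ), γ s = p →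
        (∀ᶠ u in 𝓝 s, X.field (γ u) = 0 ∧ IsUnitSpeedAt e γ u) →
        ∃ σ : ℝ, (σ = 1 ∨ σ = -1) ∧ ∀ᶠ u in 𝓝 0, γ (s + u) = δ (σ * u)) := fun p ↦ by
    by_cases hp : p ∈ fixedPoints X.field
    · obtain ⟨c, K, hpc, hK, -, hT⟩ := hX p
      obtain ⟨δ, ε, h⟩ := exists_unitSpeed_arc hr X he hinj hpc hp
        (finrank_ker_fderiv_eq_one hr X hpc (mem_of_mem_nhds hK) hT hp)
      exact ⟨δ, ε, fun _ ↦ h⟩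
    · exact ⟨fun _ ↦ p, 1, fun h ↦ absurd h hp⟩
  choose δ ε h using hloc
  have harcs : IsLocalArcs (fixedPoints X.field) δ ε := by
    refine ⟨fun p hp ↦ (h p hp).1, fun p hp ↦ (h p hp).2.1,
      fun p hp u hu ↦ ((h p hp).2.2.1 u hu).1, fun p hp u hu ↦
        ((h p hp).2.2.1 u hu).2.1.continuousAt.continuousWithinAt,
      fun p hp ↦ (h p hp).2.2.2.1, fun p hp ↦ (h p hp).2.2.2.2.1, fun p hp s hs ↦ ?_⟩
    refine (h _ ((h p hp).2.2.1 s hs).1).2.2.2.2.2 (δ p) s rfl ?_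
    filter_upwards [isOpen_Ioo.mem_nhds hs] with u hu
    exact ⟨((h p hp).2.2.1 u hu).1, ((h p hp).2.2.1 u hu).2.2⟩
  obtain ⟨n, Γ, P, hP, hΓ, hper, hdisj, hL⟩ := harcs.exists_closed_geodesics
    (X.isClosed_fixedPoints hr).isCompact
  refine ⟨n, Γ, P, hP, fun i s ↦ (hΓ i s).contMDiffAt_isUnitSpeedAt ?_, hper, hdisj, hL⟩
  have h1 := h _ (hΓ i s).1
  exact (h1.2.2.1 0 (by simpa using h1.1)).2

end UnitSpeed

/-! ### Closed curves as maps of the circle -/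

section Circles

open Set Filter

variable {M : Type*}

/-- The map of the circle induced by a `P`-periodic curve. -/
def circleMap (Γ : ℝ → M) (P : ℝ) (z : Circle) : M := Γ (P / (2 * Real.pi) * Complex.arg z)

/-- The argument of `exp(iθ)` differs from `θ` by a multiple of `2π`, which corresponds to a
multiple of the period; so the jump of the argument is invisible. -/
theorem circleMap_exp {Γ : ℝ → M} {P : ℝ} (hP : 0 < P)
    (hΓ : ∀ s t, Γ s = Γ t ↔ ∃ k : ℤ, t = s + k * P) (θ : ℝ) : circleMap Γ P (Circle.exp θ) = Γ (P / (2 * Real.pi) * θ) := by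
  rw [circleMap, hΓ]
  obtain ⟨k, hk⟩ := Circle.exp_eq_exp.1 (Circle.exp_arg (Circle.exp θ)).symm
  refine ⟨k, ?_⟩
  have := Real.pi_pos
  generalize Complex.arg (Circle.exp θ) = α at hk ⊢
  rw [hk]
  field_simp

theorem injective_circleMap {Γ : ℝ → M} {P : ℝ} (hP : 0 < P)
    (hΓ : ∀ s t, Γ s = Γ t ↔ ∃ k : ℤ, t = s + k * P) : Function.Injective (circleMap Γ P) := fun z w h ↦ by
  obtain ⟨k, hk⟩ := (hΓ _ _).1 h
  rw [← Circle.exp_arg z, ← Circle.exp_arg w, eq_comm, Circle.exp_eq_exp]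
  refine ⟨k, ?_⟩
  have := Real.pi_pos
  field_simp at hk
  linarith

theorem range_circleMap {Γ : ℝ → M} {P : ℝ} (hP : 0 < P)
    (hΓ : ∀ s t, Γ s = Γ t ↔ ∃ k : ℤ, t = s + k * P) : range (circleMap Γ P) = range Γ := by
  refine Subset.antisymm (range_subset_iff.2 fun z ↦ mem_range_self _) (range_subset_iff.2 fun s ↦
    ⟨Circle.exp (s * (2 * Real.pi) / P), ?_⟩)
  rw [circleMap_exp hP hΓ]
  congr 1
  have := Real.pi_pos
  field_simp

theorem contMDiff_circleMap [TopologicalSpace M] [ChartedSpace E3 M]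
    {Γ : ℝ → M} {P : ℝ} (hP : 0 < P)
    (hΓ : ∀ s t, Γ s = Γ t ↔ ∃ k : ℤ, t = s + k * P)
    {r : ℕ∞} (hr : ∀ s, ContMDiffAt 𝓘(ℝ, ℝ) (𝓡 3) r Γ s) :
    ContMDiff (𝓡 1) (𝓡 3) r (circleMap Γ P) := fun z₀ ↦ by
  -- A branch of the argument that is smooth near `z₀`: multiplying by the conjugate of `z₀` brings
  -- the point near 1, away from the cut of the logarithm.
  let h : ℂ → ℝ := fun w ↦ P / (2 * Real.pi) *
    (Complex.arg z₀ + (Complex.log (w * (starRingEnd ℂ) z₀)).im)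
  have h1 : ((z₀ : ℂ) * (starRingEnd ℂ) z₀) = 1 := by simp [Complex.mul_conj]
  have hh : ContDiffAt ℝ r h z₀ := by
    have h2 : ContDiffAt ℝ r Complex.log ((z₀ : ℂ) * (starRingEnd ℂ) z₀) := by
      rw [h1]
      exact ((Complex.contDiffAt_log (by simp)).restrict_scalars ℝ)
    have h3 : ContDiffAt ℝ r (fun w : ℂ ↦ w * (starRingEnd ℂ) z₀) z₀ := by fun_prop
    have h4 : ContDiffAt ℝ r (fun w : ℂ ↦ Complex.log (w * (starRingEnd ℂ) z₀)) z₀ :=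
      ContDiffAt.comp (g := Complex.log) (z₀ : ℂ) h2 h3
    have h5 : ContDiffAt ℝ r (fun w : ℂ ↦ (Complex.log (w * (starRingEnd ℂ) z₀)).im) z₀ :=
      Complex.imCLM.contDiff.contDiffAt.comp (z₀ : ℂ) h4
    exact contDiffAt_const.mul (contDiffAt_const.add h5)
  have : Fact (Module.finrank ℝ ℂ = 1 + 1) := finrank_real_complex_fact'
  have hcoe : ContMDiff (𝓡 1) 𝓘(ℝ, ℂ) r (fun z : Circle ↦ (z : ℂ)) := contMDiff_coe_sphere
  have hc : ContMDiffAt (𝓡 1) 𝓘(ℝ, ℝ) r (fun z : Circle ↦ h z) z₀ :=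
    ContMDiffAt.comp (g := h) z₀ hh.contMDiffAt hcoe.contMDiffAt
  have heq : circleMap Γ P = fun z : Circle ↦ Γ (h z) := by
    funext z
    rw [← circleMap_exp hP hΓ]
    congr 1
    have : (z : ℂ) * (starRingEnd ℂ) z₀ = ((z * z₀⁻¹ : Circle) : ℂ) := by
      rw [Circle.coe_mul, Circle.coe_inv_eq_conj]
    rw [Circle.exp_add, Circle.exp_arg, this, Complex.log_im, Circle.exp_arg]
    simp
  rw [heq]
  exact ContMDiffAt.comp (g := Γ) z₀ (hr _) hc

/-- The curve `e ∘ circleMap ∘ exp` has nonzero velocity. As the tangent space of the circle is a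
line, a nonzero kernel vector would force this velocity to vanish. -/
theorem injective_mfderiv_circleMap [TopologicalSpace M] [ChartedSpace E3 M]
    {Γ : ℝ → M} {P : ℝ} (hP : 0 < P)
    (hΓ : ∀ s t, Γ s = Γ t ↔ ∃ k : ℤ, t = s + k * P)
    {F : Type*} [NormedAddCommGroup F] [InnerProductSpace ℝ F]
    {r : ℕ∞} (hr1 : 1 ≤ r) (hr : ∀ s, ContMDiffAt 𝓘(ℝ, ℝ) (𝓡 3) r Γ s)
    {e : M → F} (he : ContMDiff (𝓡 3) 𝓘(ℝ, F) ∞ e) (hu : ∀ s, IsUnitSpeedAt e Γ s) (z : Circle) :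
    Function.Injective (mfderiv (𝓡 1) (𝓡 3) (circleMap Γ P) z) := by
  have hr1' : (1 : ℕ∞ω) ≤ r := WithTop.coe_le_coe.2 hr1
  set θ := Complex.arg z
  have hz : Circle.exp θ = z := Circle.exp_arg z
  obtain ⟨-, v, hv, hd⟩ := hu (P / (2 * Real.pi) * θ)
  have hpos : 0 < P / (2 * Real.pi) := by positivity
  have h1 : HasDerivAt (fun t ↦ e (circleMap Γ P (Circle.exp t))) ((P / (2 * Real.pi)) • v) θ := by
    simp only [circleMap_exp hP hΓ]
    exact HasDerivAt.scomp (g₁ := fun s ↦ e (Γ s)) θ hd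
      (by simpa using (hasDerivAt_id θ).const_mul (P / (2 * Real.pi)))
  have hγ : MDifferentiableAt (𝓡 1) (𝓡 3) (circleMap Γ P) (Circle.exp θ) :=
    ((contMDiff_circleMap hP hΓ hr).mdifferentiable (by positivity)) _
  have hexp : MDifferentiableAt 𝓘(ℝ, ℝ) (𝓡 1) Circle.exp θ :=
    (contMDiff_circleExp (m := 1)).mdifferentiable (by norm_num) _
  have he' : MDifferentiableAt (𝓡 3) 𝓘(ℝ, F) e (circleMap Γ P (Circle.exp θ)) :=
    he.mdifferentiable (by simp) _
  let T₁ : ℝ →L[ℝ] EuclideanSpace ℝ (Fin 1) := mfderiv 𝓘(ℝ, ℝ) (𝓡 1) Circle.exp θ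
  let T₂ : EuclideanSpace ℝ (Fin 1) →L[ℝ] E3 :=
    mfderiv (𝓡 1) (𝓡 3) (circleMap Γ P) (Circle.exp θ)
  let T₃ : E3 →L[ℝ] F := mfderiv (𝓡 3) 𝓘(ℝ, F) e (circleMap Γ P (Circle.exp θ))
  have h2 : HasFDerivAt (fun t ↦ e (circleMap Γ P (Circle.exp t))) (T₃.comp (T₂.comp T₁)) θ :=
    (he'.hasMFDerivAt.comp θ (hγ.hasMFDerivAt.comp θ hexp.hasMFDerivAt)).hasFDerivAt
  have h3 : T₃ (T₂ (T₁ 1)) = (P / (2 * Real.pi)) • v := h2.hasDerivAt.unique h1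
  have h4 : Function.Injective T₂ := by
    refine (injective_iff_map_eq_zero _).2 fun w hw ↦ ?_
    by_contra hw0
    obtain ⟨k, hk⟩ := exists_smul_eq_of_finrank_eq_one (K := ℝ) finrank_euclideanSpace_fin hw0
      (T₁ 1)
    rw [← hk, map_smul, hw, smul_zero, map_zero] at h3
    have : v = 0 := (smul_eq_zero.1 h3.symm).resolve_left hpos.ne'
    simp [this] at hv
  rw [← hz]
  exact h4

/-- This is the derivative of the identity `X ∘ γ = 0`, read in the preferred chart around `γ z`. It
allows the transverse invariants to be computed from the full linearization. -/
theorem linearization_comp_mfderiv_eq_zero [TopologicalSpace M] [ChartedSpace E3 M]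
    [IsManifold (𝓡 3) ∞ M] {X : ∀ q : M, TangentSpace (𝓡 3) q} {γ : Circle → M} {z : Circle}
    (hγ : MDifferentiableAt (𝓡 1) (𝓡 3) γ z) (hX : ∀ w, X (γ w) = 0)
    (hd : DifferentiableAt ℝ (localRep X (γ z)) (chartAt E3 (γ z) (γ z))) :
    tangentLine γ z ≤ LinearMap.ker (linearization X (γ z)) := by
  have h1 : HasFDerivAt (writtenInExtChartAt (𝓡 1) (𝓡 3) z γ)
      (mfderiv (𝓡 1) (𝓡 3) γ z : EuclideanSpace ℝ (Fin 1) →L[ℝ] E3) (extChartAt (𝓡 1) z z) := by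
    refine HasFDerivWithinAt.hasFDerivAt hγ.hasMFDerivAt.2 ?_
    rw [modelWithCornersSelf_coe, range_id]
    exact univ_mem
  have h2 : writtenInExtChartAt (𝓡 1) (𝓡 3) z γ (extChartAt (𝓡 1) z z) =
      chartAt E3 (γ z) (γ z) := by simp [writtenInExtChartAt]
  have h3 := HasFDerivAt.comp (g := localRep X (γ z)) (extChartAt (𝓡 1) z z)
    (by rw [h2]; exact hd.hasFDerivAt) h1
  have h4 : (fun y ↦ localRep X (γ z) (writtenInExtChartAt (𝓡 1) (𝓡 3) z γ y))
      =ᶠ[𝓝 (extChartAt (𝓡 1) z z)] fun _ ↦ 0 := by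
    have h5 : Tendsto (extChartAt (𝓡 1) z).symm (𝓝 (extChartAt (𝓡 1) z z)) (𝓝 z) := by
      have := continuousAt_extChartAt_symm (I := 𝓡 1) z
      rwa [ContinuousAt, extChartAt_to_inv] at this
    filter_upwards [(hγ.continuousAt.tendsto.comp h5).eventually
      ((chartAt E3 (γ z)).open_source.mem_nhds (mem_chart_source E3 (γ z)))] with y hy
    exact (localRep_eq_zero_iff X hy).2 (hX _)
  have h5 := (h3.congr_of_eventuallyEq h4.symm).unique (hasFDerivAt_const _ _)
  rintro _ ⟨w, rfl⟩
  exact DFunLike.congr_fun h5 w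

theorem HasTransverseInvariants.hasTransversallyHyperbolicLink [TopologicalSpace M]
    [ChartedSpace E3 M] [IsManifold (𝓡 3) ∞ M] [T2Space M] [CompactSpace M] {r : ℕ∞} (hr : 2 ≤ r)
    {η : PlaneField M r} {X : η.Section} (hX : HasTransverseInvariants X.field) :
    HasTransversallyHyperbolicLink r X.field := by
  have hr1 : (1 : ℕ∞) ≤ r := le_trans (by norm_num) hr
  have hr1' : (1 : ℕ∞ω) ≤ r := WithTop.coe_le_coe.2 hr1
  obtain ⟨m, e, he, -, hinj⟩ := exists_embedding_euclidean_of_compact (I := 𝓡 3) (M := M)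
  obtain ⟨n, Γ, P, hP, hΓ, hper, hdisj, hL⟩ := exists_closed_unitSpeed hr hX he hinj
  have hrange : ∀ i, range (circleMap (Γ i) (P i)) = range (Γ i) := fun i ↦
    range_circleMap (hP i) (hper i)
  have hγ : ∀ i, ContMDiff (𝓡 1) (𝓡 3) r (circleMap (Γ i) (P i)) := fun i ↦
    contMDiff_circleMap (hP i) (hper i) fun s ↦ (hΓ i s).1
  have himm : ∀ i z, Function.Injective (mfderiv (𝓡 1) (𝓡 3) (circleMap (Γ i) (P i)) z) :=
    fun i ↦ injective_mfderiv_circleMap (hP i) (hper i) hr1 (fun s ↦ (hΓ i s).1) he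
      fun s ↦ (hΓ i s).2
  have hzero : ∀ i z, X.field (circleMap (Γ i) (P i) z) = 0 := fun i z ↦
    (hL.ge (mem_iUnion_of_mem i (mem_range_self _)) :)
  refine ⟨n, fun i ↦ circleMap (Γ i) (P i), ⟨hγ, fun i ↦ injective_circleMap (hP i) (hper i), himm,
    fun i j hij ↦ ?_⟩, ?_, (hX.finite hr).subset ?_⟩
  · simpa only [hrange] using hdisj hij
  · simp only [hrange, hL]
  · rintro _ ⟨i, z, rfl, hz⟩
    refine ⟨hzero i z, ?_⟩
    -- Away from the finite set both invariants are nonzero, and the tangent line lies in the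
    -- kernel; the transverse endomorphism is then hyperbolic by linear algebra.
    by_contra! hne
    have hker := linearization_comp_mfderiv_eq_zero (z := z)
      ((hγ i).mdifferentiable (by positivity) z) (hzero i)
      (X.differentiableAt hr (mem_chart_target E3 _))
    have hle : tangentLine (circleMap (Γ i) (P i)) z ≤ (tangentLine (circleMap (Γ i) (P i)) z).comap
        (linearization X.field (circleMap (Γ i) (P i) z)) := fun v hv ↦ by
      rw [Submodule.mem_comap, LinearMap.mem_ker.1 (hker hv)]
      exact Submodule.zero_mem _
    refine hz ⟨hle, isHyperbolicLinear_mapQ ?_ _ _ hker ?_ hle hne.1 hne.2⟩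
    · exact finrank_euclideanSpace_fin
    · exact (LinearMap.finrank_range_of_inj (himm i z)).trans finrank_euclideanSpace_fin

end Circles

end PlaneFieldFlow

end

theorem mainTheorem10 (M : Type*) [TopologicalSpace M] [T2Space M] [CompactSpace M]
    [ChartedSpace PlaneFieldFlow.E3 M] [IsManifold (𝓡 3) ∞ M]
    (r : ℕ∞) (hr : 2 ≤ r) (η : PlaneFieldFlow.PlaneField M r) :
    {X : η.Section | PlaneFieldFlow.HasTransversallyHyperbolicLink r X.field} ∈
      residual η.Section := by
  filter_upwards [PlaneFieldFlow.residual_isTransverseOn hr η] with X hX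
  exact PlaneFieldFlow.HasTransverseInvariants.hasTransversallyHyperbolicLink hr hX
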